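/- Timed automata here have a single clock $x$ ranging over $\mathbb{R}_{\ge 0}$. Clock constraints are generated by $x<c$, $x\le c$ ($c\in\mathbb{N}$), conjunction and negation. An infinite timed word over a finite alphabet $\Sigma$ is a sequence $(a_0,t_0)(a_1,t_1)\ldots$ with $a_i\in\Sigma$, $t_i\in\mathbb{R}_{\ge 0}$ and $t_0<t_1<\cdots$, where $t_i$ is the time elapsed from the beginning of the word to the reading of $a_i$ (the $t_i$ are not required to be unbounded). A (standard) one-clock nondeterministic Büchi timed automaton has a finite set $Q$ of locations, an initial location, a set $F\subseteq Q$ of accepting locations, and finitely many rules $\langle q,a,\sigma,q',r\rangle$ with $q,q'\in Q$, $a\in\Sigma$, $\sigma$ a clock constraint and $r\subseteq\{x\}$: in location $q$, when $a$ is read and the current clock value satisfies $\sigma$, the automaton may move to $q'$, resetting to $0$ the clocks in $r$. It starts in the initial location with clock value $0$, and accepts an infinite timed word iff some run on it visits $F$ infinitely often. A one-clock alternating Büchi timed automaton has instead a finite partial function $\delta$ assigning to triples $(q,a,\sigma)$ positive Boolean formulas (built with $\wedge$ and $\vee$) over $Q\times\mathcal{P}(\{x\})$, such that for all $q$ and $a$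 the constraints $\sigma$ with $\delta(q,a,\sigma)$ defined form a partition of $\mathbb{R}_{\ge 0}$ into nonempty sets. It accepts an infinite timed word iff Eve has a winning strategy in the following game against Adam: when the next letter $a$ is read in location $q$, the formula $\delta(q,a,\sigma)$, for the unique $\sigma$ satisfied by the current clock value, is resolved to an element $(q',r)$, with Eve choosing at disjunctions and Adam at conjunctions; the game proceeds to location $q'$ with the clocks in $r$ reset to $0$. Eve wins an infinite play iff $F$ is visited infinitely often. The automaton is purely existential if no conjunction occurs in $\delta$. **Theorem.** The universality problem for one-clock nondeterministic Büchi timed automata (given an automaton, does it accept all infinite timed words over its alphabet?) is undecidable. This holds both for the standard nondeterministic automata and for the purely existential alternating automata. Moreover, the emptiness problem for one-clock alternating Büchi timed automata (given an automaton, does it accept no infinite timed word?) is undecidable. -/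

import Mathlib

open scoped NNReal

namespace TimedAut

/-! ### Syntax: clock constraints and positive boolean formulas -/

/-- Clock constraints over a single clock `x`: `x < c`, `x ≤ c`, negation and conjunction,
with constants `c ∈ ℕ`. -/
inductive Guard : Type
  | lt (c : ℕ) : Guard
  | le (c : ℕ) : Guard
  | neg (g : Guard) : Guard
  | and (g h : Guard) : Guard

/-- `g.Sat v`: the clock value `v` satisfies the constraint `g`. -/
def Guard.Sat : Guard → ℝ≥0 → Prop
  | .lt c, v => v < (c : ℝ≥0)
  | .le c, v => v ≤ (c : ℝ≥0)
  | .neg g, v => ¬ g.Sat v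
  | .and g h, v => g.Sat v ∧ h.Sat v

/-- Positive boolean formulas over the set `Q × 𝒫({x})` of propositions: the proposition
`atom q r` is the pair of the location `q` and the set of clocks to be reset, which is `{x}` if
`r = true` and `∅` if `r = false`. -/
inductive PosForm : Type
  | atom (q : ℕ) (r : Bool) : PosForm
  | and (b c : PosForm) : PosForm
  | or (b c : PosForm) : PosForm

/-- All locations occurring in the formula are among `0, …, n - 1`. -/
def PosForm.LocsBelow (n : ℕ) : PosForm → Prop
  | .atom q _ => q < n
  | .and b c => b.LocsBelow n ∧ c.LocsBelow n
  | .or b c => b.LocsBelow n ∧ c.LocsBelow n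

/-- No conjunction occurs in the formula. -/
def PosForm.ConjFree : PosForm → Prop
  | .atom _ _ => True
  | .and _ _ => False
  | .or b c => b.ConjFree ∧ c.ConjFree

/-! ### Effective numberings of the syntax, so that it can be the input of an algorithm -/

/-- Code of a constraint as a natural number. -/
def Guard.toNat : Guard → ℕ
  | .lt c => 4 * c
  | .le c => 4 * c + 1
  | .neg g => 4 * g.toNat + 2
  | .and g h => 4 * Nat.pair g.toNat h.toNat + 3

/-- The constraint with a given code. -/
def Guard.ofNat (n : ℕ) : Guard :=
  if h0 : n % 4 = 0 then .lt (n / 4)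
  else if h1 : n % 4 = 1 then .le (n / 4)
  else if h2 : n % 4 = 2 then .neg (Guard.ofNat (n / 4))
  else
    have h3 : n / 4 < n := by omega
    have : (n / 4).unpair.1 < n := lt_of_le_of_lt (Nat.unpair_left_le _) h3
    have : (n / 4).unpair.2 < n := lt_of_le_of_lt (Nat.unpair_right_le _) h3
    .and (Guard.ofNat (n / 4).unpair.1) (Guard.ofNat (n / 4).unpair.2)
termination_by n
decreasing_by all_goals omega

theorem Guard.ofNat_toNat (g : Guard) : Guard.ofNat g.toNat = g := by
  induction g with
  | lt c => rw [Guard.ofNat]; simp [Guard.toNat]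
  | le c =>
    have h1 : (4 * c + 1) % 4 = 1 := by omega
    have h2 : (4 * c + 1) / 4 = c := by omega
    rw [Guard.ofNat]; simp [Guard.toNat, h1, h2]
  | neg g ih =>
    have h1 : (4 * g.toNat + 2) % 4 = 2 := by omega
    have h2 : (4 * g.toNat + 2) / 4 = g.toNat := by omega
    rw [Guard.ofNat]; simp [Guard.toNat, h1, h2, ih]
  | and g h ih1 ih2 =>
    have h1 : (4 * Nat.pair g.toNat h.toNat + 3) % 4 = 3 := by omega
    have h2 : (4 * Nat.pair g.toNat h.toNat + 3) / 4 = Nat.pair g.toNat h.toNat := by omega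
    rw [Guard.ofNat]; simp [Guard.toNat, h1, h2, ih1, ih2]

theorem Guard.toNat_ofNat (n : ℕ) : (Guard.ofNat n).toNat = n := by
  induction n using Nat.strong_induction_on with
  | _ n ih =>
    rw [Guard.ofNat]
    split_ifs with h0 h1 h2
    · simp only [Guard.toNat]; omega
    · simp only [Guard.toNat]; omega
    · simp only [Guard.toNat]; rw [ih _ (by omega)]; omega
    · have h3 : n / 4 < n := by omega
      simp only [Guard.toNat]
      rw [ih _ (lt_of_le_of_lt (Nat.unpair_left_le _) h3),
        ih _ (lt_of_le_of_lt (Nat.unpair_right_le _) h3), Nat.pair_unpair]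
      omega

instance : Denumerable Guard :=
  Denumerable.mk' ⟨Guard.toNat, Guard.ofNat, Guard.ofNat_toNat, Guard.toNat_ofNat⟩

/-- Code of a positive boolean formula as a natural number. -/
def PosForm.toNat : PosForm → ℕ
  | .atom q false => 4 * q
  | .atom q true => 4 * q + 1
  | .and b c => 4 * Nat.pair b.toNat c.toNat + 2
  | .or b c => 4 * Nat.pair b.toNat c.toNat + 3

/-- The positive boolean formula with a given code. -/
def PosForm.ofNat (n : ℕ) : PosForm :=
  if h0 : n % 4 = 0 then .atom (n / 4) false
  else if h1 : n % 4 = 1 then .atom (n / 4) true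
  else
    have h3 : n / 4 < n := by omega
    have : (n / 4).unpair.1 < n := lt_of_le_of_lt (Nat.unpair_left_le _) h3
    have : (n / 4).unpair.2 < n := lt_of_le_of_lt (Nat.unpair_right_le _) h3
    if n % 4 = 2 then .and (PosForm.ofNat (n / 4).unpair.1) (PosForm.ofNat (n / 4).unpair.2)
    else .or (PosForm.ofNat (n / 4).unpair.1) (PosForm.ofNat (n / 4).unpair.2)
termination_by n
decreasing_by all_goals omega

theorem PosForm.ofNat_toNat (b : PosForm) : PosForm.ofNat b.toNat = b := by
  induction b with
  | atom q r =>
    cases r with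
    | false => rw [PosForm.ofNat]; simp [PosForm.toNat]
    | true =>
      have h1 : (4 * q + 1) % 4 = 1 := by omega
      have h2 : (4 * q + 1) / 4 = q := by omega
      rw [PosForm.ofNat]; simp [PosForm.toNat, h1, h2]
  | and g h ih1 ih2 =>
    have h1 : (4 * Nat.pair g.toNat h.toNat + 2) % 4 = 2 := by omega
    have h2 : (4 * Nat.pair g.toNat h.toNat + 2) / 4 = Nat.pair g.toNat h.toNat := by omega
    rw [PosForm.ofNat]; simp [PosForm.toNat, h1, h2, ih1, ih2]
  | or g h ih1 ih2 =>
    have h1 : (4 * Nat.pair g.toNat h.toNat + 3) % 4 = 3 := by omega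
    have h2 : (4 * Nat.pair g.toNat h.toNat + 3) / 4 = Nat.pair g.toNat h.toNat := by omega
    rw [PosForm.ofNat]; simp [PosForm.toNat, h1, h2, ih1, ih2]

theorem PosForm.toNat_ofNat (n : ℕ) : (PosForm.ofNat n).toNat = n := by
  induction n using Nat.strong_induction_on with
  | _ n ih =>
    rw [PosForm.ofNat]
    split_ifs with h0 h1 h2
    · simp only [PosForm.toNat]; omega
    · simp only [PosForm.toNat]; omega
    all_goals
      have h3 : n / 4 < n := by omega
      simp only [PosForm.toNat]
      rw [ih _ (lt_of_le_of_lt (Nat.unpair_left_le _) h3),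
        ih _ (lt_of_le_of_lt (Nat.unpair_right_le _) h3), Nat.pair_unpair]
      omega

instance : Denumerable PosForm :=
  Denumerable.mk' ⟨PosForm.toNat, PosForm.ofNat, PosForm.ofNat_toNat, PosForm.toNat_ofNat⟩

/-! ### One-clock automata as finite objects -/

/-- A transition rule `source, letter, guard ↦ target`. -/
structure Rule (T : Type) where
  source : ℕ
  letter : ℕ
  guard : Guard
  target : T

/-- The data of a one-clock automaton, with set of locations `Q = {0, …, numLocs - 1}`, input
alphabet `{0, …, numLetters - 1}`, initial location `init`, set of accepting locations `acc`, and
finite set `rules` of transition rules. -/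
structure Automaton (T : Type) where
  numLocs : ℕ
  numLetters : ℕ
  init : ℕ
  acc : List ℕ
  rules : List (Rule T)

def Rule.equivProd (T : Type) : Rule T ≃ ℕ × ℕ × Guard × T where
  toFun r := (r.source, r.letter, r.guard, r.target)
  invFun p := ⟨p.1, p.2.1, p.2.2.1, p.2.2.2⟩
  left_inv _ := rfl
  right_inv _ := rfl

instance (T : Type) [Primcodable T] : Primcodable (Rule T) :=
  Primcodable.ofEquiv _ (Rule.equivProd T)

def Automaton.equivProd (T : Type) :
    Automaton T ≃ ℕ × ℕ × ℕ × List ℕ × List (Rule T) where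
  toFun A := (A.numLocs, A.numLetters, A.init, A.acc, A.rules)
  invFun p := ⟨p.1, p.2.1, p.2.2.1, p.2.2.2.1, p.2.2.2.2⟩
  left_inv _ := rfl
  right_inv _ := rfl

instance (T : Type) [Primcodable T] : Primcodable (Automaton T) :=
  Primcodable.ofEquiv _ (Automaton.equivProd T)

/-- A rule `⟨q, a, σ, (q', r)⟩` of a nondeterministic automaton: in location `q`, on reading
`a` with the clock satisfying `σ`, go to `q'`, and reset the clock iff `r = true`. -/
abbrev NTA : Type := Automaton (ℕ × Bool)

/-- A rule `⟨q, a, σ, b⟩` of an alternating automaton says that `δ(q, a, σ) = b`. -/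
abbrev ATA : Type := Automaton PosForm

/-- `A` is a one-clock nondeterministic timed automaton: all its data are in range. -/
structure NTA.Valid (A : NTA) : Prop where
  init_lt : A.init < A.numLocs
  acc_lt : ∀ q ∈ A.acc, q < A.numLocs
  rules_lt : ∀ ρ ∈ A.rules,
    ρ.source < A.numLocs ∧ ρ.letter < A.numLetters ∧ ρ.target.1 < A.numLocs

/-- `A` is a one-clock alternating timed automaton: all its data are in range, its rules define
a partial function of `(q, a, σ)`, and for all `q` and `a` the constraints `σ` such that
`δ(q, a, σ)` is defined form a partition of `ℝ≥0`. -/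
structure ATA.Valid (A : ATA) : Prop where
  init_lt : A.init < A.numLocs
  acc_lt : ∀ q ∈ A.acc, q < A.numLocs
  rules_lt : ∀ ρ ∈ A.rules,
    ρ.source < A.numLocs ∧ ρ.letter < A.numLetters ∧ ρ.target.LocsBelow A.numLocs
  functional : ∀ ρ ∈ A.rules, ∀ ρ' ∈ A.rules,
    ρ.source = ρ'.source → ρ.letter = ρ'.letter → ρ.guard = ρ'.guard → ρ.target = ρ'.target
  guard_nonempty : ∀ ρ ∈ A.rules, ∃ v : ℝ≥0, ρ.guard.Sat v
  partition : ∀ q < A.numLocs, ∀ a < A.numLetters, ∀ v : ℝ≥0,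
    ∃! σ : Guard, (∃ b : PosForm, (⟨q, a, σ, b⟩ : Rule PosForm) ∈ A.rules) ∧ σ.Sat v

/-- `A` is purely existential: no conjunction appears in its transition rules. -/
def ATA.PurelyExistential (A : ATA) : Prop :=
  ∀ ρ ∈ A.rules, ρ.target.ConjFree

/-! ### Infinite timed words -/

/-- Infinite timed words `(a₀, t₀) (a₁, t₁) …` over an alphabet with `m` letters: `tᵢ ∈ ℝ≥0` is
the time elapsed from the beginning of the word to the reading of `aᵢ`, and `t₀ < t₁ < …`. -/
structure TimedWord (m : ℕ) where
  letter : ℕ → Fin m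
  time : ℕ → ℝ≥0
  time_strictMono : StrictMono time

/-- The time that passes immediately before the letter number `k` is read. -/
noncomputable def TimedWord.delay {m : ℕ} (w : TimedWord m) : ℕ → ℝ≥0
  | 0 => w.time 0
  | k + 1 => w.time (k + 1) - w.time k

/-- The clock value after a transition: `0` if the clock is reset, otherwise unchanged. -/
def applyReset (r : Bool) (v : ℝ≥0) : ℝ≥0 := if r then 0 else v

/-! ### Büchi acceptance for nondeterministic automata -/

/-- `run k = (qₖ, vₖ)` is a run of `A` over `w`. -/
def NTA.IsRun (A : NTA) (w : TimedWord A.numLetters) (run : ℕ → ℕ × ℝ≥0) : Prop :=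
  run 0 = (A.init, 0) ∧
  ∀ k : ℕ, ∃ ρ ∈ A.rules,
    ρ.source = (run k).1 ∧
    ρ.letter = (w.letter k : ℕ) ∧
    ρ.guard.Sat ((run k).2 + w.delay k) ∧
    run (k + 1) = (ρ.target.1, applyReset ρ.target.2 ((run k).2 + w.delay k))

/-- Some run over `w` visits accepting locations infinitely often. -/
def NTA.Accepts (A : NTA) (w : TimedWord A.numLetters) : Prop :=
  ∃ run : ℕ → ℕ × ℝ≥0, A.IsRun w run ∧ ∀ N : ℕ, ∃ k ≥ N, (run k).1 ∈ A.acc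

/-! ### The acceptance game of an alternating automaton -/

/-- Positions of the acceptance game: either the phase that reads letter number `k` starts in the
configuration `(q, v)`, or, within this phase, the formula `b` is left to be resolved, where `v`
is the clock value when the letter is read. -/
inductive Pos : Type
  | conf (k : ℕ) (q : ℕ) (v : ℝ≥0) : Pos
  | form (k : ℕ) (v : ℝ≥0) (b : PosForm) : Pos

/-- Legal moves of the game. -/
inductive ATA.Move (A : ATA) (w : TimedWord A.numLetters) : Pos → Pos → Prop
  | read (k q : ℕ) (v : ℝ≥0) (σ : Guard) (b : PosForm)
      (hrule : (⟨q, (w.letter k : ℕ), σ, b⟩ : Rule PosForm) ∈ A.rules)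
      (hsat : σ.Sat (v + w.delay k)) :
      ATA.Move A w (.conf k q v) (.form k (v + w.delay k) b)
  | and_left (k : ℕ) (v : ℝ≥0) (b c : PosForm) :
      ATA.Move A w (.form k v (.and b c)) (.form k v b)
  | and_right (k : ℕ) (v : ℝ≥0) (b c : PosForm) :
      ATA.Move A w (.form k v (.and b c)) (.form k v c)
  | or_left (k : ℕ) (v : ℝ≥0) (b c : PosForm) :
      ATA.Move A w (.form k v (.or b c)) (.form k v b)
  | or_right (k : ℕ) (v : ℝ≥0) (b c : PosForm) :
      ATA.Move A w (.form k v (.or b c)) (.form k v c)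
  | atom (k : ℕ) (v : ℝ≥0) (q : ℕ) (r : Bool) :
      ATA.Move A w (.form k v (.atom q r)) (.conf (k + 1) q (applyReset r v))

/-- An infinite play. -/
def ATA.IsPlay (A : ATA) (w : TimedWord A.numLetters) (π : ℕ → Pos) : Prop :=
  π 0 = .conf 0 A.init 0 ∧ ∀ i : ℕ, A.Move w (π i) (π (i + 1))

/-- A strategy of Eve: for a finite play ending in a disjunction (the positions where Eve is to
move) it selects the left disjunct (`true`) or the right disjunct (`false`). -/
abbrev EveStrategy : Type := List Pos → Bool

/-- Eve follows the strategy `s` in the play `π`. -/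
def Follows (s : EveStrategy) (π : ℕ → Pos) : Prop :=
  ∀ (i k : ℕ) (v : ℝ≥0) (b c : PosForm), π i = .form k v (.or b c) →
    π (i + 1) = .form k v (if s ((List.range (i + 1)).map π) then b else c)

/-- Eve wins the play `π`: accepting locations appear infinitely often. -/
def ATA.EveWins (A : ATA) (π : ℕ → Pos) : Prop :=
  ∀ N : ℕ, ∃ i ≥ N, ∃ (k q : ℕ) (v : ℝ≥0), π i = .conf k q v ∧ q ∈ A.acc

/-- Eve has a winning strategy in the acceptance game over `w`. -/
def ATA.Accepts (A : ATA) (w : TimedWord A.numLetters) : Prop :=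
  ∃ s : EveStrategy, ∀ π : ℕ → Pos, A.IsPlay w π → Follows s π → A.EveWins π

/-! ### Decision problems -/

/-- The problem "given `A` in the class `C`, does `P A` hold?" is decidable: some algorithm
terminates with the right answer on every input from `C` (its behaviour on inputs outside of `C`
is arbitrary). -/
def DecidableOn {α : Type} [Primcodable α] (C P : α → Prop) : Prop :=
  ∃ f : α →. Bool, Partrec f ∧ ∀ A : α, C A → ∃ b ∈ f A, (b = true ↔ P A)

/-- All infinite timed words are accepted. -/
def NTA.Universal (A : NTA) : Prop := ∀ w : TimedWord A.numLetters, A.Accepts w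

/-- All infinite timed words are accepted. -/
def ATA.Universal (A : ATA) : Prop := ∀ w : TimedWord A.numLetters, A.Accepts w

/-- No infinite timed word is accepted. -/
def ATA.Empty (A : ATA) : Prop := ∀ w : TimedWord A.numLetters, ¬ A.Accepts w

end TimedAut

open scoped NNReal
namespace TimedAut

/-! ### A Turing machine whose halting on unary inputs is undecidable -/

/-! The undecidable problem that gets reduced is the halting of one fixed Turing machine on the
tapes formed by a symbol `a` and `n + 1` copies of a symbol `u` (`exists_undecidable_machine`). The
machine is turned into a cellular automaton `B` with a global control, for which the input is merely
the time at which the control is switched on (`exists_undecidable_cellAut`). In the timed automata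
that result, the input occurs only as the constant of one clock comparison, which makes the
reduction plainly computable.

A timed word describes a computation of `B` by rows of duration one, in which each cell is repeated,
after an update, exactly one time unit later. With one clock, a nondeterministic automaton can guess
a cell and discover that its copy is missing or wrong, but it cannot discover a cell that has no
original. The words without discoverable errors (`CellAut.Good`) are therefore computations with
insertion errors, and the encoding has to make these errors harmless.

To this end each row has a prefix of cells that are switched on, and the prefix computes in phases.
A phase ends when a mark that starts at the right end of the prefix and moves left by one cell per
row has reached the first cell. The prefix does not shrink during a phase, and loses at most one
cell at its end. Infinitely often there must be a row of kind `super`, whose prefix is empty; its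
successor is longer and has copies of all its cells switched on. Hence, for each `K > 0`, the prefix
has at some time at least `K` cells and must later shrink to nothing. In the last phase before that
which starts with at least `K` cells, there are exactly `K` of them in every row, so nothing is
inserted into the prefix (`exists_exact_phase`). This phase simulates `B` correctly in a window of
`K` cells for `K` steps, during which halting is forbidden (`IsRows.not_halts`). Conversely, if `B`
does not halt, there are rows without any insertion error (`isRows_par`), and they form a good timed
word (`good_letters`). So good words exist exactly if `B` does not halt (`exists_good_iff`).

The automaton `watch` guesses an error and verifies it. Its existential reading accepts the words
that are not good (`exists_run_iff`), so it is universal exactly if `B` halts. Its reading with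
conjunctions in place of disjunctions, and with the locations `Safe` accepting, accepts the good
words (`forall_run_iff`), so it is empty exactly if `B` halts. The passage to the concrete syntax
and to the acceptance game is made in `toNTA_accepts`, `toATA_accepts_true` and
`toATA_accepts_false`. -/

/-- The number with binary expansion `1 … 1`, of length `n + 1`. -/
def allOnes (n : ℕ) : PosNum := n.rec PosNum.one fun _ m => PosNum.bit1 m

theorem trPosNum_allOnes (n : ℕ) :
    Turing.PartrecToTM2.trPosNum (allOnes n) =
      List.replicate (n + 1) Turing.PartrecToTM2.Γ'.bit1 := by
  induction n with
  | zero => rfl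
  | succ n ih => rw [List.replicate_succ, ← ih]; rfl

theorem trList_allOnes (n : ℕ) :
    Turing.PartrecToTM2.trList [((allOnes n : PosNum) : ℕ)] =
      List.replicate (n + 1) Turing.PartrecToTM2.Γ'.bit1 ++ [Turing.PartrecToTM2.Γ'.cons] := by
  have h : (((allOnes n : PosNum) : ℕ) : Num) = Num.pos (allOnes n) := by
    exact Num.of_to_nat (Num.pos (allOnes n))
  simp only [Turing.PartrecToTM2.trList, Turing.PartrecToTM2.trNat, h,
    Turing.PartrecToTM2.trNum, trPosNum_allOnes]

theorem allOnes_succ (n : ℕ) :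
    ((allOnes (n + 1) : PosNum) : ℕ) = 2 * ((allOnes n : PosNum) : ℕ) + 1 := by
  change ((PosNum.bit1 (allOnes n) : PosNum) : ℕ) = _
  rw [PosNum.cast_bit1]; ring

theorem allOnes_strictMono : StrictMono fun n => ((allOnes n : PosNum) : ℕ) :=
  strictMono_nat_of_lt_succ fun n => by simp only [allOnes_succ]; omega

theorem primrec_allOnes : Primrec fun n => ((allOnes n : PosNum) : ℕ) := by
  have h : Primrec fun n : ℕ =>
      (Nat.rec 1 (fun _ m => 2 * m + 1) n : ℕ) :=
    Primrec.nat_rec₁ 1 (Primrec.succ.comp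
      ((Primrec.nat_mul.comp (Primrec.const 2) Primrec.snd)) : Primrec fun p : ℕ × ℕ => 2 * p.2 + 1).to₂
  refine h.of_eq fun n => ?_
  induction n with
  | zero => rfl
  | succ n ih => rw [allOnes_succ, ← ih]

/-- This lets numbers with constant binary expansion serve as inputs: `g` searches for the `n` that
its argument encodes, and injectivity of `allOnes` makes the search return the right one. -/
theorem exists_partrec_allOnes {f : ℕ →. ℕ} (hf : Partrec f) :
    ∃ g : ℕ →. ℕ, Partrec g ∧ ∀ n, (g ((allOnes n : PosNum) : ℕ)) = f n := by
  have hd : Partrec fun m : ℕ => Nat.rfind fun k =>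
      Part.some (decide (((allOnes k : PosNum) : ℕ) = m)) := by
    refine Partrec.rfind ?_
    have : PrimrecRel fun m k : ℕ => ((allOnes k : PosNum) : ℕ) = m :=
      Primrec.eq.comp₂ (primrec_allOnes.comp₂ Primrec₂.right) Primrec₂.left
    exact (Primrec₂.to_comp this.decide).partrec₂
  refine ⟨_, hd.bind ((hf.comp Computable.snd).to₂), fun n => ?_⟩
  have h : (Nat.rfind fun k =>
      Part.some (decide (((allOnes k : PosNum) : ℕ) = ((allOnes n : PosNum) : ℕ)))) = Part.some n :=
    Part.eq_some_iff.2 (Nat.mem_rfind.2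
      ⟨by simp, fun {m} hm => by simpa using (allOnes_strictMono hm).ne⟩)
  exact (congrArg (fun p => Part.bind p f) h).trans (Part.bind_some _ _)

open Turing in
/-- A machine with a finite set of reachable states is equivalent to one with finitely many
states. -/
theorem exists_finite_machine {Γ Λ : Type} [Inhabited Γ] [Inhabited Λ] (M : TM0.Machine Γ Λ)
    (S : Finset Λ) (hS : TM0.Supports M (S : Set Λ)) :
    ∃ (Λ' : Type) (_ : Inhabited Λ') (_ : Finite Λ') (M' : TM0.Machine Γ Λ'),
      ∀ l, (TM0.eval M' l).Dom ↔ (TM0.eval M l).Dom := by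
  classical
  let iS : Inhabited S := ⟨⟨default, hS.1⟩⟩
  let g₁ : PointedMap Λ S := ⟨fun q => if h : q ∈ S then ⟨q, h⟩ else default, by
    rw [dif_pos (show default ∈ S from hS.1)]; rfl⟩
  let f : PointedMap Γ Γ := ⟨id, rfl⟩
  refine ⟨S, iS, inferInstance, M.map f f g₁ Subtype.val, fun l => ?_⟩
  have hr := TM0.Machine.map_respects M f f g₁ Subtype.val hS (fun _ => rfl)
    (fun q hq => by
      change ((if h : q ∈ S then (⟨q, h⟩ : S) else default : S) : Λ) = q
      rw [dif_pos (show q ∈ S from hq)])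
  have hi : TM0.Cfg.map f g₁ (TM0.init l) = TM0.init l := by
    rw [TM0.map_init]
    exact congrArg TM0.init (List.map_id l)
  exact StateTransition.tr_eval_dom hr (a₁ := TM0.init l) (a₂ := TM0.init l) ⟨hS.1, hi⟩

-- The machine is compiled, through the `TM2` and `TM1` models, from a code for running program
-- number `n` on input `0`, where `n` is presented as `allOnes n`. All information on the tape is
-- then the number of copies of `u`.
open Turing in
theorem exists_undecidable_machine :
    ∃ (Γ Λ : Type) (_ : Inhabited Γ) (_ : Inhabited Λ) (_ : Finite Γ) (_ : Finite Λ)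
      (M : TM0.Machine Γ Λ) (a u : Γ),
      ¬ ComputablePred fun n : ℕ => (TM0.eval M (a :: List.replicate (n + 1) u)).Dom := by
  classical
  obtain ⟨g, hg, hgf⟩ := exists_partrec_allOnes (f := fun n =>
    Nat.Partrec.Code.eval (Denumerable.ofNat Nat.Partrec.Code n) 0)
    (Nat.Partrec.Code.eval_part.comp (Computable.ofNat _) (Computable.const 0))
  have hg' : Nat.Partrec' (fun v : List.Vector ℕ 1 => g v.head) :=
    Nat.Partrec'.part_iff₁.2 hg
  obtain ⟨c, hc⟩ := ToPartrec.Code.exists_code hg'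
  -- Machines start in the default label, so this has to be the entry point of the code `c`.
  let iΛ : Inhabited PartrecToTM2.Λ' := ⟨PartrecToTM2.trNormal c PartrecToTM2.Cont'.halt⟩
  let iK : Fintype PartrecToTM2.K' :=
    ⟨{PartrecToTM2.K'.main, PartrecToTM2.K'.rev, PartrecToTM2.K'.aux, PartrecToTM2.K'.stack},
      fun k => by cases k <;> simp⟩
  have s2 := PartrecToTM2.tr_supports c PartrecToTM2.Cont'.halt
  have s1 := TM2to1.tr_supports PartrecToTM2.tr s2
  have s0 := TM1to0.tr_supports (TM2to1.tr PartrecToTM2.tr) s1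
  obtain ⟨Λ', i1, i2, M', hM'⟩ := exists_finite_machine _ _ s0
  let sym (x : PartrecToTM2.Γ') : TM2to1.Γ' PartrecToTM2.K' (fun _ => PartrecToTM2.Γ') :=
    (false, Function.update (fun _ => none) PartrecToTM2.K'.main (some x))
  refine ⟨_, Λ', inferInstance, i1, inferInstance, i2, M',
    (true, (sym PartrecToTM2.Γ'.cons).2), sym PartrecToTM2.Γ'.bit1, fun h => ?_⟩
  have key : ∀ n, (TM0.eval M' ((true, (sym PartrecToTM2.Γ'.cons).2) ::
      List.replicate (n + 1) (sym PartrecToTM2.Γ'.bit1))).Dom ↔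
      (Nat.Partrec.Code.eval (Denumerable.ofNat Nat.Partrec.Code n) 0).Dom := by
    intro n
    -- `trInit` reverses its list, so the separator `cons` comes first and carries the flag `true`
    -- of the bottom cell.
    have hl : ((true, (sym PartrecToTM2.Γ'.cons).2) ::
        List.replicate (n + 1) (sym PartrecToTM2.Γ'.bit1)) =
        TM2to1.trInit PartrecToTM2.K'.main
          (PartrecToTM2.trList [((allOnes n : PosNum) : ℕ)]) := by
      rw [trList_allOnes, TM2to1.trInit]
      simp only [List.reverse_append, List.reverse_replicate, List.reverse_singleton]
      exact congrArg (List.cons _) List.map_replicate.symm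
    refine (hM' _).trans ((iff_of_eq (congrArg (fun l =>
      (TM0.eval (TM1to0.tr (TM2to1.tr PartrecToTM2.tr)) l).Dom) hl)).trans
      ((iff_of_eq (congrArg Part.Dom (TM1to0.tr_eval _ _))).trans
        ((TM2to1.tr_eval_dom _ _ _).trans ?_)))
    have h1 : TM2.init PartrecToTM2.K'.main (PartrecToTM2.trList [((allOnes n : PosNum) : ℕ)]) =
        PartrecToTM2.init c [((allOnes n : PosNum) : ℕ)] := by
      unfold TM2.init PartrecToTM2.init
      congr 1
      funext k
      cases k <;> rfl
    have h2 := PartrecToTM2.tr_eval c [((allOnes n : PosNum) : ℕ)]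
    have h3 := hc (((allOnes n : PosNum) : ℕ) ::ᵥ List.Vector.nil)
    have h4 : c.eval [((allOnes n : PosNum) : ℕ)] = pure <$> g ((allOnes n : PosNum) : ℕ) := h3
    refine (iff_of_eq (congrArg (fun x =>
      (StateTransition.eval (TM2.step PartrecToTM2.tr) x).Dom) h1)).trans ?_
    rw [h2, h4, hgf]
    rfl
  refine ComputablePred.halting_problem 0 ?_
  obtain ⟨f, hf, hfe⟩ := ComputablePred.computable_iff.1 h
  refine ComputablePred.computable_iff.2 ⟨fun c => f (Encodable.encode c),
    hf.comp Computable.encode, ?_⟩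
  funext c
  rw [← congrFun hfe (Encodable.encode c), key, Denumerable.ofNat_encode]

end TimedAut

namespace TimedAut

/-! ### Cellular automata with a global control -/

/-- One-sided cellular automata whose cells see a global control state `s : S`. The control starts
in `pre`, stays there until it is switched to `start` from outside, and evolves by `ctrl` after
that, depending on the leftmost cell. -/
structure CellAut (S C : Type) where
  blank : C
  pre : S
  start : S
  halt : S → Prop
  ctrl : S → C → S
  cell : S → Option C → C → C → C
  start_ne : start ≠ pre
  ctrl_ne : ∀ s c, s ≠ pre → ctrl s c ≠ pre
  not_halt_pre : ¬ halt pre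

/-- The left neighbour. -/
def leftOf {C : Type} (c : ℕ → C) : ℕ → Option C
  | 0 => none
  | i + 1 => some (c i)

open Classical in
/-- Configuration at time `t` in a window with `K` cells, if the control is switched at time
`n`. -/
noncomputable def CellAut.conf {S C : Type} (B : CellAut S C) (n K : ℕ) : ℕ → S × (ℕ → C)
  | 0 => (B.pre, fun _ => B.blank)
  | t + 1 =>
    (if t + 1 < n then B.pre else if t + 1 = n then B.start
      else B.ctrl (B.conf n K t).1 ((B.conf n K t).2 0),
     fun i => if i < K then B.cell (B.conf n K t).1 (leftOf (B.conf n K t).2 i)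
       ((B.conf n K t).2 i) ((B.conf n K t).2 (i + 1)) else B.blank)

namespace CellAut

variable {S C : Type} (B : CellAut S C) {n K t : ℕ}

theorem conf_fst_of_lt (h : t < n) : (B.conf n K t).1 = B.pre := by
  cases t with
  | zero => rfl
  | succ t => rw [conf, if_pos h]

theorem conf_fst_ne_pre (hn : 0 < n) (h : n ≤ t) : (B.conf n K t).1 ≠ B.pre := by
  induction t with
  | zero => omega
  | succ t ih =>
    rw [conf, if_neg (by omega)]
    split_ifs with h1
    · exact B.start_ne
    · exact B.ctrl_ne _ _ (ih (by omega))

theorem conf_snd_of_le {i : ℕ} (h : K ≤ i) : (B.conf n K t).2 i = B.blank := by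
  cases t with
  | zero => rfl
  | succ t => rw [conf]; exact if_neg (by omega)

theorem conf_snd_succ {i : ℕ} (h : i < K) :
    (B.conf n K (t + 1)).2 i = B.cell (B.conf n K t).1 (leftOf (B.conf n K t).2 i)
      ((B.conf n K t).2 i) ((B.conf n K t).2 (i + 1)) := by
  rw [conf]; exact if_pos h

end CellAut

/-- The automaton halts for some window before time exceeds the size of the window. -/
def CellAut.Halts {S C : Type} (B : CellAut S C) (n : ℕ) : Prop :=
  ∃ K t, t < K ∧ B.halt (B.conf n K t).1

open Turing

/-! ### A Turing machine as a cellular automaton -/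

section machine

variable {Γ Λ : Type} [Inhabited Γ] [Inhabited Λ]

/-- Simulation of a Turing machine: the control knows the state and the scanned symbol, and cell
number `i` holds the symbols at distance `i + 1` to the right and to the left of the head. Before
the switch, copies of `u` are pushed to the right half of the tape. -/
def cellAutOf (M : TM0.Machine Γ Λ) (a u : Γ) : CellAut (Option (Λ × Γ)) (Γ × Γ) where
  blank := (default, default)
  pre := none
  start := some (default, a)
  halt s := ∃ x, s = some x ∧ M x.1 x.2 = none
  ctrl s c := s.bind fun x => match M x.1 x.2 with
    | none => some x
    | some (q', .write b) => some (q', b)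
    | some (q', .move .right) => some (q', c.1)
    | some (q', .move .left) => some (q', c.2)
  cell s l c r := match s with
    | none => ((l.map Prod.fst).getD u, c.2)
    | some x => match M x.1 x.2 with
      | none => c
      | some (_, .write _) => c
      | some (_, .move .right) => (r.1, (l.map Prod.snd).getD x.2)
      | some (_, .move .left) => ((l.map Prod.fst).getD x.2, r.2)
  start_ne := by simp
  ctrl_ne s c hs := by
    cases s with
    | none => exact absurd rfl hs
    | some x =>
      simp only [Option.bind_some]
      split <;> simp
  not_halt_pre := by simp

section

variable (M : TM0.Machine Γ Λ) (a u : Γ)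

theorem cellAutOf_cell_none (l : Option (Γ × Γ)) (c r : Γ × Γ) :
    (cellAutOf M a u).cell none l c r = ((l.map Prod.fst).getD u, c.2) := rfl

variable {M} {q q' : Λ} {b d : Γ} (l : Option (Γ × Γ)) (c r : Γ × Γ)

theorem cellAutOf_cell_write (h : M q b = some (q', .write d)) :
    (cellAutOf M a u).cell (some (q, b)) l c r = c := by
  simp [cellAutOf, h]

theorem cellAutOf_cell_right (h : M q b = some (q', .move .right)) :
    (cellAutOf M a u).cell (some (q, b)) l c r = (r.1, (l.map Prod.snd).getD b) := by
  simp [cellAutOf, h]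

theorem cellAutOf_cell_left (h : M q b = some (q', .move .left)) :
    (cellAutOf M a u).cell (some (q, b)) l c r = ((l.map Prod.fst).getD b, r.2) := by
  simp [cellAutOf, h]

theorem cellAutOf_ctrl_write (h : M q b = some (q', .write d)) :
    (cellAutOf M a u).ctrl (some (q, b)) c = some (q', d) := by
  simp [cellAutOf, h]

theorem cellAutOf_ctrl_right (h : M q b = some (q', .move .right)) :
    (cellAutOf M a u).ctrl (some (q, b)) c = some (q', c.1) := by
  simp [cellAutOf, h]

theorem cellAutOf_ctrl_left (h : M q b = some (q', .move .left)) :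
    (cellAutOf M a u).ctrl (some (q, b)) c = some (q', c.2) := by
  simp [cellAutOf, h]

end

/-- The configuration of the machine after `r` steps. -/
def tmRun (M : TM0.Machine Γ Λ) (l : List Γ) : ℕ → Option (TM0.Cfg Γ Λ)
  | 0 => some (TM0.init l)
  | r + 1 => (tmRun M l r).bind (TM0.step M)

theorem eval_dom_iff_tmRun (M : TM0.Machine Γ Λ) (l : List Γ) :
    (TM0.eval M l).Dom ↔ ∃ r x, tmRun M l r = some x ∧ TM0.step M x = none := by
  have h1 : (TM0.eval M l).Dom ↔ (StateTransition.eval (TM0.step M) (TM0.init l)).Dom := Iff.rfl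
  rw [h1, Part.dom_iff_mem]
  constructor
  · rintro ⟨y, hy⟩
    obtain ⟨hr, hn⟩ := StateTransition.mem_eval.1 hy
    suffices ∃ r, tmRun M l r = some y from ⟨this.choose, y, this.choose_spec, hn⟩
    clear hy hn
    induction hr with
    | refl => exact ⟨0, rfl⟩
    | tail _ h ih =>
      obtain ⟨r, hr⟩ := ih
      exact ⟨r + 1, by rw [tmRun, hr]; exact h⟩
  · rintro ⟨r, x, hr, hx⟩
    refine ⟨x, StateTransition.mem_eval.2 ⟨?_, hx⟩⟩
    clear hx
    induction r generalizing x with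
    | zero => cases hr; exact Relation.ReflTransGen.refl
    | succ r ih =>
      rw [tmRun, Option.bind_eq_some_iff] at hr
      obtain ⟨y, hy, hyx⟩ := hr
      exact (ih y hy).tail hyx

theorem eval_dom_of_tmRun_eq_none (M : TM0.Machine Γ Λ) (l : List Γ) (r : ℕ)
    (h : tmRun M l r = none) : (TM0.eval M l).Dom := by
  rw [eval_dom_iff_tmRun]
  induction r with
  | zero => cases h
  | succ r ih =>
    cases hr : tmRun M l r with
    | none => exact ih hr
    | some x => exact ⟨r, x, hr, by simpa [tmRun, hr] using h⟩

/-- Each step of waiting pushes one more `u` into the right half of the tape, next to the head. This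
converts the time of the switch into the length of the input. -/
theorem conf_pre (M : TM0.Machine Γ Λ) (a u : Γ) (n K t : ℕ) (ht : t < n) :
    ((cellAutOf M a u).conf n K t).1 = none ∧ ∀ i,
      ((cellAutOf M a u).conf n K t).2 i =
        (if i < K ∧ i < t then u else default, default) := by
  induction t with
  | zero => exact ⟨rfl, fun i => by simp [CellAut.conf, cellAutOf]⟩
  | succ t ih =>
    obtain ⟨h1, h2⟩ := ih (by omega)
    refine ⟨by simp [CellAut.conf, ht, cellAutOf], fun i => ?_⟩
    rw [CellAut.conf]
    by_cases hi : i < K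
    · simp only [hi, if_true, h1, cellAutOf_cell_none]
      cases i with
      | zero => simp [leftOf, h2]
      | succ i => simp only [leftOf, Option.map_some, h2]; simp; grind
    · simp [hi, cellAutOf]

theorem conf_start (M : TM0.Machine Γ Λ) (a u : Γ) (n K : ℕ) :
    ((cellAutOf M a u).conf (n + 1) K (n + 1)).1 = some (default, a) ∧ ∀ i < K,
      ((cellAutOf M a u).conf (n + 1) K (n + 1)).2 i =
        (if i < n + 1 then u else default, default) := by
  obtain ⟨h1, h2⟩ := conf_pre M a u (n + 1) K n (by omega)
  refine ⟨by simp [CellAut.conf, cellAutOf], fun i hi => ?_⟩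
  rw [CellAut.conf]
  simp only [hi, if_true, h1, cellAutOf_cell_none]
  cases i with
  | zero => simp [leftOf, h2]
  | succ i => simp only [leftOf, Option.map_some, h2]; simp; grind

/-- Beyond the window all cells are blank, which need not agree with the tape, and this error moves
inwards by at most one cell per step; hence the bound `i + r < K`. The scanned symbol depends only
on cell `0` at the step before, so for the control `r ≤ K` is enough. -/
theorem conf_tmRun (M : TM0.Machine Γ Λ) (a u : Γ) (n K r : ℕ) (x : TM0.Cfg Γ Λ) (hr : r ≤ K)
    (hx : tmRun M (a :: List.replicate (n + 1) u) r = some x) :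
    ((cellAutOf M a u).conf (n + 1) K (n + 1 + r)).1 = some (x.q, x.Tape.head) ∧
      ∀ i, i + r < K → ((cellAutOf M a u).conf (n + 1) K (n + 1 + r)).2 i =
        (x.Tape.nth ((i + 1 : ℕ) : ℤ), x.Tape.nth (Int.negSucc i)) := by
  induction r generalizing x with
  | zero =>
    cases hx
    obtain ⟨h1, h2⟩ := conf_start M a u n K
    refine ⟨h1, fun i hi => ?_⟩
    rw [Nat.add_zero, h2 i (by omega)]
    refine Prod.ext ?_ ?_
    · change _ = (Tape.mk' (ListBlank.mk ([] : List Γ))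
        (ListBlank.mk (a :: List.replicate (n + 1) u))).nth ((i + 1 : ℕ) : ℤ)
      rw [Tape.mk'_nth_nat, ListBlank.nth_mk]
      simp only [List.getI_cons_succ]
      by_cases h : i < n + 1
      · rw [if_pos h, List.getI_eq_getElem _ (by simpa using h)]; simp
      · rw [if_neg h, List.getI_eq_default _ (by simpa using h)]
    · change _ = (ListBlank.mk ([] : List Γ)).nth i
      rw [ListBlank.nth_mk]; simp
  | succ r ih =>
    rw [tmRun, Option.bind_eq_some_iff] at hx
    obtain ⟨y, hy, hyx⟩ := hx
    obtain ⟨h1, h2⟩ := ih y (by omega) hy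
    obtain ⟨q, T⟩ := y
    obtain ⟨⟨q', s⟩, hM, rfl⟩ := Option.map_eq_some_iff.1 hyx
    have hM : M q T.head = some (q', s) := hM
    have h0 := h2 0 (by omega)
    refine ⟨?_, fun i hi => ?_⟩
    · rw [← Nat.add_assoc, CellAut.conf, if_neg (by omega), if_neg (by omega), h1, h0]
      cases s with
      | write b => rw [cellAutOf_ctrl_write _ _ _ hM]; rfl
      | move d =>
        cases d with
        | left =>
          rw [cellAutOf_ctrl_left _ _ _ hM]
          exact congrArg (fun x => some (q', x)) (Tape.move_left_nth T 0).symm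
        | right =>
          rw [cellAutOf_ctrl_right _ _ _ hM]
          exact congrArg (fun x => some (q', x)) (Tape.move_right_nth T 0).symm
    · rw [← Nat.add_assoc, CellAut.conf]
      simp only [show i < K by omega, if_true, h1, h2 i (by omega), h2 (i + 1) (by omega)]
      cases s with
      | write b =>
        rw [cellAutOf_cell_write _ _ _ _ _ hM]
        change _ = ((T.write b).nth _, (T.write b).nth _)
        rw [Tape.write_nth, Tape.write_nth, if_neg (by omega), if_neg (by omega)]
      | move d =>
        cases d with
        | left =>
          rw [cellAutOf_cell_left _ _ _ _ _ hM]
          change _ = ((T.move .left).nth _, (T.move .left).nth _)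
          rw [Tape.move_left_nth, Tape.move_left_nth]
          refine Prod.ext ?_ rfl
          cases i with
          | zero => rfl
          | succ i =>
            simp only [leftOf, Option.map_some, h2 i (by omega), Option.getD_some]
            congr 1
            omega
        | right =>
          rw [cellAutOf_cell_right _ _ _ _ _ hM]
          change _ = ((T.move .right).nth _, (T.move .right).nth _)
          rw [Tape.move_right_nth, Tape.move_right_nth]
          refine Prod.ext rfl ?_
          cases i with
          | zero => rfl
          | succ i =>
            simp only [leftOf, Option.map_some, h2 i (by omega), Option.getD_some]
            congr 1

/-- The condition `t < K` in `Halts` keeps the boundary error away from the control. If the machine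
has stopped before step `r`, so that `tmRun` is `none`, there is nothing to compare. -/
theorem halts_cellAutOf_iff (M : TM0.Machine Γ Λ) (a u : Γ) (n : ℕ) :
    (cellAutOf M a u).Halts (n + 1) ↔ (TM0.eval M (a :: List.replicate (n + 1) u)).Dom := by
  constructor
  · rintro ⟨K, t, ht, x, hx, hM⟩
    rcases Nat.lt_or_ge t (n + 1) with h | h
    · rw [(conf_pre M a u (n + 1) K t h).1] at hx; cases hx
    · obtain ⟨r, rfl⟩ := Nat.exists_eq_add_of_le h
      cases hr : tmRun M (a :: List.replicate (n + 1) u) r with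
      | none => exact eval_dom_of_tmRun_eq_none _ _ r hr
      | some y =>
        rw [(conf_tmRun M a u n K r y (by omega) hr).1] at hx
        cases hx
        exact (eval_dom_iff_tmRun _ _).2 ⟨r, y, hr, by
          obtain ⟨q, T⟩ := y; exact Option.map_eq_none_iff.2 hM⟩
  · intro h
    obtain ⟨r, y, hr, hy⟩ := (eval_dom_iff_tmRun _ _).1 h
    refine ⟨n + 1 + r + 1, n + 1 + r, by omega, _,
      (conf_tmRun M a u n _ r y (by omega) hr).1, ?_⟩
    obtain ⟨q, T⟩ := y
    exact Option.map_eq_none_iff.1 hy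

end machine

theorem exists_undecidable_cellAut :
    ∃ (S C : Type) (_ : Finite S) (_ : Finite C) (B : CellAut S C),
      ¬ ComputablePred fun n : ℕ => B.Halts (n + 1) := by
  obtain ⟨Γ, Λ, i1, i2, i3, i4, M, a, u, h⟩ := exists_undecidable_machine
  refine ⟨_, _, inferInstance, inferInstance, cellAutOf M a u, ?_⟩
  simpa only [halts_cellAutOf_iff] using h

end TimedAut

namespace TimedAut

/-! ### Rows of cells with insertion errors -/

/-- A cell of a row: switched off, or switched on with a mark and a content. -/
inductive Cell (C : Type) : Type
  | off : Cell C
  | on (m : Bool) (c : C) : Cell C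

/-- The kind of a row: the first row of a phase, a later row in the middle of a phase, the last row
of a phase, or a row in which all cells are switched off. -/
inductive Kind (S : Type) : Type
  | start : Kind S
  | step (s : S) : Kind S
  | last : Kind S
  | super : Kind S

/-- Letters are heads of rows and cells. -/
inductive Letter (S C : Type) : Type
  | mark (k : Kind S) : Letter S C
  | cell (c : Cell C) : Letter S C

variable {S C : Type}

/-- The ranks of the cells of a row are nondecreasing. -/
def Cell.rank : Cell C → ℕ
  | .on false _ => 0
  | .on true _ => 1
  | .off => 2

/-- The rank of the first cell of a row. -/
def Kind.rank : Kind S → ℕ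
  | .start => 0
  | .step _ => 0
  | .last => 1
  | .super => 2

def cellContent : Option (Cell C) → Option C
  | some (.on _ c) => some c
  | _ => none

def isFresh : Option (Cell C) → Bool
  | some (.on false _) => true
  | _ => false

namespace CellAut

variable (B : CellAut S C)

/-- A step of the automaton in which the marked part of the row grows by one cell. -/
def stepCell (s : S) (l : Option (Cell C)) : Cell C → Option (Cell C) → Cell C
  | .off, _ => .off
  | .on m c, r => .on (m || !isFresh r) (B.cell s (cellContent l) c ((cellContent r).getD B.blank))

/-- The copy in the next row of a cell with given neighbours. -/
def upd : Kind S → Option (Cell C) → Cell C → Option (Cell C) → Cell C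
  | .start, l, c, r => B.stepCell B.pre l c r
  | .step s, l, c, r => B.stepCell s l c r
  | .last, _, .on _ _, some (.on _ _) => .on false B.blank
  | .last, _, _, _ => .off
  | .super, _, _, _ => .on false B.blank

/-- Local conditions for the rows: the second argument is the cell before the letter, if any. -/
def Ok : Kind S → Option (Cell C) → Letter S C → Prop
  | k, none, .mark _ => k = .super
  | _, some _, .mark _ => True
  | k, none, .cell c => c.rank = k.rank ∧ (k = .start → c = .off ∨ c = .on false B.blank)
  | k, some b, .cell c => b.rank ≤ c.rank ∧ (k = .start → c = .off ∨ c = .on false B.blank)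

/-- The possible kinds of the next row in the middle of a phase. -/
def CtrlNext (s : S) (f : Option (Cell C)) (k : Kind S) : Prop :=
  k = .last ∨ ∃ s', k = .step s' ∧ ¬ B.halt s' ∧
    (s = B.pre ∧ (s' = B.pre ∨ s' = B.start) ∨
      s ≠ B.pre ∧ ∃ m c, f = some (.on m c) ∧ s' = B.ctrl s c)

/-- The possible kinds of the next row, depending on the first cell of the row. -/
def Next : Kind S → Option (Cell C) → Kind S → Prop
  | .start, f, k => B.CtrlNext B.pre f k
  | .step s, f, k => B.CtrlNext s f k
  | .last, _, k => k = .start ∨ k = .super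
  | .super, _, k => k = .start

/-- A sequence of rows, each of which contains a copy of the one before, in the same order but
possibly with further cells inserted. -/
structure IsRows (n : ℕ) (kind : ℕ → Kind S) (len : ℕ → ℕ) (row : ℕ → ℕ → Option (Cell C))
    (emb : ℕ → ℕ → ℕ) : Prop where
  isSome_iff : ∀ k i, (row k i).isSome ↔ i < len k
  emb_lt : ∀ k i, i < len k → emb k i < len (k + 1)
  emb_mono : ∀ k i j, i < j → j < len k → emb k i < emb k j
  row_emb : ∀ k i c, row k i = some c →
    row (k + 1) (emb k i) = some (B.upd (kind k) ((leftOf (row k) i).join) c (row k (i + 1)))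
  ok : ∀ k i c, row k i = some c → B.Ok (kind k) ((leftOf (row k) i).join) (.cell c)
  super_of_none : ∀ k, row k 0 = none → kind k = .super
  next : ∀ k, B.Next (kind k) (row k 0) (kind (k + 1))
  len_lt : ∀ k, kind k = .super → len k < len (k + 1)
  clock : ∀ k i s, kind k = .start → (∀ j, 0 < j → j < i → kind (k + j) = .step B.pre) →
    kind (k + i) = .step s → (i < n → s = B.pre) ∧ (i = n → s = B.start)
  super_inf : ∀ k, ∃ k' ≥ k, kind k' = .super

theorem leftOf_join_zero (r : ℕ → Option (Cell C)) : (leftOf r 0).join = none := rfl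

theorem leftOf_join_succ (r : ℕ → Option (Cell C)) (i : ℕ) : (leftOf r (i + 1)).join = r i := rfl

namespace IsRows

variable {B} {n : ℕ} {kind : ℕ → Kind S} {len : ℕ → ℕ} {row : ℕ → ℕ → Option (Cell C)}
  {emb : ℕ → ℕ → ℕ}

def IsOn (r : Option (Cell C)) : Prop := ∃ m c, r = some (.on m c)

theorem emb_gap (h : B.IsRows n kind len row emb) {k i d : ℕ} (hd : i + d < len k) :
    emb k i + d ≤ emb k (i + d) := by
  induction d with
  | zero => simp
  | succ d ih =>
    have := h.emb_mono k (i + d) (i + (d + 1)) (by omega) hd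
    have := ih (by omega)
    omega

theorem le_emb (h : B.IsRows n kind len row emb) {k i : ℕ} (hi : i < len k) : i ≤ emb k i := by
  have := h.emb_gap (k := k) (i := 0) (d := i) (by omega)
  rw [Nat.zero_add] at this
  omega

theorem len_mono (h : B.IsRows n kind len row emb) : Monotone len :=
  monotone_nat_of_le_succ fun k => by
    rcases Nat.eq_zero_or_pos (len k) with h0 | h0
    · omega
    · have := h.le_emb (k := k) (i := len k - 1) (by omega)
      have := h.emb_lt k (len k - 1) (by omega)
      omega

/-- A cell that is off has the greatest rank and ranks do not decrease along a row, so the cells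
that are on form a prefix. -/
theorem not_isOn_succ (h : B.IsRows n kind len row emb) {k i : ℕ} (hi : ¬ IsOn (row k i)) :
    ¬ IsOn (row k (i + 1)) := by
  rintro ⟨m, c, hc⟩
  have h1 := (h.isSome_iff k (i + 1)).1 (by rw [hc]; rfl)
  have h2 := (h.isSome_iff k i).2 (by omega)
  obtain ⟨b, hb⟩ := Option.isSome_iff_exists.1 h2
  have h3 := h.ok k (i + 1) _ hc
  rw [leftOf_join_succ, hb] at h3
  cases b with
  | off => cases m <;> exact absurd h3.1 (by simp [Cell.rank])
  | on m' c' => exact hi ⟨m', c', hb⟩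

theorem exists_onLen (h : B.IsRows n kind len row emb) (k : ℕ) :
    ∃ a, ∀ i, IsOn (row k i) ↔ i < a := by
  classical
  have he : ∃ i, ¬ IsOn (row k i) := ⟨len k, by
    rintro ⟨m, c, hc⟩
    exact absurd ((h.isSome_iff k (len k)).1 (by rw [hc]; rfl)) (lt_irrefl _)⟩
  refine ⟨Nat.find he, fun i => ⟨fun hi => ?_, fun hi => not_not.1 (Nat.find_min he hi)⟩⟩
  by_contra hlt
  obtain ⟨d, rfl⟩ := Nat.exists_eq_add_of_le (not_lt.1 hlt)
  suffices ∀ d, ¬ IsOn (row k (Nat.find he + d)) from this d hi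
  intro d
  induction d with
  | zero => exact Nat.find_spec he
  | succ d ih => exact h.not_isOn_succ ih

/-- The number of cells in row `k` that are switched on. -/
noncomputable def onLen (h : B.IsRows n kind len row emb) (k : ℕ) : ℕ := (h.exists_onLen k).choose

theorem isOn_iff (h : B.IsRows n kind len row emb) {k i : ℕ} : IsOn (row k i) ↔ i < h.onLen k :=
  (h.exists_onLen k).choose_spec i

theorem lt_len_of_isOn (h : B.IsRows n kind len row emb) {k i : ℕ} (hi : IsOn (row k i)) :
    i < len k := by
  obtain ⟨m, c, hc⟩ := hi
  exact (h.isSome_iff k i).1 (by rw [hc]; rfl)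

/-- The kinds of rows inside a phase. -/
def Inner (k : Kind S) : Prop := k ≠ .last ∧ k ≠ .super

theorem isOn_emb (h : B.IsRows n kind len row emb) {k i : ℕ} (hk : Inner (kind k))
    (hi : IsOn (row k i)) : IsOn (row (k + 1) (emb k i)) := by
  obtain ⟨m, c, hc⟩ := hi
  rw [h.row_emb k i _ hc]
  cases hkk : kind k with
  | start => exact ⟨_, _, rfl⟩
  | step s => exact ⟨_, _, rfl⟩
  | last => exact absurd hkk hk.1
  | super => exact absurd hkk hk.2

theorem onLen_le_succ (h : B.IsRows n kind len row emb) {k : ℕ} (hk : Inner (kind k)) :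
    h.onLen k ≤ h.onLen (k + 1) := by
  rcases Nat.eq_zero_or_pos (h.onLen k) with h0 | h0
  · omega
  · have h1 : IsOn (row k (h.onLen k - 1)) := h.isOn_iff.2 (by omega)
    have h2 := h.isOn_iff.1 (h.isOn_emb hk h1)
    have h3 := h.le_emb (h.lt_len_of_isOn h1)
    omega

/-- The last cell of the prefix has a copy inside a prefix of the same length, and a strictly
increasing map from an initial segment to itself is the identity. -/
theorem emb_eq_self (h : B.IsRows n kind len row emb) {k i : ℕ} (hk : Inner (kind k))
    (he : h.onLen (k + 1) = h.onLen k) (hi : i < h.onLen k) : emb k i = i := by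
  have h1 : IsOn (row k (h.onLen k - 1)) := h.isOn_iff.2 (by omega)
  have h2 := h.isOn_iff.1 (h.isOn_emb hk h1)
  have h3 := h.lt_len_of_isOn h1
  have h4 := h.emb_gap (k := k) (i := i) (d := h.onLen k - 1 - i) (by omega)
  rw [show i + (h.onLen k - 1 - i) = h.onLen k - 1 by omega] at h4
  have h5 := h.le_emb (k := k) (i := i) (by omega)
  omega

/-- At the end of a phase a cell stays on if its right neighbour is on, so the last but one cell of
the prefix survives, and its copy is not to the left of it. -/
theorem onLen_le_succ_of_last (h : B.IsRows n kind len row emb) {k : ℕ} (hk : kind k = .last) :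
    h.onLen k ≤ h.onLen (k + 1) + 1 := by
  rcases Nat.lt_or_ge (h.onLen k) 2 with h0 | h0
  · omega
  · have h1 : IsOn (row k (h.onLen k - 2)) := h.isOn_iff.2 (by omega)
    have h2 : IsOn (row k (h.onLen k - 2 + 1)) := h.isOn_iff.2 (by omega)
    have h3 := h.le_emb (h.lt_len_of_isOn h1)
    obtain ⟨m, c, hc⟩ := h1
    obtain ⟨m', c', hc'⟩ := h2
    have h4 := h.row_emb k _ _ hc
    rw [hc', hk] at h4
    have := h.isOn_iff.1 ⟨_, _, h4⟩
    omega

theorem onLen_super (h : B.IsRows n kind len row emb) {k : ℕ} (hk : kind k = .super) :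
    h.onLen k = 0 := by
  by_contra h0
  obtain ⟨m, c, hc⟩ := h.isOn_iff.2 (Nat.pos_of_ne_zero h0)
  have h1 := (h.ok k 0 _ hc).1
  rw [hk] at h1
  cases m <;> exact absurd h1 (by simp [Cell.rank, Kind.rank])

theorem len_le_onLen (h : B.IsRows n kind len row emb) {k : ℕ} (hk : kind k = .super) :
    len k ≤ h.onLen (k + 1) := by
  rcases Nat.eq_zero_or_pos (len k) with h0 | h0
  · omega
  · obtain ⟨c, hc⟩ := Option.isSome_iff_exists.1 ((h.isSome_iff k (len k - 1)).2 (by omega))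
    have h1 := h.row_emb k _ _ hc
    rw [hk] at h1
    have h2 := h.isOn_iff.1 ⟨_, _, h1⟩
    have h3 := h.le_emb (k := k) (i := len k - 1) (by omega)
    omega

/-- Rows never get shorter, and they grow after each of the infinitely many rows of kind `super`. -/
theorem exists_super_len (h : B.IsRows n kind len row emb) (N : ℕ) :
    ∃ k, kind k = .super ∧ N ≤ len k := by
  induction N with
  | zero => obtain ⟨k, -, hk⟩ := h.super_inf 0; exact ⟨k, hk, Nat.zero_le _⟩
  | succ N ih =>
    obtain ⟨k, hk, hN⟩ := ih
    obtain ⟨k', hk', hs⟩ := h.super_inf (k + 1)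
    have := h.len_lt k hk
    have := h.len_mono hk'
    exact ⟨k', hs, by omega⟩

theorem onLen_mono_inner (h : B.IsRows n kind len row emb) {j l : ℕ}
    (hin : ∀ i, j ≤ i → i < l → Inner (kind i)) {i i' : ℕ} (h1 : j ≤ i) (h2 : i ≤ i')
    (h3 : i' ≤ l) : h.onLen i ≤ h.onLen i' := by
  induction i', h2 using Nat.le_induction with
  | base => exact le_rfl
  | succ m hm ih => exact (ih (by omega)).trans (h.onLen_le_succ (hin m (by omega) (by omega)))

/-- There is a phase without insertions into the part of the row that is switched on, for any
length `K` of this part. -/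
theorem exists_exact_phase (h : B.IsRows n kind len row emb) {K : ℕ} (hK : 0 < K) :
    ∃ j l, j < l ∧ kind j = .start ∧ kind l = .last ∧ (∀ i, j ≤ i → i < l → Inner (kind i)) ∧
      ∀ i, j ≤ i → i ≤ l → h.onLen i = K := by
  classical
  obtain ⟨k₀, hk₀, hlen⟩ := h.exists_super_len K
  have hex : ∃ k, k₀ < k ∧ kind k = .super := by
    obtain ⟨k, hk, hs⟩ := h.super_inf (k₀ + 1)
    exact ⟨k, hk, hs⟩
  obtain ⟨k₂, hk₂, hs₂⟩ := hex
  -- `P` singles out the ends of phases after which at least `K` cells are on. The wanted phase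
  -- follows the last of these before the next `super` row `k₂`.
  let P : ℕ → Prop := fun j => ¬ Inner (kind j) ∧ K ≤ h.onLen (j + 1)
  have hP₀ : P k₀ := ⟨fun hi => hi.2 hk₀, hlen.trans (h.len_le_onLen hk₀)⟩
  set j := Nat.findGreatest P (k₂ - 1) with hj
  have hPj : P j := Nat.findGreatest_spec (P := P) (by omega : k₀ ≤ k₂ - 1) hP₀
  have hjle : j ≤ k₂ - 1 := Nat.findGreatest_le _
  have hmax : ∀ m, j < m → m ≤ k₂ - 1 → ¬ P m := fun m h1 h2 =>
    Nat.findGreatest_is_greatest h1 h2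
  have hexl : ∃ l, j < l ∧ ¬ Inner (kind l) := ⟨k₂, by omega, fun hi => hi.2 hs₂⟩
  set l := Nat.find hexl with hl
  obtain ⟨hjl, hlin⟩ : j < l ∧ ¬ Inner (kind l) := Nat.find_spec hexl
  have hl₂ : l ≤ k₂ := Nat.find_min' hexl ⟨by omega, fun hi => hi.2 hs₂⟩
  have hin : ∀ i, j + 1 ≤ i → i < l → Inner (kind i) := fun i h1 h2 => by
    by_contra hc
    exact Nat.find_min hexl h2 ⟨by omega, hc⟩
  have hnext := h.next j
  have hstart : kind (j + 1) = .start := by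
    have hns : kind (j + 1) ≠ .super := fun hc => by
      have := h.onLen_super hc
      have := hPj.2
      omega
    cases hkj : kind j with
    | start => exact absurd ⟨by simp [hkj], by simp [hkj]⟩ hPj.1
    | step s => exact absurd ⟨by simp [hkj], by simp [hkj]⟩ hPj.1
    | last => rw [hkj] at hnext; exact hnext.resolve_right hns
    | super => rw [hkj] at hnext; exact hnext
  have hlj : j + 1 < l := by
    rcases Nat.lt_or_ge (j + 1) l with h1 | h1
    · exact h1
    · have : l = j + 1 := by omega
      rw [this, hstart] at hlin
      exact absurd ⟨by simp, by simp⟩ hlin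
  have hKl : ∀ i, j + 1 ≤ i → i ≤ l → K ≤ h.onLen i := fun i h1 h2 =>
    hPj.2.trans (h.onLen_mono_inner hin le_rfl h1 h2)
  -- Row `l` still has at least `K > 0` cells on, which excludes `super`.
  have hlast : kind l = .last := by
    by_contra hc
    have hsup : kind l = .super := by
      by_contra hc'
      exact hlin ⟨hc, hc'⟩
    have := hKl l (by omega) le_rfl
    rw [h.onLen_super hsup] at this
    omega
  have hlk : l ≤ k₂ - 1 := by
    rcases Nat.lt_or_ge l k₂ with h1 | h1
    · omega
    · have : l = k₂ := by omega
      rw [this, hs₂] at hlast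
      cases hlast
  -- Otherwise `l` would be a later end of a phase satisfying `P`. As at most one cell is lost after
  -- row `l`, that row has at most `K` cells on.
  have hlt : h.onLen (l + 1) < K := by
    by_contra hc
    exact hmax l hjl hlk ⟨hlin, by omega⟩
  have hle := h.onLen_le_succ_of_last hlast
  refine ⟨j + 1, l, hlj, hstart, hlast, hin, fun i h1 h2 => le_antisymm ?_ (hKl i h1 h2)⟩
  have := h.onLen_mono_inner hin h1 h2 le_rfl
  omega

end IsRows

end CellAut

end TimedAut

/-! ### Correct simulation in a phase without insertions -/

namespace TimedAut

namespace CellAut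

variable {S C : Type} {B : CellAut S C}

theorem upd_of_inner {k : Kind S} {s : S} (hk : k = .start ∧ s = B.pre ∨ k = .step s)
    (l : Option (Cell C)) (c : Cell C) (r : Option (Cell C)) :
    B.upd k l c r = B.stepCell s l c r := by
  rcases hk with ⟨rfl, rfl⟩ | rfl <;> rfl

theorem next_of_inner {k : Kind S} {s : S} (hk : k = .start ∧ s = B.pre ∨ k = .step s)
    {f : Option (Cell C)} {k' : Kind S} : B.Next k f k' ↔ B.CtrlNext s f k' := by
  rcases hk with ⟨rfl, rfl⟩ | rfl <;> rfl

namespace IsRows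

variable {n : ℕ} {kind : ℕ → Kind S} {len : ℕ → ℕ} {row : ℕ → ℕ → Option (Cell C)}
  {emb : ℕ → ℕ → ℕ}

theorem row_eq_conf_start (h : B.IsRows n kind len row emb) {K j : ℕ} (hj : kind j = .start)
    (hon : h.onLen j = K) (x : ℕ) (hx : x < K) : row j x = some (.on false B.blank) := by
  obtain ⟨m, c, hc⟩ := h.isOn_iff.2 (hon ▸ hx)
  have h1 := h.ok j x _ hc
  rw [hj] at h1
  have h2 : Cell.on m c = .off ∨ Cell.on m c = .on false B.blank := by
    cases hl : (leftOf (row j) x).join with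
    | none => rw [hl] at h1; exact h1.2 rfl
    | some b => rw [hl] at h1; exact h1.2 rfl
  rw [hc]
  rcases h2 with h2 | h2
  · cases h2
  · rw [h2]

/-- Copies keep their index because `emb` is the identity on the prefix. The neighbour to the right
of the prefix is off or absent; it counts as blank, as at the border of the window, and as not
fresh, so that the mark enters there and has reached index `x` after `i` steps exactly if `K ≤ x +
i`. -/
theorem row_eq_conf_succ (h : B.IsRows n kind len row emb) {K k i : ℕ}
    (hin : Inner (kind k)) (hon : h.onLen k = K) (hon' : h.onLen (k + 1) = K)
    (hk : kind k = .start ∧ (B.conf n K i).1 = B.pre ∨ kind k = .step (B.conf n K i).1)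
    (hrow : ∀ x < K, row k x = some (.on (decide (K ≤ x + i)) ((B.conf n K i).2 x)))
    (x : ℕ) (hx : x < K) :
    row (k + 1) x = some (.on (decide (K ≤ x + (i + 1))) ((B.conf n K (i + 1)).2 x)) := by
  have h1 := h.row_emb k x _ (hrow x hx)
  rw [h.emb_eq_self hin (by omega) (by omega)] at h1
  rw [h1, upd_of_inner hk, B.conf_snd_succ hx, stepCell]
  have hl : cellContent (leftOf (row k) x).join = leftOf (B.conf n K i).2 x := by
    cases x with
    | zero => rfl
    | succ x => rw [leftOf_join_succ, hrow x (by omega)]; rfl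
  have hoff : ¬ x + 1 < K → ¬ IsOn (row k (x + 1)) := fun hc ho => by
    have := h.isOn_iff.1 ho
    omega
  have hr : (cellContent (row k (x + 1))).getD B.blank = (B.conf n K i).2 (x + 1) ∧
      (decide (K ≤ x + i) || !isFresh (row k (x + 1))) = decide (K ≤ x + (i + 1)) := by
    by_cases hc : x + 1 < K
    · rw [hrow _ hc]
      refine ⟨rfl, ?_⟩
      by_cases h2 : K ≤ x + 1 + i
      · have h3 : K ≤ x + (i + 1) := by omega
        simp [h2, h3, isFresh]
      · have h3 : ¬ K ≤ x + (i + 1) := by omega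
        have h4 : ¬ K ≤ x + i := by omega
        simp [h2, h3, h4, isFresh]
    · have h3 : K ≤ x + (i + 1) := by omega
      rw [B.conf_snd_of_le (by omega)]
      cases hrr : row k (x + 1) with
      | none => simp [cellContent, isFresh, h3]
      | some c =>
        cases c with
        | off => simp [cellContent, isFresh, h3]
        | on m c => exact absurd ⟨m, c, hrr⟩ (hoff hc)
  rw [hl, hr.1, hr.2]

/-- A phase with constantly `K` cells on follows `B.conf n K` until the mark arrives at cell `0`,
which takes `K` rows, and `CtrlNext` admits no halting state on the way. -/
theorem not_halts (h : B.IsRows n kind len row emb) (hn : 0 < n) : ¬ B.Halts n := by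
  rintro ⟨K, t, ht, hhalt⟩
  obtain ⟨j, l, hjl, hstart, hlast, hin, hon⟩ := h.exists_exact_phase (K := K) (by omega)
  -- Strong induction is needed since `clock` requires that all the rows since the start of the
  -- phase have control state `pre`.
  have key : ∀ i, j + i ≤ l →
      (∀ x < K, row (j + i) x = some (.on (decide (K ≤ x + i)) ((B.conf n K i).2 x))) ∧
      (j + i < l → (i = 0 ∧ kind (j + i) = .start ∨
        0 < i ∧ kind (j + i) = .step (B.conf n K i).1) ∧ ¬ B.halt (B.conf n K i).1) := by
    intro i
    induction i using Nat.strong_induction_on with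
    | _ i ih =>
      cases i with
      | zero =>
        refine fun _ => ⟨fun x hx => ?_, fun _ => ⟨Or.inl ⟨rfl, hstart⟩, B.not_halt_pre⟩⟩
        rw [Nat.add_zero, h.row_eq_conf_start hstart (hon j le_rfl (by omega)) x hx,
          decide_eq_false (by omega)]
        rfl
      | succ i =>
        intro hil
        obtain ⟨hrow, hkind⟩ := ih i (by omega) (by omega)
        obtain ⟨hkind, -⟩ := hkind (by omega)
        have hk : kind (j + i) = .start ∧ (B.conf n K i).1 = B.pre ∨
            kind (j + i) = .step (B.conf n K i).1 := by
          rcases hkind with ⟨rfl, hk⟩ | ⟨-, hk⟩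
          · exact Or.inl ⟨hk, rfl⟩
          · exact Or.inr hk
        refine ⟨h.row_eq_conf_succ (hin (j + i) (by omega) (by omega))
          (hon (j + i) (by omega) (by omega)) (hon (j + (i + 1)) (by omega) hil) hk hrow,
          fun hlt => ?_⟩
        have hnext := (next_of_inner hk).1 (h.next (j + i))
        rcases hnext with hnext | ⟨s', hs', hnh, hnext⟩
        · exact absurd hnext (hin (j + (i + 1)) (by omega) hlt).1
        suffices s' = (B.conf n K (i + 1)).1 by
          rw [← this]
          exact ⟨Or.inr ⟨by omega, hs'⟩, hnh⟩
        have hclock := h.clock j (i + 1) s' hstart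
        have hpre : i + 1 ≤ n → ∀ m, 0 < m → m < i + 1 → kind (j + m) = .step B.pre := by
          intro hin' m hm0 hm
          rcases ((ih m hm (by omega)).2 (by omega)).1 with ⟨h0, -⟩ | ⟨-, h0⟩
          · omega
          · rw [h0, B.conf_fst_of_lt (by omega)]
        rw [conf]
        rcases lt_trichotomy (i + 1) n with hlt' | heq | hgt
        · rw [if_pos hlt']
          exact (hclock (hpre hlt'.le) hs').1 hlt'
        · rw [if_neg (by omega), if_pos heq]
          exact (hclock (hpre heq.le) hs').2 heq
        · rw [if_neg (by omega), if_neg (by omega)]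
          rcases hnext with ⟨hp, -⟩ | ⟨-, m, c, hf, hs''⟩
          · exact absurd hp (B.conf_fst_ne_pre hn (by omega))
          · rw [hrow 0 (by omega)] at hf
            cases hf
            exact hs''
  -- The first cell of the row of kind `last` must be marked.
  have hlen : j + K ≤ l := by
    obtain ⟨i, rfl⟩ := Nat.exists_eq_add_of_lt hjl
    have h1 := (key (i + 1) (by omega)).1 0 (by omega)
    rw [show j + (i + 1) = j + i + 1 by omega] at h1
    have h2 := (h.ok _ _ _ h1).1
    rw [hlast] at h2
    by_contra hc
    rw [decide_eq_false (by omega)] at h2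
    simp [Cell.rank, Kind.rank] at h2
  exact ((key t (by omega)).2 (by omega)).2 hhalt

end IsRows

end CellAut

end TimedAut

namespace TimedAut

/-! ### Timed words that consist of rows -/

section

variable {S C : Type}

def Letter.toCell : Letter S C → Option (Cell C)
  | .cell c => some c
  | .mark _ => none

/-- The cell at a position of a word, if there is one. -/
def cellAt (a : ℕ → Letter S C) (p : ℕ) : Option (Cell C) := (a p).toCell

/-- Position `i` is the head of a row of kind `k`, and only cells follow before position `j`. -/
def Seg (a : ℕ → Letter S C) (i j : ℕ) (k : Kind S) : Prop :=
  a i = .mark k ∧ i < j ∧ ∀ l, i < l → l < j → ∃ c, a l = .cell c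

/-- The timed word is a sequence of rows of duration `1` that evolve according to `B`, except that
new cells may be inserted anywhere. -/
structure CellAut.Good (B : CellAut S C) (n : ℕ) (a : ℕ → Letter S C) (t : ℕ → ℝ≥0) : Prop where
  spacing : ∀ i j k k', Seg a i j k → a j = .mark k' → t j = t i + 1
  next : ∀ i j k k', Seg a i j k → a j = .mark k' → B.Next k (cellAt a (i + 1)) k'
  ok : ∀ i j k, Seg a i j k → B.Ok k (cellAt a (j - 1)) (a j)
  copy : ∀ i j k c, Seg a i j k → a j = .cell c → ∃ j', t j' = t j + 1 ∧
    a j' = .cell (B.upd k (cellAt a (j - 1)) c (cellAt a (j + 1)))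
  grow : ∀ i j j' k', Seg a i (j + 1) .super → a (j + 1) = .mark k' → t j' = t j + 1 →
    ∃ c, a (j' + 1) = .cell c
  clock : ∀ i j s, a i = .mark .start → i < j →
    (∀ l, i < l → l < j → ∀ k, a l = .mark k → k = .step B.pre) → a j = .mark (.step s) →
    (t j < t i + n → s = B.pre) ∧ (t j = t i + n → s = B.start)
  super_inf : ∀ N, ∃ p ≥ N, a p = .mark .super

theorem cellAt_eq_some {a : ℕ → Letter S C} {p : ℕ} {c : Cell C} :
    cellAt a p = some c ↔ a p = .cell c := by
  unfold cellAt Letter.toCell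
  cases a p <;> simp

theorem cellAt_of_mark {a : ℕ → Letter S C} {p : ℕ} {k : Kind S} (h : a p = .mark k) :
    cellAt a p = none := by
  unfold cellAt; rw [h]; rfl

theorem cellAt_of_cell {a : ℕ → Letter S C} {p : ℕ} {c : Cell C} (h : a p = .cell c) :
    cellAt a p = some c := by
  unfold cellAt; rw [h]; rfl

theorem cellAt_eq_none {a : ℕ → Letter S C} {p : ℕ} :
    cellAt a p = none ↔ ∃ k, a p = .mark k := by
  unfold cellAt Letter.toCell
  cases a p <;> simp

/-! ### Good timed words contain rows -/

namespace CellAut.Good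

variable {B : CellAut S C} {n : ℕ} {a : ℕ → Letter S C} {t : ℕ → ℝ≥0}

/-- The position of the head of row number `k`. -/
noncomputable def headPos (a : ℕ → Letter S C) (k : ℕ) : ℕ :=
  Nat.nth (fun p => ∃ k, a p = .mark k) k

theorem infinite_heads (h : B.Good n a t) : {p | ∃ k, a p = .mark k}.Infinite :=
  Set.infinite_of_not_bddAbove fun ⟨N, hN⟩ => by
    obtain ⟨p, hp, hs⟩ := h.super_inf (N + 1)
    have := hN ⟨_, hs⟩
    omega

theorem exists_kind (h : B.Good n a t) (k : ℕ) : ∃ k', a (headPos a k) = .mark k' :=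
  Nat.nth_mem_of_infinite h.infinite_heads k

theorem headPos_strictMono (h : B.Good n a t) : StrictMono (headPos a) :=
  Nat.nth_strictMono h.infinite_heads

theorem eq_headPos (_h : B.Good n a t) {p : ℕ} {k' : Kind S} (hp : a p = .mark k') :
    ∃ k, p = headPos a k := by
  classical
  exact ⟨_, (Nat.nth_count (p := fun p => ∃ k, a p = .mark k) ⟨k', hp⟩).symm⟩

theorem exists_cell (h : B.Good n a t) {k p : ℕ} (h1 : headPos a k < p)
    (h2 : p < headPos a (k + 1)) : ∃ c, a p = .cell c := by
  cases hp : a p with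
  | cell c => exact ⟨c, rfl⟩
  | mark k' =>
    obtain ⟨l, rfl⟩ := h.eq_headPos hp
    have := h.headPos_strictMono.lt_iff_lt.1 h1
    have := h.headPos_strictMono.lt_iff_lt.1 h2
    omega

theorem seg (h : B.Good n a t) {k p : ℕ} {k' : Kind S} (hk : a (headPos a k) = .mark k')
    (h1 : headPos a k < p) (h2 : p ≤ headPos a (k + 1)) : Seg a (headPos a k) p k' :=
  ⟨hk, h1, fun _ h3 h4 => h.exists_cell h3 (h4.trans_le h2)⟩

theorem time_succ (h : B.Good n a t) (k : ℕ) : t (headPos a (k + 1)) = t (headPos a k) + 1 := by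
  obtain ⟨k', hk⟩ := h.exists_kind k
  obtain ⟨k'', hk'⟩ := h.exists_kind (k + 1)
  exact h.spacing _ _ _ _ (h.seg hk (h.headPos_strictMono (by omega)) le_rfl) hk'

theorem time_add (h : B.Good n a t) (k i : ℕ) : t (headPos a (k + i)) = t (headPos a k) + i := by
  induction i with
  | zero => simp
  | succ i ih => rw [← Nat.add_assoc, h.time_succ, ih]; push_cast; ring

/-- The cells of row number `k`. -/
noncomputable def rowOf (a : ℕ → Letter S C) (k i : ℕ) : Option (Cell C) :=
  if headPos a k + 1 + i < headPos a (k + 1) then cellAt a (headPos a k + 1 + i) else none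

theorem rowOf_eq (h : B.Good n a t) {k i : ℕ} (hi : headPos a k + 1 + i ≤ headPos a (k + 1)) :
    rowOf a k i = cellAt a (headPos a k + 1 + i) := by
  unfold rowOf
  split_ifs with h1
  · rfl
  · rw [show headPos a k + 1 + i = headPos a (k + 1) by omega]
    obtain ⟨k', hk⟩ := h.exists_kind (k + 1)
    rw [cellAt_of_mark hk]

theorem leftOf_rowOf (h : B.Good n a t) {k i : ℕ}
    (hi : headPos a k + 1 + i ≤ headPos a (k + 1)) :
    (leftOf (rowOf a k) i).join = cellAt a (headPos a k + 1 + i - 1) := by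
  cases i with
  | zero =>
    obtain ⟨k', hk⟩ := h.exists_kind k
    rw [CellAut.leftOf_join_zero, Nat.add_zero, Nat.add_sub_cancel, cellAt_of_mark hk]
  | succ i => rw [CellAut.leftOf_join_succ, h.rowOf_eq (by omega)]; rfl

/-- Rows last one time unit, so a shift by one unit maps the interior of a row into the interior of
the next. -/
theorem copy_pos (h : B.Good n a t) (ht : StrictMono t) {k p q : ℕ} (h1 : headPos a k < p)
    (h2 : p < headPos a (k + 1)) (hq : t q = t p + 1) :
    headPos a (k + 1) < q ∧ q < headPos a (k + 2) := by
  constructor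
  · rw [← ht.lt_iff_lt, hq, h.time_succ]
    gcongr
    exact ht h1
  · rw [← ht.lt_iff_lt, hq, h.time_succ (k + 1)]
    gcongr
    exact ht h2

theorem not_halts (h : B.Good n a t) (ht : StrictMono t) (hn : 0 < n) : ¬ B.Halts n := by
  choose kind hkind using h.exists_kind
  have hm := h.headPos_strictMono
  have hm1 : ∀ k, headPos a k < headPos a (k + 1) := fun k => hm (by omega)
  -- The range condition is placed inside the existential so that `choose` gives a total function;
  -- outside the row its value is irrelevant.
  have hemb : ∀ k i, ∃ e, headPos a k + 1 + i < headPos a (k + 1) →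
      headPos a (k + 1) + 1 + e < headPos a (k + 2) ∧
      t (headPos a (k + 1) + 1 + e) = t (headPos a k + 1 + i) + 1 ∧
      ∀ c, a (headPos a k + 1 + i) = .cell c → a (headPos a (k + 1) + 1 + e) =
        .cell (B.upd (kind k) (cellAt a (headPos a k + 1 + i - 1)) c
          (cellAt a (headPos a k + 1 + i + 1))) := by
    intro k i
    by_cases hi : headPos a k + 1 + i < headPos a (k + 1)
    · obtain ⟨c, hc⟩ := h.exists_cell (k := k) (p := headPos a k + 1 + i) (by omega) hi
      obtain ⟨q, hq1, hq2⟩ := h.copy _ _ _ c (h.seg (hkind k) (by omega) hi.le) hc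
      obtain ⟨h3, h4⟩ := h.copy_pos ht (by omega) hi hq1
      refine ⟨q - headPos a (k + 1) - 1, fun _ => ?_⟩
      rw [show headPos a (k + 1) + 1 + (q - headPos a (k + 1) - 1) = q by omega]
      refine ⟨h4, hq1, fun c' hc' => ?_⟩
      rw [hc] at hc'
      cases hc'
      exact hq2
    · exact ⟨0, fun hc => absurd hc hi⟩
  choose emb hemb using hemb
  have hcell : ∀ k i c, rowOf a k i = some c → headPos a k + 1 + i < headPos a (k + 1) ∧
      a (headPos a k + 1 + i) = .cell c := by
    intro k i c hc
    unfold rowOf at hc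
    split_ifs at hc with h1
    exact ⟨h1, cellAt_eq_some.1 hc⟩
  suffices B.IsRows n kind (fun k => headPos a (k + 1) - headPos a k - 1) (rowOf a) emb from
    this.not_halts hn
  refine
    { isSome_iff := fun k i => ?_
      emb_lt := fun k i hi => ?_
      emb_mono := fun k i j hij hj => ?_
      row_emb := fun k i c hc => ?_
      ok := fun k i c hc => ?_
      super_of_none := fun k hk => ?_
      next := fun k => ?_
      len_lt := fun k hk => ?_
      clock := fun k i s hk hpre hs => ?_
      super_inf := fun k => ?_ }
  · constructor
    · intro hs
      obtain ⟨c, hc⟩ := Option.isSome_iff_exists.1 hs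
      have := (hcell k i c hc).1
      omega
    · intro hi
      obtain ⟨c, hc⟩ := h.exists_cell (k := k) (p := headPos a k + 1 + i) (by omega) (by omega)
      rw [h.rowOf_eq (by omega), cellAt_of_cell hc]
      rfl
  · have := (hemb k i (by omega)).1
    rw [show k + 1 + 1 = k + 2 from rfl]
    omega
  · have h1 := (hemb k i (by omega)).2.1
    have h2 := (hemb k j (by omega)).2.1
    have h3 : t (headPos a (k + 1) + 1 + emb k i) < t (headPos a (k + 1) + 1 + emb k j) := by
      rw [h1, h2]
      gcongr
      exact ht (by omega)
    have := ht.lt_iff_lt.1 h3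
    omega
  · obtain ⟨h1, h2⟩ := hcell k i c hc
    obtain ⟨h3, -, h4⟩ := hemb k i h1
    rw [h.rowOf_eq (k := k + 1) h3.le, h.leftOf_rowOf h1.le, h.rowOf_eq (by omega),
      cellAt_of_cell (h4 c h2)]
    rfl
  · obtain ⟨h1, h2⟩ := hcell k i c hc
    rw [h.leftOf_rowOf h1.le, ← h2]
    exact h.ok _ _ _ (h.seg (hkind k) (by omega) h1.le)
  · rw [h.rowOf_eq (by have := hm1 k; omega), Nat.add_zero] at hk
    obtain ⟨k', hk'⟩ := cellAt_eq_none.1 hk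
    have := h.ok _ (headPos a k + 1) _ (h.seg (hkind k) (by omega) (hm1 k))
    rw [Nat.add_sub_cancel, cellAt_of_mark (hkind k), hk'] at this
    exact this
  · rw [h.rowOf_eq (by have := hm1 k; omega)]
    exact h.next _ _ _ _ (h.seg (hkind k) (hm1 k) le_rfl) (hkind (k + 1))
  · have h0 := hm1 k
    have h0' := hm1 (k + 1)
    have hseg := h.seg (hkind k) (hm1 k) le_rfl
    rw [hk] at hseg
    have hgrow : ∀ j', t j' = t (headPos a (k + 1) - 1) + 1 → ∃ c, a (j' + 1) = .cell c := by
      intro j' hj'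
      refine h.grow (headPos a k) (headPos a (k + 1) - 1) j' (kind (k + 1)) ?_ ?_ hj'
      · rw [show headPos a (k + 1) - 1 + 1 = headPos a (k + 1) by omega]; exact hseg
      · rw [show headPos a (k + 1) - 1 + 1 = headPos a (k + 1) by omega]; exact hkind _
    have hend : ∀ p, headPos a (k + 1) ≤ p → p < headPos a (k + 2) → (∃ c, a (p + 1) = .cell c) →
        p + 1 < headPos a (k + 2) := by
      rintro p h1 h2 ⟨c, hc⟩
      rcases Nat.lt_or_ge (p + 1) (headPos a (k + 2)) with h3 | h3
      · exact h3
      · rw [show p + 1 = headPos a (k + 2) by omega, hkind] at hc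
        cases hc
    -- The last position of the row is a cell, or the head if the row is empty. In both cases the
    -- position one time unit later is followed by a cell, which is the additional one.
    rcases Nat.lt_or_ge (headPos a k + 1) (headPos a (k + 1)) with h1 | h1
    · obtain ⟨h2, h3, -⟩ := hemb k (headPos a (k + 1) - headPos a k - 2) (by omega)
      rw [show headPos a k + 1 + (headPos a (k + 1) - headPos a k - 2) =
        headPos a (k + 1) - 1 by omega] at h3
      have h4 := hend _ (by omega) h2 (hgrow _ h3)
      have h5 : ∀ i, headPos a k + 1 + i < headPos a (k + 1) → i ≤ emb k i := by
        intro i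
        induction i with
        | zero => omega
        | succ i ih =>
          intro hi
          have h6 := (hemb k i (by omega)).2.1
          have h7 := (hemb k (i + 1) (by omega)).2.1
          have h8 : t (headPos a (k + 1) + 1 + emb k i) <
              t (headPos a (k + 1) + 1 + emb k (i + 1)) := by
            rw [h6, h7]
            gcongr
            exact ht (by omega)
          have := ht.lt_iff_lt.1 h8
          have := ih (by omega)
          omega
      have h6 := h5 (headPos a (k + 1) - headPos a k - 2) (by omega)
      rw [show k + 1 + 1 = k + 2 from rfl]
      omega
    · have h2 : t (headPos a (k + 1)) = t (headPos a (k + 1) - 1) + 1 := by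
        rw [h.time_succ, show headPos a (k + 1) - 1 = headPos a k by omega]
      have h4 := hend _ le_rfl h0' (hgrow _ h2)
      rw [show k + 1 + 1 = k + 2 from rfl]
      omega
  · rcases Nat.eq_zero_or_pos i with rfl | hi
    · rw [Nat.add_zero, hk] at hs
      cases hs
    have := h.clock (headPos a k) (headPos a (k + i)) s (by rw [hkind, hk]) (hm (by omega))
      (fun l h1 h2 k' hk' => by
        obtain ⟨m, rfl⟩ := h.eq_headPos hk'
        have h3 := hm.lt_iff_lt.1 h1
        have h4 := hm.lt_iff_lt.1 h2
        have h5 := hpre (m - k) (by omega) (by omega)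
        rw [show k + (m - k) = m by omega] at h5
        rw [hkind, h5] at hk'
        cases hk'
        rfl)
      (by rw [hkind, hs])
    rw [h.time_add] at this
    refine ⟨fun hin => this.1 ?_, fun hin => this.2 (by rw [hin])⟩
    gcongr
  · obtain ⟨p, hp, hs⟩ := h.super_inf (headPos a k)
    obtain ⟨m, rfl⟩ := h.eq_headPos hs
    refine ⟨m, hm.le_iff_le.1 hp, ?_⟩
    rw [hkind] at hs
    cases hs' : kind m <;> simp_all

end CellAut.Good

end

end TimedAut

namespace TimedAut

/-! ### A timed word for a sequence of rows without insertion errors -/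

namespace CellAut

variable {S C : Type} {B : CellAut S C} {n : ℕ}

section word

variable (kind : ℕ → Kind S) (len : ℕ → ℕ) (row : ℕ → ℕ → Option (Cell C))

/-- The position of the head of row `k`. -/
def rowPos : ℕ → ℕ
  | 0 => 0
  | k + 1 => rowPos k + len k + 1

/-- The row of a position and the index within the row. -/
def rowIdx : ℕ → ℕ × ℕ
  | 0 => (0, 0)
  | p + 1 => if (rowIdx p).2 < len (rowIdx p).1 then ((rowIdx p).1, (rowIdx p).2 + 1)
      else ((rowIdx p).1 + 1, 0)

/-- Index `0` in a row is the head, and index `x + 1` is cell number `x`. -/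
def letterAt (x : ℕ × ℕ) : Letter S C :=
  match (leftOf (row x.1) x.2).join with
  | some c => .cell c
  | none => .mark (kind x.1)

/-- The offset within the row is below `1` and depends only on the index, not on the length of the
row. So equal indices in consecutive rows are exactly one time unit apart, even when the second row
is longer. -/
noncomputable def timeAt (x : ℕ × ℕ) : ℝ≥0 := x.1 + x.2 / (x.2 + 1)

variable {kind len row}

theorem rowIdx_add {k e : ℕ} (he : e ≤ len k) (h0 : rowIdx len (rowPos len k) = (k, 0)) :
    rowIdx len (rowPos len k + e) = (k, e) := by
  induction e with
  | zero => exact h0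
  | succ e ih => rw [← Nat.add_assoc, rowIdx, ih (by omega)]; exact if_pos he

theorem rowIdx_rowPos (k : ℕ) : rowIdx len (rowPos len k) = (k, 0) := by
  induction k with
  | zero => rfl
  | succ k ih =>
    rw [rowPos, rowIdx, rowIdx_add le_rfl ih]
    exact if_neg (lt_irrefl _)

theorem rowIdx_eq {k e : ℕ} (he : e ≤ len k) : rowIdx len (rowPos len k + e) = (k, e) :=
  rowIdx_add he (rowIdx_rowPos k)

theorem exists_rowPos (p : ℕ) : ∃ k e, e ≤ len k ∧ p = rowPos len k + e := by
  induction p with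
  | zero => exact ⟨0, 0, Nat.zero_le _, rfl⟩
  | succ p ih =>
    obtain ⟨k, e, he, rfl⟩ := ih
    rcases Nat.lt_or_ge e (len k) with h | h
    · exact ⟨k, e + 1, h, by omega⟩
    · exact ⟨k + 1, 0, Nat.zero_le _, by rw [rowPos]; omega⟩

theorem rowPos_strictMono : StrictMono (rowPos len) :=
  strictMono_nat_of_lt_succ fun k => by rw [rowPos]; omega

theorem timeAt_lt_succ (p : ℕ) : timeAt (rowIdx len p) < timeAt (rowIdx len (p + 1)) := by
  obtain ⟨k, e, he, rfl⟩ := exists_rowPos (len := len) p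
  rw [rowIdx_eq he]
  rcases Nat.lt_or_ge e (len k) with h | h
  · rw [Nat.add_assoc, rowIdx_eq h]
    refine (add_lt_add_iff_left _).2 ?_
    push_cast
    rw [div_lt_div_iff₀ (by positivity) (by positivity), ← NNReal.coe_lt_coe]
    push_cast
    nlinarith
  · have h1 : rowPos len k + e + 1 = rowPos len (k + 1) := by rw [rowPos]; omega
    rw [h1, rowIdx_rowPos]
    unfold timeAt
    simp only [Nat.cast_zero, zero_div, add_zero]
    push_cast
    gcongr
    rw [div_lt_one (by positivity)]
    exact lt_add_one _

end word

namespace IsRows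

variable {kind : ℕ → Kind S} {len : ℕ → ℕ} {row : ℕ → ℕ → Option (Cell C)}

theorem row_len (h : B.IsRows n kind len row fun _ i => i) (k : ℕ) : row k (len k) = none := by
  cases hr : row k (len k) with
  | none => rfl
  | some c => exact absurd ((h.isSome_iff k (len k)).1 (by rw [hr]; rfl)) (lt_irrefl _)

/-- The letters of the timed word. -/
def letters (_h : B.IsRows n kind len row fun _ i => i) (p : ℕ) : Letter S C :=
  letterAt kind row (rowIdx len p)

theorem letters_rowPos (h : B.IsRows n kind len row fun _ i => i) (k : ℕ) :
    h.letters (rowPos len k) = .mark (kind k) := by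
  unfold letters; rw [rowIdx_rowPos]; rfl

theorem letters_cell (h : B.IsRows n kind len row fun _ i => i) {k x : ℕ} {c : Cell C}
    (hc : row k x = some c) : h.letters (rowPos len k + 1 + x) = .cell c := by
  have hx : x < len k := (h.isSome_iff k x).1 (by rw [hc]; rfl)
  unfold letters
  rw [show rowPos len k + 1 + x = rowPos len k + (x + 1) by omega, rowIdx_eq hx, letterAt]
  simp only [leftOf_join_succ, hc]

theorem exists_row (h : B.IsRows n kind len row fun _ i => i) {k x : ℕ} (hx : x < len k) :
    ∃ c, row k x = some c := Option.isSome_iff_exists.1 ((h.isSome_iff k x).2 hx)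

theorem eq_rowPos (h : B.IsRows n kind len row fun _ i => i) {p : ℕ} {k' : Kind S}
    (hp : h.letters p = .mark k') : ∃ k, p = rowPos len k ∧ kind k = k' := by
  obtain ⟨k, e, he, rfl⟩ := exists_rowPos (len := len) p
  cases e with
  | zero =>
    rw [Nat.add_zero, h.letters_rowPos] at hp
    cases hp
    exact ⟨k, rfl, rfl⟩
  | succ x =>
    obtain ⟨c, hc⟩ := h.exists_row (k := k) (x := x) (by omega)
    rw [show rowPos len k + (x + 1) = rowPos len k + 1 + x by omega, h.letters_cell hc] at hp
    cases hp

theorem seg_cases (h : B.IsRows n kind len row fun _ i => i) {i j : ℕ} {k' : Kind S}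
    (hs : Seg h.letters i j k') :
    ∃ k x, i = rowPos len k ∧ kind k = k' ∧ j = rowPos len k + 1 + x ∧ x ≤ len k := by
  obtain ⟨h1, h2, h3⟩ := hs
  obtain ⟨k, rfl, hk⟩ := h.eq_rowPos h1
  refine ⟨k, j - rowPos len k - 1, rfl, hk, by omega, ?_⟩
  by_contra hc
  obtain ⟨c, hc⟩ := h3 (rowPos len (k + 1)) (rowPos_strictMono (by omega)) (by rw [rowPos]; omega)
  rw [h.letters_rowPos] at hc
  cases hc

theorem cellAt_letters (h : B.IsRows n kind len row fun _ i => i) {k x : ℕ} (hx : x ≤ len k) :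
    cellAt h.letters (rowPos len k + 1 + x) = row k x := by
  rcases hx.lt_or_eq with hx | rfl
  · obtain ⟨c, hc⟩ := h.exists_row hx
    rw [hc, cellAt_of_cell (h.letters_cell hc)]
  · rw [h.row_len, show rowPos len k + 1 + len k = rowPos len (k + 1) by rw [rowPos]; omega,
      cellAt_of_mark (h.letters_rowPos _)]

theorem cellAt_letters_pred (h : B.IsRows n kind len row fun _ i => i) {k x : ℕ}
    (hx : x ≤ len k) :
    cellAt h.letters (rowPos len k + 1 + x - 1) = (leftOf (row k) x).join := by
  cases x with
  | zero =>
    rw [Nat.add_zero, Nat.add_sub_cancel, cellAt_of_mark (h.letters_rowPos _)]; rfl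
  | succ x => exact h.cellAt_letters (by omega)

theorem eq_len_of_mark (h : B.IsRows n kind len row fun _ i => i) {k x : ℕ} {k' : Kind S}
    (hx : x ≤ len k) (hm : h.letters (rowPos len k + 1 + x) = .mark k') :
    x = len k ∧ kind (k + 1) = k' := by
  rcases hx.lt_or_eq with hx | rfl
  · obtain ⟨c, hc⟩ := h.exists_row hx
    rw [h.letters_cell hc] at hm
    cases hm
  · refine ⟨rfl, ?_⟩
    rw [show rowPos len k + 1 + len k = rowPos len (k + 1) by rw [rowPos]; omega,
      h.letters_rowPos] at hm
    cases hm
    rfl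

theorem times_strictMono : StrictMono fun p => timeAt (rowIdx len p) :=
  strictMono_nat_of_lt_succ timeAt_lt_succ

theorem good_letters (h : B.IsRows n kind len row fun _ i => i) :
    B.Good n h.letters fun p => timeAt (rowIdx len p) := by
  have hlen : ∀ k, rowPos len k + 1 + len k = rowPos len (k + 1) := fun k => by
    rw [rowPos]; omega
  have htp : ∀ k, timeAt (rowIdx len (rowPos len k)) = k := fun k => by
    rw [rowIdx_rowPos]; simp [timeAt]
  have hcopy : ∀ k e, e ≤ len k → timeAt (rowIdx len (rowPos len (k + 1) + e)) =
      timeAt (rowIdx len (rowPos len k + e)) + 1 := fun k e he => by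
    rw [rowIdx_eq he, rowIdx_eq (he.trans (h.len_mono (by omega)))]
    simp only [timeAt]
    push_cast
    ring
  refine
    { spacing := fun i j k' k'' hs hj => ?_
      next := fun i j k' k'' hs hj => ?_
      ok := fun i j k' hs => ?_
      copy := fun i j k' c hs hj => ?_
      grow := fun i j j' k' hs hj hj' => ?_
      clock := fun i j s hi hij hpre hj => ?_
      super_inf := fun N => ?_ }
  · obtain ⟨k, x, rfl, rfl, rfl, hx⟩ := h.seg_cases hs
    obtain ⟨rfl, -⟩ := h.eq_len_of_mark hx hj
    rw [hlen, htp, htp]; push_cast; rfl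
  · obtain ⟨k, x, rfl, rfl, rfl, hx⟩ := h.seg_cases hs
    obtain ⟨-, rfl⟩ := h.eq_len_of_mark hx hj
    have := h.cellAt_letters (k := k) (x := 0) (Nat.zero_le _)
    rw [Nat.add_zero] at this
    rw [this]
    exact h.next k
  · obtain ⟨k, x, rfl, rfl, rfl, hx⟩ := h.seg_cases hs
    rw [h.cellAt_letters_pred hx]
    rcases hx.lt_or_eq with hx | rfl
    · obtain ⟨c, hc⟩ := h.exists_row hx
      rw [h.letters_cell hc]
      exact h.ok k x c hc
    · rw [hlen, h.letters_rowPos]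
      cases hl : (leftOf (row k) (len k)).join with
      | some b => cases kind k <;> trivial
      | none =>
        have : len k = 0 := by
          by_contra h0
          obtain ⟨x, hx⟩ := Nat.exists_eq_succ_of_ne_zero h0
          rw [hx, leftOf_join_succ] at hl
          obtain ⟨c, hc⟩ := h.exists_row (k := k) (x := x) (by omega)
          rw [hl] at hc
          cases hc
        have hr := h.row_len k
        rw [this] at hr
        have := h.super_of_none k hr
        rw [this]
        rfl
  · obtain ⟨k, x, rfl, rfl, rfl, hx⟩ := h.seg_cases hs
    have hxl : x < len k := by
      rcases hx.lt_or_eq with hx | rfl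
      · exact hx
      · rw [hlen, h.letters_rowPos] at hj
        cases hj
    obtain ⟨c', hc⟩ := h.exists_row hxl
    rw [h.letters_cell hc] at hj
    cases hj
    refine ⟨rowPos len (k + 1) + 1 + x, ?_, ?_⟩
    · simpa only [Nat.add_assoc, Nat.add_comm 1 x] using hcopy k (x + 1) hxl
    · rw [h.cellAt_letters_pred hx, Nat.add_assoc _ x 1, h.cellAt_letters (Nat.succ_le_of_lt hxl)]
      exact h.letters_cell (h.row_emb k x _ hc)
  · obtain ⟨k, x, rfl, hk, hjx, hx⟩ := h.seg_cases hs
    rw [hjx] at hj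
    obtain ⟨rfl, -⟩ := h.eq_len_of_mark hx hj
    have hj2 : j = rowPos len k + len k := by omega
    subst hj2
    rw [← hcopy k _ le_rfl] at hj'
    have := times_strictMono.injective hj'
    subst this
    obtain ⟨c, hc⟩ := h.exists_row (h.len_lt k hk)
    exact ⟨c, by
      rw [show rowPos len (k + 1) + len k + 1 = rowPos len (k + 1) + 1 + len k by omega]
      exact h.letters_cell hc⟩
  · obtain ⟨k, rfl, hk⟩ := h.eq_rowPos hi
    obtain ⟨m, rfl, hm⟩ := h.eq_rowPos hj
    have hkm := rowPos_strictMono.lt_iff_lt.1 hij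
    obtain ⟨d, rfl⟩ := Nat.exists_eq_add_of_lt hkm
    rw [htp, htp]
    have := h.clock k (d + 1) s hk (fun l h1 h2 => hpre (rowPos len (k + l))
      (rowPos_strictMono (by omega)) (rowPos_strictMono (by omega)) _ (h.letters_rowPos _)) hm
    refine ⟨fun hlt => this.1 ?_, fun heq => this.2 ?_⟩
    · have : k + d + 1 < k + n := by exact_mod_cast hlt
      omega
    · have : k + d + 1 = k + n := by exact_mod_cast heq
      omega
  · obtain ⟨k, hk, hs⟩ := h.super_inf N
    exact ⟨rowPos len k, hk.trans (rowPos_strictMono.le_apply), by rw [h.letters_rowPos, hs]⟩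

end IsRows

end CellAut

end TimedAut

namespace TimedAut

/-! ### The rows of an automaton that does not halt -/

namespace CellAut

variable {S C : Type} (B : CellAut S C) (n : ℕ)

/-- Parameters of a row: the number of cells, the number of cells switched on, and the time within
the phase. -/
def parNext (x : ℕ × ℕ × ℕ) : ℕ × ℕ × ℕ :=
  if x.2.2 < x.2.1 then (x.1, x.2.1, x.2.2 + 1)
  else if 0 < x.2.1 then (x.1, x.2.1 - 1, 0) else (x.1 + 1, x.1 + 1, 0)

/-- For each `N` there are phases with `N, N - 1, …, 1` cells on, the phase with `K` cells
consisting of `K + 1` rows; then comes one `super` row, and `N` increases by one. -/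
def par : ℕ → ℕ × ℕ × ℕ
  | 0 => (0, 0, 0)
  | k + 1 => parNext (par k)

noncomputable def parKind (x : ℕ × ℕ × ℕ) : Kind S :=
  if x.2.1 = 0 then .super else if x.2.2 = x.2.1 then .last else if x.2.2 = 0 then .start
  else .step (B.conf n x.2.1 x.2.2).1

noncomputable def parRow (x : ℕ × ℕ × ℕ) (i : ℕ) : Option (Cell C) :=
  if i < x.1 then some (if i < x.2.1 then
    .on (decide (x.2.1 ≤ i + x.2.2)) ((B.conf n x.2.1 x.2.2).2 i) else .off) else none

theorem par_le (k : ℕ) : (par k).2.2 ≤ (par k).2.1 ∧ (par k).2.1 ≤ (par k).1 := by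
  induction k with
  | zero => exact ⟨le_rfl, le_rfl⟩
  | succ k ih =>
    rw [par, parNext]
    split_ifs with h1 h2
    · exact ⟨h1, ih.2⟩
    · exact ⟨Nat.zero_le _, (Nat.sub_le _ _).trans ih.2⟩
    · exact ⟨Nat.zero_le _, le_rfl⟩

/-- A phase runs to its end without interruption, which identifies rows by their distance from its
start. -/
theorem par_phase {k N K : ℕ} (h : par k = (N, K, 0)) {j : ℕ} (hj : j ≤ K) :
    par (k + j) = (N, K, j) := by
  induction j with
  | zero => exact h
  | succ j ih => rw [← Nat.add_assoc, par, ih (by omega)]; exact if_pos hj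

theorem exists_par_eq_zero (K : ℕ) : ∀ k N j, j ≤ K → par k = (N, K, j) →
    ∃ k' ≥ k, (par k').2.1 = 0 := by
  induction K with
  | zero => intro k N j _ h; exact ⟨k, le_rfl, by rw [h]⟩
  | succ K ih =>
    intro k N j hj h
    have h1 : ∀ d, j + d ≤ K + 1 → par (k + d) = (N, K + 1, j + d) := by
      intro d
      induction d with
      | zero => intro _; exact h
      | succ d ihd =>
        intro hd
        rw [← Nat.add_assoc, par, ihd (by omega)]
        exact if_pos hd
    have h2 := h1 (K + 1 - j) (by omega)
    rw [show j + (K + 1 - j) = K + 1 by omega] at h2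
    have h3 : par (k + (K + 1 - j) + 1) = (N, K, 0) := by
      rw [par, h2, parNext]
      simp
    obtain ⟨k', hk', h0⟩ := ih _ N 0 (Nat.zero_le _) h3
    exact ⟨k', by omega, h0⟩

theorem parRow_of_lt_on {x : ℕ × ℕ × ℕ} {i : ℕ} (h : i < x.2.1) (hx : x.2.1 ≤ x.1) :
    B.parRow n x i =
      some (.on (decide (x.2.1 ≤ i + x.2.2)) ((B.conf n x.2.1 x.2.2).2 i)) := by
  rw [parRow, if_pos (by omega), if_pos h]

theorem parRow_of_off {x : ℕ × ℕ × ℕ} {i : ℕ} (h : x.2.1 ≤ i) :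
    B.parRow n x i = none ∨ B.parRow n x i = some .off := by
  rw [parRow]
  split_ifs with h1 h2
  · omega
  · exact Or.inr rfl
  · exact Or.inl rfl

theorem eq_of_parRow_eq_some {x : ℕ × ℕ × ℕ} {i : ℕ} {c : Cell C} (h : B.parRow n x i = some c) :
    i < x.1 ∧ c = if i < x.2.1 then
      .on (decide (x.2.1 ≤ i + x.2.2)) ((B.conf n x.2.1 x.2.2).2 i) else .off := by
  rw [parRow] at h
  split_ifs at h with h1 h2
  · cases h; exact ⟨h1, by rw [if_pos h2]⟩
  · cases h; exact ⟨h1, by rw [if_neg h2]⟩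

theorem parKind_of_inner {N K j : ℕ} (hj : j < K) :
    B.parKind n (N, K, j) = .start ∧ (B.conf n K j).1 = B.pre ∨
      B.parKind n (N, K, j) = .step (B.conf n K j).1 := by
  rcases Nat.eq_zero_or_pos j with rfl | h0
  · exact Or.inl ⟨by simp [parKind, show K ≠ 0 by omega, show 0 ≠ K by omega], rfl⟩
  · exact Or.inr (by
      simp [parKind, show K ≠ 0 by omega, show j ≠ K by omega, show j ≠ 0 by omega])

theorem parKind_last {N K : ℕ} (hK : 0 < K) : B.parKind n (N, K, K) = .last := by
  simp [parKind, show K ≠ 0 by omega]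

theorem parKind_super {N j : ℕ} : B.parKind n (N, 0, j) = .super := by
  simp [parKind]

/-- Inside a phase this is the recursion for `conf` together with the motion of the mark. After a
`last` row exactly the last cell of the prefix goes off, and after a `super` row all cells go on;
the one new cell is at the right end and is nobody's copy. -/
theorem parRow_next {x : ℕ × ℕ × ℕ} (h1 : x.2.2 ≤ x.2.1) (h2 : x.2.1 ≤ x.1) {i : ℕ} {c : Cell C}
    (hc : B.parRow n x i = some c) : B.parRow n (parNext x) i =
      some (B.upd (B.parKind n x) ((leftOf (B.parRow n x) i).join) c (B.parRow n x (i + 1))) := by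
  obtain ⟨N, K, j⟩ := x
  obtain ⟨hi, rfl⟩ := B.eq_of_parRow_eq_some n hc
  simp only at h1 h2 hi ⊢
  rcases h1.lt_or_eq with hj | rfl
  · have hn : parNext (N, K, j) = (N, K, j + 1) := if_pos hj
    rw [hn, upd_of_inner (B.parKind_of_inner n hj)]
    rcases Nat.lt_or_ge i K with hiK | hiK
    · rw [if_pos hiK, B.parRow_of_lt_on n (by exact hiK) h2, B.conf_snd_succ hiK, stepCell]
      have hl : cellContent (leftOf (B.parRow n (N, K, j)) i).join =
          leftOf (B.conf n K j).2 i := by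
        cases i with
        | zero => rfl
        | succ i =>
          rw [leftOf_join_succ, B.parRow_of_lt_on n (show i < K by omega) h2]
          rfl
      rw [hl]
      rcases Nat.lt_or_ge (i + 1) K with hi1 | hi1
      · rw [B.parRow_of_lt_on n (x := (N, K, j)) (by exact hi1) h2]
        have : (decide (K ≤ i + (j + 1))) =
            (decide (K ≤ i + j) || !isFresh (some (Cell.on (decide (K ≤ i + 1 + j))
              ((B.conf n K j).2 (i + 1))))) := by
          by_cases h3 : K ≤ i + 1 + j
          · simp [h3, isFresh, show K ≤ i + (j + 1) by omega]
          · simp [h3, isFresh, show ¬ K ≤ i + (j + 1) by omega, show ¬ K ≤ i + j by omega]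
        simp only [this]
        rfl
      · have h3 : K ≤ i + (j + 1) := by omega
        rw [B.conf_snd_of_le (i := i + 1) hi1]
        rcases B.parRow_of_off n (x := (N, K, j)) hi1 with h4 | h4 <;>
          rw [h4] <;> simp [cellContent, isFresh, h3]
    · rw [if_neg (by omega), parRow, if_pos hi, if_neg (by exact not_lt.2 hiK)]
      rfl
  · rcases Nat.eq_zero_or_pos j with rfl | hj
    · have hn : parNext (N, 0, 0) = (N + 1, N + 1, 0) := rfl
      rw [hn, parKind_super, B.parRow_of_lt_on n (by simp only; omega) le_rfl]
      simp only [decide_eq_false (show ¬ N + 1 ≤ i + 0 by omega)]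
      rfl
    · have hn : parNext (N, j, j) = (N, j - 1, 0) := by simp [parNext, hj]
      rw [hn, parKind_last _ _ hj]
      rcases Nat.lt_or_ge (i + 1) j with hi1 | hi1
      · rw [if_pos (by omega), B.parRow_of_lt_on n (x := (N, j, j)) (by exact hi1) h2,
          B.parRow_of_lt_on n (by simp only; omega) (by simp only; omega)]
        simp only [decide_eq_false (show ¬ j - 1 ≤ i + 0 by omega)]
        rfl
      · rw [parRow, if_pos hi, if_neg (by simp only; omega)]
        rcases B.parRow_of_off n (x := (N, j, j)) hi1 with h4 | h4 <;> rw [h4] <;>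
          split_ifs <;> rfl

theorem parRow_ok {x : ℕ × ℕ × ℕ} (h1 : x.2.2 ≤ x.2.1) (h2 : x.2.1 ≤ x.1) {i : ℕ} {c : Cell C}
    (hc : B.parRow n x i = some c) :
    B.Ok (B.parKind n x) ((leftOf (B.parRow n x) i).join) (.cell c) := by
  obtain ⟨N, K, j⟩ := x
  obtain ⟨hi, rfl⟩ := B.eq_of_parRow_eq_some n hc
  simp only at h1 h2 hi ⊢
  have hstart : B.parKind n (N, K, j) = .start → j = 0 := by
    intro h
    by_contra h0
    rw [parKind] at h
    split_ifs at h
  have hfresh : B.parKind n (N, K, j) = .start →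
      (if i < K then Cell.on (decide (K ≤ i + j)) ((B.conf n K j).2 i) else .off) = .off ∨
      (if i < K then Cell.on (decide (K ≤ i + j)) ((B.conf n K j).2 i) else .off) =
        .on false B.blank := by
    intro h
    obtain rfl := hstart h
    split_ifs with h3
    · right
      rw [decide_eq_false (by omega)]
      rfl
    · exact Or.inl rfl
  cases i with
  | zero =>
    refine ⟨?_, hfresh⟩
    rcases Nat.eq_zero_or_pos K with rfl | hK
    · rw [parKind_super]; simp [Cell.rank, Kind.rank]
    · rw [if_pos hK]
      rcases h1.lt_or_eq with hj | rfl
      · have : (B.parKind n (N, K, j)).rank = 0 := by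
          rcases B.parKind_of_inner n (N := N) hj with ⟨h, -⟩ | h <;> rw [h] <;> rfl
        rw [this, decide_eq_false (by omega)]
        rfl
      · rw [parKind_last _ _ hK, decide_eq_true (by omega)]
        rfl
  | succ i =>
    rw [leftOf_join_succ]
    rcases Nat.lt_or_ge i K with hiK | hiK
    · rw [B.parRow_of_lt_on n (x := (N, K, j)) hiK h2]
      refine ⟨?_, hfresh⟩
      split_ifs with h3
      · by_cases h4 : K ≤ i + j
        · simp [h4, show K ≤ i + 1 + j by omega]
          exact le_rfl
        · simp only [h4, decide_false]
          exact Nat.zero_le _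
      · cases decide (K ≤ i + j) <;> simp [Cell.rank]
    · have : B.parRow n (N, K, j) i = some .off := by
        rw [parRow, if_pos (by simp only; omega), if_neg (by simp only; omega)]
      rw [this]
      refine ⟨?_, hfresh⟩
      rw [if_neg (by omega)]

/-- Here the hypothesis that `B` does not halt is used: the control states that appear are those at
times below the size `K` of the window. -/
theorem parKind_next {x : ℕ × ℕ × ℕ} (hn₀ : 0 < n) (hh : ¬ B.Halts n) (h1 : x.2.2 ≤ x.2.1) (h2 : x.2.1 ≤ x.1) :
    B.Next (B.parKind n x) (B.parRow n x 0) (B.parKind n (parNext x)) := by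
  obtain ⟨N, K, j⟩ := x
  simp only at h1 h2
  rcases h1.lt_or_eq with hj | rfl
  · have hn : parNext (N, K, j) = (N, K, j + 1) := if_pos hj
    rw [hn, next_of_inner (B.parKind_of_inner n hj)]
    rcases Nat.lt_or_ge (j + 1) K with hj1 | hj1
    · have hk : B.parKind n (N, K, j + 1) = .step (B.conf n K (j + 1)).1 :=
        (B.parKind_of_inner n hj1).resolve_left fun h => by
          have := h.1
          rw [parKind] at this
          split_ifs at this with _ _ h0
          exact absurd h0 (by simp)
      refine Or.inr ⟨_, hk, fun hc => hh ⟨K, j + 1, hj1, hc⟩, ?_⟩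
      rw [B.parRow_of_lt_on n (show 0 < K by omega) h2]
      rcases lt_trichotomy (j + 1) n with hlt | heq | hgt
      · exact Or.inl ⟨B.conf_fst_of_lt (by omega), Or.inl (B.conf_fst_of_lt hlt)⟩
      · refine Or.inl ⟨B.conf_fst_of_lt (by omega), Or.inr ?_⟩
        rw [conf, if_neg (by omega), if_pos heq]
      · by_cases hp : (B.conf n K j).1 = B.pre
        · exact absurd hp (B.conf_fst_ne_pre hn₀ (by omega))
        · refine Or.inr ⟨hp, _, _, rfl, ?_⟩
          rw [conf, if_neg (by omega), if_neg (by omega)]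
    · left
      obtain rfl : j + 1 = K := by omega
      exact parKind_last _ _ (by omega)
  · rcases Nat.eq_zero_or_pos j with rfl | hj
    · have hn : parNext (N, 0, 0) = (N + 1, N + 1, 0) := rfl
      rw [hn, parKind_super]
      exact (by simp [parKind] : B.parKind n (N + 1, N + 1, 0) = .start)
    · have hn : parNext (N, j, j) = (N, j - 1, 0) := by simp [parNext, hj]
      rw [hn, parKind_last _ _ hj]
      rcases Nat.eq_zero_or_pos (j - 1) with h0 | h0
      · right; rw [h0, parKind_super]
      · left
        simp [parKind, show j - 1 ≠ 0 by omega, show 0 ≠ j - 1 by omega]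

theorem isRows_par (hn : 0 < n) (hh : ¬ B.Halts n) :
    B.IsRows n (fun k => B.parKind n (par k)) (fun k => (par k).1)
      (fun k => B.parRow n (par k)) (fun _ i => i) := by
  have hlen : ∀ x, x.1 ≤ (parNext x).1 := fun x => by
    rw [parNext]; split_ifs <;> simp
  have hsup : ∀ k, B.parKind n (par k) = .super → (par k).2.1 = 0 := fun k hk => by
    rw [parKind] at hk
    split_ifs at hk with h0
    exact h0
  refine
    { isSome_iff := fun k i => ?_
      emb_lt := fun k i hi => hi.trans_le (hlen _)
      emb_mono := fun k i j hij _ => hij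
      row_emb := fun k i c hc => B.parRow_next n (par_le k).1 (par_le k).2 hc
      ok := fun k i c hc => B.parRow_ok n (par_le k).1 (par_le k).2 hc
      super_of_none := fun k hk => ?_
      next := fun k => B.parKind_next n hn hh (par_le k).1 (par_le k).2
      len_lt := fun k hk => ?_
      clock := fun k i s hk hpre hs => ?_
      super_inf := fun k => ?_ }
  · rw [parRow]; split_ifs with h <;> simp [h]
  · have : ¬ 0 < (par k).1 := fun h0 => by rw [parRow, if_pos h0] at hk; cases hk
    have := par_le k
    rw [parKind, if_pos (by omega)]
  · have h0 := hsup k hk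
    rw [par, parNext, if_neg (by omega), if_neg (by omega)]
    exact Nat.lt_succ_self _
  · have hj : (par k).2.2 = 0 ∧ 0 < (par k).2.1 := by
      rw [parKind] at hk
      split_ifs at hk with h0 h1 h2
      exact ⟨h2, Nat.pos_of_ne_zero h0⟩
    obtain ⟨N, K, j, hpar⟩ : ∃ N K j, par k = (N, K, j) := ⟨_, _, _, rfl⟩
    rw [hpar] at hj
    obtain ⟨rfl, hK⟩ : j = 0 ∧ 0 < K := hj
    have hKlast : B.parKind n (par (k + K)) = .last := by
      rw [par_phase hpar le_rfl, parKind_last _ _ hK]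
    -- The row at distance `K` is the last one of the phase, so the premises of `clock` can hold
    -- only for `i < K`.
    rcases lt_trichotomy i K with hi | rfl | hi
    · rw [par_phase hpar hi.le] at hs
      have hs' : s = (B.conf n K i).1 := by
        rw [parKind, if_neg (by simp only; omega), if_neg (by simp only; omega)] at hs
        split_ifs at hs
        cases hs
        rfl
      rw [hs']
      refine ⟨fun h => B.conf_fst_of_lt h, ?_⟩
      rintro rfl
      obtain ⟨i, rfl⟩ := Nat.exists_eq_succ_of_ne_zero hn.ne'
      rw [conf, if_neg (lt_irrefl _), if_pos rfl]
    · rw [hKlast] at hs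
      cases hs
    · have := hpre K hK hi
      rw [hKlast] at this
      cases this
  · obtain ⟨k', hk', h0⟩ := exists_par_eq_zero _ k _ _ (par_le k).1 rfl
    exact ⟨k', hk', by rw [parKind, if_pos h0]⟩

end CellAut

end TimedAut

namespace TimedAut

/-! ### One-clock automata over abstract locations and letters -/

/-- Time elapsed since the letter before number `k`. -/
noncomputable def delayOf (t : ℕ → ℝ≥0) : ℕ → ℝ≥0
  | 0 => t 0
  | k + 1 => t (k + 1) - t k

/-- Time elapsed before letter number `k` when the letter before it has been read. -/
noncomputable def elapsed (t : ℕ → ℝ≥0) : ℕ → ℝ≥0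
  | 0 => 0
  | k + 1 => t k

theorem elapsed_add_delayOf {t : ℕ → ℝ≥0} (ht : StrictMono t) (k : ℕ) :
    elapsed t k + delayOf t k = t k := by
  cases k with
  | zero => simp [elapsed, delayOf]
  | succ k => exact add_tsub_cancel_of_le (ht (Nat.lt_succ_self k)).le

theorem add_delayOf {t : ℕ → ℝ≥0} (ht : StrictMono t) {k : ℕ} {v s : ℝ≥0}
    (h : v + s = elapsed t k) : v + delayOf t k + s = t k := by
  rw [add_right_comm, h, elapsed_add_delayOf ht]

/-- Automata whose transitions depend on the comparison of the clock with one constant for each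
location. -/
structure RegAut (Q L : Type) where
  init : Q
  bound : Q → ℕ
  tr : Q → L → Ordering → Q → Bool → Prop
  exists_tr : ∀ q a o, ∃ q' r, tr q a o q' r

namespace RegAut

variable {Q L : Type} (A : RegAut Q L) (a : ℕ → L) (t : ℕ → ℝ≥0)

/-- A transition that reads letter number `k`. -/
def Step (k : ℕ) (x y : Q × ℝ≥0) : Prop :=
  ∃ r, A.tr x.1 (a k) (compare (x.2 + delayOf t k) (A.bound x.1 : ℝ≥0)) y.1 r ∧
    y.2 = applyReset r (x.2 + delayOf t k)

structure IsRun (ρ : ℕ → Q × ℝ≥0) : Prop where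
  zero : ρ 0 = (A.init, 0)
  succ : ∀ k, A.Step a t k (ρ k) (ρ (k + 1))

/-- Configurations that can be reached by reading `k` letters. -/
inductive Reach : ℕ → Q × ℝ≥0 → Prop
  | zero : Reach 0 (A.init, 0)
  | succ (k : ℕ) (x y : Q × ℝ≥0) : Reach k x → A.Step a t k x y → Reach (k + 1) y

variable {A a t}

theorem IsRun.reach {ρ : ℕ → Q × ℝ≥0} (h : A.IsRun a t ρ) (k : ℕ) : A.Reach a t k (ρ k) := by
  induction k with
  | zero => rw [h.zero]; exact .zero
  | succ k ih => exact .succ k _ _ ih (h.succ k)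

theorem Reach.exists_prefix {p : ℕ} {x : Q × ℝ≥0} (h : A.Reach a t p x) :
    ∃ ρ : ℕ → Q × ℝ≥0, ρ 0 = (A.init, 0) ∧ ρ p = x ∧ ∀ k < p, A.Step a t k (ρ k) (ρ (k + 1)) := by
  induction h with
  | zero => exact ⟨fun _ => (A.init, 0), rfl, rfl, fun k hk => absurd hk (Nat.not_lt_zero k)⟩
  | succ k x y _ hs ih =>
    obtain ⟨ρ, h0, hk, hlt⟩ := ih
    refine ⟨Function.update ρ (k + 1) y, ?_, by simp, fun i hi => ?_⟩
    · rw [Function.update_of_ne (by omega), h0]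
    · rw [Function.update_of_ne (by omega)]
      rcases (Nat.lt_succ_iff.1 hi).lt_or_eq with h | rfl
      · rw [Function.update_of_ne (by omega)]; exact hlt i h
      · rw [Function.update_self, hk]; exact hs

/-- A reachable configuration from which one can continue forever in `P` extends to a run. -/
theorem Reach.exists_run {p : ℕ} {x : Q × ℝ≥0} (h : A.Reach a t p x)
    (P : ℕ → Q × ℝ≥0 → Prop) (hx : P p x)
    (hP : ∀ k, p ≤ k → ∀ x, P k x → ∃ y, A.Step a t k x y ∧ P (k + 1) y) :
    ∃ ρ, A.IsRun a t ρ ∧ ∀ k, p ≤ k → P k (ρ k) := by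
  obtain ⟨ρ₀, h0, hp, hlt⟩ := h.exists_prefix
  choose f hf hf' using hP
  let σ : ∀ d, {y // P (p + d) y} := fun d => Nat.rec ⟨x, hx⟩
    (fun d y => ⟨f (p + d) (by omega) y.1 y.2, hf' (p + d) (by omega) y.1 y.2⟩) d
  have hσ : ∀ d, A.Step a t (p + d) (σ d).1 (σ (d + 1)).1 := fun d => hf _ _ _ _
  refine ⟨fun k => if k < p then ρ₀ k else (σ (k - p)).1, ⟨?_, fun k => ?_⟩, fun k hk => ?_⟩
  · split_ifs with h1
    · exact h0
    · obtain rfl : p = 0 := by omega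
      rw [← h0, hp]
      rfl
  · rcases Nat.lt_or_ge (k + 1) p with h1 | h1
    · rw [if_pos (by omega), if_pos h1]; exact hlt k (by omega)
    · rw [if_neg (not_lt.2 h1)]
      rcases Nat.lt_or_ge k p with h2 | h2
      · obtain rfl : k + 1 = p := by omega
        rw [if_pos h2, Nat.sub_self]
        have := hlt k h2
        rwa [hp] at this
      · rw [if_neg (not_lt.2 h2)]
        obtain ⟨d, rfl⟩ := Nat.exists_eq_add_of_le h2
        rw [show p + d - p = d by omega, show p + d + 1 - p = d + 1 by omega]
        exact hσ d
  · beta_reduce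
    rw [if_neg (by omega)]
    obtain ⟨d, rfl⟩ := Nat.exists_eq_add_of_le hk
    rw [show p + d - p = d by omega]
    exact (σ d).2

end RegAut

/-! ### The automaton that looks for errors in a sequence of rows -/

section

variable {S C : Type}

theorem Seg.start {a : ℕ → Letter S C} {i : ℕ} {k : Kind S} (h : a i = .mark k) : Seg a i (i + 1) k :=
  ⟨h, Nat.lt_succ_self i, fun l h1 h2 => by omega⟩

theorem Seg.snoc {a : ℕ → Letter S C} {i j : ℕ} {k : Kind S} {c : Cell C} (h : Seg a i j k) (hc : a j = .cell c) :
    Seg a i (j + 1) k :=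
  ⟨h.1, by have := h.2.1; omega, fun l h1 h2 => by
    rcases (Nat.lt_succ_iff.1 h2).lt_or_eq with h3 | rfl
    · exact h.2.2 l h1 h3
    · exact ⟨c, hc⟩⟩

/-- `home b` has not begun any check and remembers in `b` whether the letter just read was the head
of a `super` row; `fin` bets that no such head will follow; `bad` is a proven error, and `dead` a
check that was abandoned. The other locations carry out checks. -/
inductive Loc (S C : Type) : Type
  | home (b : Bool) : Loc S C
  | fin : Loc S C
  | dead : Loc S C
  | bad : Loc S C
  | head (k : Kind S) : Loc S C
  | body (k : Kind S) (c : Cell C) : Loc S C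
  | walk (k : Kind S) (o : Option (Cell C)) : Loc S C
  | seen (k : Kind S) (o : Option (Cell C)) (c : Cell C) : Loc S C
  | wait (c : Cell C) : Loc S C
  | endRow : Loc S C
  | endWait : Loc S C
  | endCopy : Loc S C
  | clk : Loc S C

def Letter.isSuper : Letter S C → Bool
  | .mark .super => true
  | _ => false

theorem Letter.isSuper_iff {a : Letter S C} : a.isSuper = true ↔ a = .mark .super := by
  cases a with
  | cell c => simp [isSuper]
  | mark k => cases k <;> simp [isSuper]

namespace CellAut

variable (B : CellAut S C) (n : ℕ)

/-- Transitions: `head` and `body` check the duration of a row and the kind of the next row, `walk`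
the local conditions, `seen` and `wait` the copy of a cell, `endRow`, `endWait` and `endCopy` the
additional cell after a row of kind `super`, and `clk` the time when the control is switched. -/
inductive Tr : Loc S C → Letter S C → Ordering → Loc S C → Bool → Prop
  | dead (q a o) : Tr q a o .dead false
  | bad (a o) : Tr .bad a o .bad false
  | home (b a o) : Tr (.home b) a o (.home a.isSuper) false
  | toFin (b a o) : Tr (.home b) a o .fin false
  | fin (a o) : a ≠ .mark .super → Tr .fin a o .fin false
  | head (b k o) : Tr (.home b) (.mark k) o (.head k) true
  | headBody (k c o) : Tr (.head k) (.cell c) o (.body k c) false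
  | headBad (k k' o) : (o ≠ .eq ∨ ¬ B.Next k none k') → Tr (.head k) (.mark k') o .bad false
  | body (k c c' o) : Tr (.body k c) (.cell c') o (.body k c) false
  | bodyBad (k c k' o) : (o ≠ .eq ∨ ¬ B.Next k (some c) k') →
      Tr (.body k c) (.mark k') o .bad false
  | homeWalk (b k o) : Tr (.home b) (.mark k) o (.walk k none) false
  | walk (k p c o) : Tr (.walk k p) (.cell c) o (.walk k (some c)) false
  | walkBad (k p a o) : ¬ B.Ok k p a → Tr (.walk k p) a o .bad false
  | seen (k p c o) : Tr (.walk k p) (.cell c) o (.seen k p c) true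
  | seenWait (k p c a) : Tr (.seen k p c) a .lt (.wait (B.upd k p c a.toCell)) false
  | wait (c a) : Tr (.wait c) a .lt (.wait c) false
  | waitBad (c a) : a ≠ .cell c → Tr (.wait c) a .eq .bad false
  | waitLate (c a) : Tr (.wait c) a .gt .bad false
  | endRowHome (b o) : Tr (.home b) (.mark .super) o .endRow true
  | endRowWalk (p c o) : Tr (.walk .super p) (.cell c) o .endRow true
  | endRowWait (k) : Tr .endRow (.mark k) .lt .endWait false
  | endRowCopy (k) : Tr .endRow (.mark k) .eq .endCopy false
  | endWait (a) : Tr .endWait a .lt .endWait false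
  | endWaitCopy (a) : Tr .endWait a .eq .endCopy false
  | endBad (k o) : Tr .endCopy (.mark k) o .bad false
  | homeClk (b o) : Tr (.home b) (.mark .start) o .clk true
  | clkCell (c o) : Tr .clk (.cell c) o .clk false
  | clkPre : Tr .clk (.mark (.step B.pre)) .lt .clk false
  | clkBad (s) : s ≠ B.pre → Tr .clk (.mark (.step s)) .lt .bad false
  | clkStart (s) : s ≠ B.start → Tr .clk (.mark (.step s)) .eq .bad false

def watch : RegAut (Loc S C) (Letter S C) where
  init := .home false
  bound q := match q with
    | .clk => n
    | _ => 1
  tr := B.Tr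
  exists_tr q a o := ⟨_, _, .dead q a o⟩

variable {B n} {a : ℕ → Letter S C} {t : ℕ → ℝ≥0}

/-- In this group of lemmas `x` is the clock, `s` the time of the last reset and `y` the present
time. The relation `x + s = y` avoids truncated subtraction. -/
theorem compare_lt_of {x y s c : ℝ≥0} (h : x + s = y) (hy : y < s + c) : compare x c = .lt := by
  rw [compare_lt_iff_lt]
  rw [← h, add_comm] at hy
  exact lt_of_add_lt_add_left hy

theorem compare_eq_of {x y s c : ℝ≥0} (h : x + s = y) (hy : y = s + c) : compare x c = .eq := by
  rw [compare_eq_iff_eq]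
  rw [← h, add_comm] at hy
  exact add_left_cancel hy

theorem compare_gt_of {x y s c : ℝ≥0} (h : x + s = y) (hy : s + c < y) : compare x c = .gt := by
  rw [compare_gt_iff_gt]
  rw [← h, add_comm x] at hy
  exact lt_of_add_lt_add_left hy

theorem lt_of_compare {x y s c : ℝ≥0} (h : x + s = y) (hc : compare x c = .lt) : y < s + c := by
  rw [compare_lt_iff_lt] at hc
  rw [← h, add_comm]
  exact add_lt_add_right hc s

theorem eq_of_compare {x y s c : ℝ≥0} (h : x + s = y) (hc : compare x c = .eq) : y = s + c := by
  rw [compare_eq_iff_eq] at hc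
  rw [← h, add_comm, hc]

theorem gt_of_compare {x y s c : ℝ≥0} (h : x + s = y) (hc : compare x c = .gt) : s + c < y := by
  rw [compare_gt_iff_gt] at hc
  rw [← h, add_comm x]
  exact add_lt_add_right hc s

/-- What the configurations of `watch` say about the word. -/
def Inv (B : CellAut S C) (a : ℕ → Letter S C) (t : ℕ → ℝ≥0) (p : ℕ) (v : ℝ≥0) : Loc S C → Prop
  | .home _ => True
  | .fin => True
  | .dead => True
  | .bad => False
  | .head k => ∃ i, p = i + 1 ∧ a i = .mark k ∧ v = 0
  | .body k c => ∃ i, Seg a i p k ∧ i + 1 < p ∧ a (i + 1) = .cell c ∧ v + t i = elapsed t p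
  | .walk k o => ∃ i, Seg a i p k ∧ o = cellAt a (p - 1)
  | .seen k o c => ∃ i j, p = j + 1 ∧ Seg a i j k ∧ a j = .cell c ∧ o = cellAt a (j - 1) ∧ v = 0
  | .wait c => ∃ j j', t j' = t j + 1 ∧ a j' = .cell c ∧ v + t j = elapsed t p ∧ p ≤ j'
  | .endRow => ∃ i j, p = j + 1 ∧ Seg a i p .super ∧ v = 0
  | .endWait => ∃ j, (∀ j', t j' = t j + 1 → ∃ c, a (j' + 1) = .cell c) ∧ v + t j = elapsed t p
  | .endCopy => ∃ c, a p = .cell c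
  | .clk => ∃ i, i < p ∧ a i = .mark .start ∧
      (∀ l, i < l → l < p → ∀ k, a l = .mark k → k = .step B.pre) ∧ v + t i = elapsed t p

/-- There are no false alarms: locations remember only true facts about the word, and each
transition into `bad` from another location would contradict a clause of `Good`. -/
theorem Good.inv_step (h : B.Good n a t) (ht : StrictMono t) {p : ℕ} {x y : Loc S C × ℝ≥0}
    (hx : Inv B a t p x.2 x.1) (hs : (B.watch n).Step a t p x y) :
    Inv B a t (p + 1) y.2 y.1 := by
  obtain ⟨q, v⟩ := x
  obtain ⟨q', v'⟩ := y
  obtain ⟨r, htr, hv⟩ := hs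
  simp only at hx htr hv ⊢
  have h0 : (0 : ℝ≥0) + t p = elapsed t (p + 1) := zero_add _
  change B.Tr q (a p) (compare (v + delayOf t p) ((B.watch n).bound q : ℝ≥0)) q' r at htr
  generalize hap : a p = ap at htr
  generalize hcmp : compare (v + delayOf t p) ((B.watch n).bound q : ℝ≥0) = o at htr
  have hone : ((1 : ℕ) : ℝ≥0) = 1 := Nat.cast_one
  cases htr with
  | dead => trivial
  | bad => exact hx
  | home => trivial
  | toFin => trivial
  | fin => trivial
  | head b k => exact ⟨p, rfl, hap, hv⟩
  | headBody k c =>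
    obtain ⟨i, rfl, hi, rfl⟩ := hx
    refine ⟨i, (Seg.start hi).snoc hap, by omega, hap, ?_⟩
    rw [hv]
    exact add_delayOf ht (zero_add _)
  | headBad k k' _ hb =>
    obtain ⟨i, rfl, hi, rfl⟩ := hx
    have h1 := h.spacing _ _ _ _ (Seg.start hi) hap
    have h2 := h.next _ _ _ _ (Seg.start hi) hap
    rw [cellAt_of_mark hap] at h2
    have h3 := compare_eq_of (add_delayOf ht (zero_add (t i))) (h1.trans (by rw [← hone]))
    exact hb.elim (fun hb => hb (hcmp.symm.trans h3)) (fun hb => hb h2)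
  | body k c c' =>
    obtain ⟨i, hi, hip, hc, hvi⟩ := hx
    refine ⟨i, hi.snoc hap, by omega, hc, ?_⟩
    rw [hv]
    exact add_delayOf ht hvi
  | bodyBad k c k' _ hb =>
    obtain ⟨i, hi, hip, hc, hvi⟩ := hx
    have h1 := h.spacing _ _ _ _ hi hap
    have h2 := h.next _ _ _ _ hi hap
    rw [cellAt_of_cell hc] at h2
    have h3 := compare_eq_of (add_delayOf ht hvi) (h1.trans (by rw [← hone]))
    exact hb.elim (fun hb => hb (hcmp.symm.trans h3)) (fun hb => hb h2)
  | homeWalk b k => exact ⟨p, Seg.start hap, (cellAt_of_mark hap).symm⟩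
  | walk k o c =>
    obtain ⟨i, hi, -⟩ := hx
    exact ⟨i, hi.snoc hap, (cellAt_of_cell hap).symm⟩
  | walkBad k o _ _ hb =>
    obtain ⟨i, hi, rfl⟩ := hx
    exact hb (hap ▸ h.ok _ _ _ hi)
  | seen k o c =>
    obtain ⟨i, hi, ho⟩ := hx
    exact ⟨i, p, rfl, hi, hap, ho, hv⟩
  | seenWait k o c =>
    obtain ⟨i, j, rfl, hi, hc, rfl, rfl⟩ := hx
    obtain ⟨j', hj', hc'⟩ := h.copy _ _ _ _ hi hc
    have h1 := lt_of_compare (add_delayOf ht (zero_add (t j))) hcmp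
    refine ⟨j, j', hj', ?_, ?_, ?_⟩
    · rw [hc', ← hap]; rfl
    · rw [hv]; exact add_delayOf ht (zero_add _)
    · have : t (j + 1) < t j' := by rw [hj', ← hone]; exact h1
      have := ht.lt_iff_lt.1 this
      omega
  | wait c =>
    obtain ⟨j, j', hj', hc', hvj, hp⟩ := hx
    have h1 := lt_of_compare (add_delayOf ht hvj) hcmp
    refine ⟨j, j', hj', hc', ?_, ?_⟩
    · rw [hv]; exact add_delayOf ht hvj
    · have : t p < t j' := by rw [hj', ← hone]; exact h1
      exact ht.lt_iff_lt.1 this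
  | waitBad c _ hb =>
    obtain ⟨j, j', hj', hc', hvj, hp⟩ := hx
    have h1 := eq_of_compare (add_delayOf ht hvj) hcmp
    have : t p = t j' := by rw [hj', ← hone]; exact h1
    rw [← ht.injective this, hap] at hc'
    exact hb hc'
  | waitLate c =>
    obtain ⟨j, j', hj', hc', hvj, hp⟩ := hx
    have h1 := gt_of_compare (add_delayOf ht hvj) hcmp
    have : t j' < t p := by rw [hj', ← hone]; exact h1
    have := ht.lt_iff_lt.1 this
    exact absurd hp (by omega)
  | endRowHome b => exact ⟨p, p, rfl, Seg.start hap, hv⟩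
  | endRowWalk o c =>
    obtain ⟨i, hi, -⟩ := hx
    exact ⟨i, p, rfl, hi.snoc hap, hv⟩
  | endRowWait k =>
    obtain ⟨i, j, rfl, hi, rfl⟩ := hx
    refine ⟨j, fun j' hj' => h.grow i j j' k hi hap hj', ?_⟩
    rw [hv]; exact add_delayOf ht (zero_add _)
  | endRowCopy k =>
    obtain ⟨i, j, rfl, hi, rfl⟩ := hx
    exact h.grow i j _ k hi hap
      ((eq_of_compare (add_delayOf ht (zero_add (t j))) hcmp).trans (by rw [← hone]; rfl))
  | endWait =>
    obtain ⟨j, hj, hvj⟩ := hx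
    exact ⟨j, hj, by rw [hv]; exact add_delayOf ht hvj⟩
  | endWaitCopy =>
    obtain ⟨j, hj, hvj⟩ := hx
    exact hj _ ((eq_of_compare (add_delayOf ht hvj) hcmp).trans (by rw [← hone]; rfl))
  | endBad k =>
    obtain ⟨c, hc⟩ := hx
    rw [hap] at hc
    cases hc
  | homeClk b =>
    exact ⟨p, Nat.lt_succ_self p, hap, fun l h1 h2 => by omega, by rw [hv]; exact h0⟩
  | clkCell c =>
    obtain ⟨i, hip, hi, hpre, hvi⟩ := hx
    refine ⟨i, by omega, hi, fun l h1 h2 k hk => ?_, by rw [hv]; exact add_delayOf ht hvi⟩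
    rcases (Nat.lt_succ_iff.1 h2).lt_or_eq with h3 | rfl
    · exact hpre l h1 h3 k hk
    · rw [hap] at hk; cases hk
  | clkPre =>
    obtain ⟨i, hip, hi, hpre, hvi⟩ := hx
    refine ⟨i, by omega, hi, fun l h1 h2 k hk => ?_, by rw [hv]; exact add_delayOf ht hvi⟩
    rcases (Nat.lt_succ_iff.1 h2).lt_or_eq with h3 | rfl
    · exact hpre l h1 h3 k hk
    · rw [hap] at hk; cases hk; rfl
  | clkBad s hs =>
    obtain ⟨i, hip, hi, hpre, hvi⟩ := hx
    exact hs ((h.clock i p s hi hip hpre hap).1 (lt_of_compare (add_delayOf ht hvi) hcmp))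
  | clkStart s hs =>
    obtain ⟨i, hip, hi, hpre, hvi⟩ := hx
    exact hs ((h.clock i p s hi hip hpre hap).2 (eq_of_compare (add_delayOf ht hvi) hcmp))

theorem Good.not_bad (h : B.Good n a t) (ht : StrictMono t) {p : ℕ} {x : Loc S C × ℝ≥0}
    (hx : (B.watch n).Reach a t p x) : x.1 ≠ .bad := by
  have : Inv B a t p x.2 x.1 := by
    induction hx with
    | zero => trivial
    | succ k x y _ hs ih => exact h.inv_step ht ih hs
  intro hc
  rw [hc] at this
  exact this

end CellAut

end

end TimedAut

namespace TimedAut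

/-! ### A word without reachable errors is a sequence of rows -/

namespace CellAut

variable {S C : Type} {B : CellAut S C} {n : ℕ} {a : ℕ → Letter S C} {t : ℕ → ℝ≥0}

theorem reach_succ {p : ℕ} {q q' : Loc S C} {v : ℝ≥0} {r : Bool} {o : Ordering}
    (h : (B.watch n).Reach a t p (q, v))
    (ho : compare (v + delayOf t p) ((B.watch n).bound q : ℝ≥0) = o)
    (htr : B.Tr q (a p) o q' r) :
    (B.watch n).Reach a t (p + 1) (q', applyReset r (v + delayOf t p)) :=
  .succ p _ _ h ⟨r, ho ▸ htr, rfl⟩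

/-- Waiting in `home` is always possible, so every check can start at any letter. -/
theorem reach_home (p : ℕ) : ∃ b v, (B.watch n).Reach a t p (.home b, v) := by
  induction p with
  | zero => exact ⟨_, _, .zero⟩
  | succ p ih =>
    obtain ⟨b, v, h⟩ := ih
    exact ⟨_, _, reach_succ h rfl (.home b _ _)⟩

theorem reach_head {i : ℕ} {k : Kind S} (hi : a i = .mark k) :
    (B.watch n).Reach a t (i + 1) (.head k, 0) := by
  obtain ⟨b, v, h⟩ := reach_home (B := B) (n := n) (a := a) (t := t) i
  exact reach_succ h rfl (r := true) (by rw [hi]; exact .head b k _)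

theorem reach_clk {i : ℕ} (hi : a i = .mark .start) :
    (B.watch n).Reach a t (i + 1) (.clk, 0) := by
  obtain ⟨b, v, h⟩ := reach_home (B := B) (n := n) (a := a) (t := t) i
  exact reach_succ h rfl (r := true) (by rw [hi]; exact .homeClk b _)

theorem Seg.pred {a : ℕ → Letter S C} {i j : ℕ} {k : Kind S} (h : Seg a i (j + 1) k) (hij : i < j) :
    Seg a i j k ∧ ∃ c, a j = .cell c :=
  ⟨⟨h.1, hij, fun l h1 h2 => h.2.2 l h1 (by omega)⟩, h.2.2 j hij (Nat.lt_succ_self j)⟩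

theorem reach_body (ht : StrictMono t) {i p : ℕ} {k : Kind S} {c : Cell C} (hs : Seg a i p k)
    (hip : i + 1 < p) (hc : a (i + 1) = .cell c) :
    ∃ v, (B.watch n).Reach a t p (.body k c, v) ∧ v + t i = elapsed t p := by
  induction p, hip using Nat.le_induction with
  | base =>
    exact ⟨_, reach_succ (r := false) (reach_head hs.1) rfl (by rw [hc]; exact .headBody k c _),
      add_delayOf ht (zero_add _)⟩
  | succ p hp ih =>
    obtain ⟨hs', c', hc'⟩ := Seg.pred hs (by omega)
    obtain ⟨v, hv, hvi⟩ := ih hs'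
    exact ⟨_, reach_succ (r := false) hv rfl (by rw [hc']; exact .body k c c' _),
      add_delayOf ht hvi⟩

theorem reach_walk {i p : ℕ} {k : Kind S} (hs : Seg a i p k) :
    ∃ v, (B.watch n).Reach a t p (.walk k (cellAt a (p - 1)), v) := by
  have hip := hs.2.1
  induction p, hip using Nat.le_induction with
  | base =>
    obtain ⟨b, v, h⟩ := reach_home (B := B) (n := n) (a := a) (t := t) i
    refine ⟨_, reach_succ (r := false) h rfl ?_⟩
    rw [Nat.succ_sub_one, cellAt_of_mark hs.1, hs.1]
    exact .homeWalk b k _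
  | succ p hp ih =>
    obtain ⟨hs', c', hc'⟩ := Seg.pred hs (by omega)
    obtain ⟨v, hv⟩ := ih hs'
    refine ⟨_, reach_succ (r := false) hv rfl ?_⟩
    rw [Nat.add_sub_cancel, cellAt_of_cell hc', hc']
    exact .walk k _ c' _

theorem reach_seen {i j : ℕ} {k : Kind S} {c : Cell C} (hs : Seg a i j k) (hc : a j = .cell c) :
    (B.watch n).Reach a t (j + 1) (.seen k (cellAt a (j - 1)) c, 0) := by
  obtain ⟨v, hv⟩ := reach_walk (B := B) (n := n) (t := t) hs
  exact reach_succ (r := true) hv rfl (by rw [hc]; exact .seen k _ c _)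

theorem reach_endRow {i j : ℕ} (hs : Seg a i (j + 1) .super) :
    (B.watch n).Reach a t (j + 1) (.endRow, 0) := by
  rcases (Nat.lt_succ_iff.1 hs.2.1).lt_or_eq with hij | rfl
  · obtain ⟨hs', c, hc⟩ := Seg.pred hs hij
    obtain ⟨v, hv⟩ := reach_walk (B := B) (n := n) (t := t) hs'
    exact reach_succ (r := true) hv rfl (by rw [hc]; exact .endRowWalk _ c _)
  · obtain ⟨b, v, h⟩ := reach_home (B := B) (n := n) (a := a) (t := t) i
    exact reach_succ (r := true) h rfl (by rw [hs.1]; exact .endRowHome b _)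

/-- A location that waits while the clock is less than `1`. -/
theorem reach_waiting (ht : StrictMono t) {q : Loc S C} (hb : (B.watch n).bound q = 1)
    (hq : ∀ l, B.Tr q l .lt q false) {p₀ s p : ℕ}
    (h : ∃ v, (B.watch n).Reach a t p₀ (q, v) ∧ v + t s = elapsed t p₀) (hp : p₀ ≤ p)
    (hlt : ∀ l, p₀ ≤ l → l < p → t l < t s + 1) :
    ∃ v, (B.watch n).Reach a t p (q, v) ∧ v + t s = elapsed t p := by
  induction p, hp using Nat.le_induction with
  | base => exact h
  | succ p hp ih =>
    obtain ⟨v, hv, hvs⟩ := ih fun l h1 h2 => hlt l h1 (by omega)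
    refine ⟨_, reach_succ (r := false) (o := .lt) hv ?_ (hq _), add_delayOf ht hvs⟩
    rw [hb]
    exact compare_lt_of (add_delayOf ht hvs) (by
      rw [Nat.cast_one]; exact hlt p hp (Nat.lt_succ_self p))

theorem exists_next_head (hinf : ∀ N, ∃ p ≥ N, a p = .mark .super) {i j : ℕ} {k : Kind S}
    (hs : Seg a i j k) : ∃ j' k', j ≤ j' ∧ Seg a i j' k ∧ a j' = .mark k' := by
  classical
  have hex : ∃ p, j ≤ p ∧ ∃ k', a p = .mark k' := by
    obtain ⟨p, hp, hm⟩ := hinf j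
    exact ⟨p, hp, _, hm⟩
  obtain ⟨h1, k', h2⟩ := Nat.find_spec hex
  refine ⟨Nat.find hex, k', h1, ⟨hs.1, hs.2.1.trans_le h1, fun l h3 h4 => ?_⟩, h2⟩
  rcases Nat.lt_or_ge l j with h5 | h5
  · exact hs.2.2 l h3 h5
  · cases hl : a l with
    | cell c => exact ⟨c, rfl⟩
    | mark k'' => exact absurd ⟨h5, k'', hl⟩ (Nat.find_min hex h4)

section

variable (hbad : ∀ p v, ¬ (B.watch n).Reach a t p (.bad, v))

include hbad

theorem spacing_next (ht : StrictMono t) {i j : ℕ} {k k' : Kind S} (hs : Seg a i j k)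
    (hj : a j = .mark k') : t j = t i + 1 ∧ B.Next k (cellAt a (i + 1)) k' := by
  rcases (Nat.succ_le_of_lt hs.2.1).lt_or_eq with hij | rfl
  · obtain ⟨c, hc⟩ := hs.2.2 (i + 1) (by omega) hij
    obtain ⟨v, hv, hvi⟩ := reach_body (B := B) (n := n) ht hs hij hc
    have htr : ¬ (compare (v + delayOf t j) ((1 : ℕ) : ℝ≥0) ≠ .eq ∨ ¬ B.Next k (some c) k') :=
      fun hb => hbad _ _ (reach_succ (r := false) hv rfl (by rw [hj]; exact .bodyBad k c k' _ hb))
    push Not at htr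
    rw [cellAt_of_cell hc]
    exact ⟨(eq_of_compare (add_delayOf ht hvi) htr.1).trans (by rw [Nat.cast_one]), htr.2⟩
  · have hv := reach_head (B := B) (n := n) (t := t) hs.1
    have htr : ¬ (compare (0 + delayOf t (i + 1)) ((1 : ℕ) : ℝ≥0) ≠ .eq ∨ ¬ B.Next k none k') :=
      fun hb => hbad _ _ (reach_succ (r := false) hv rfl (by rw [hj]; exact .headBad k k' _ hb))
    push Not at htr
    rw [cellAt_of_mark hj]
    exact ⟨(eq_of_compare (add_delayOf ht (zero_add (t i))) htr.1).trans (by rw [Nat.cast_one]),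
      htr.2⟩

theorem ok_of_not_bad {i j : ℕ} {k : Kind S} (hs : Seg a i j k) :
    B.Ok k (cellAt a (j - 1)) (a j) := by
  by_contra hc
  obtain ⟨v, hv⟩ := reach_walk (B := B) (n := n) (t := t) hs
  exact hbad _ _ (reach_succ (r := false) hv rfl (.walkBad k _ _ _ hc))

/-- The first letter that is not earlier than one unit after the cell has to be its copy: a later
time leads to `bad` by `waitLate`, and a wrong letter at the right time by `waitBad`. The hypothesis
on `super` heads is essential, since times may be bounded and the copy might otherwise never fall
due. -/
theorem copy_of_not_bad (ht : StrictMono t) (hinf : ∀ N, ∃ p ≥ N, a p = .mark .super) {i j : ℕ}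
    {k : Kind S} {c : Cell C} (hs : Seg a i j k) (hc : a j = .cell c) :
    ∃ j', t j' = t j + 1 ∧ a j' = .cell (B.upd k (cellAt a (j - 1)) c (cellAt a (j + 1))) := by
  classical
  obtain ⟨m, k', hjm, hsm, hm⟩ := exists_next_head hinf (hs.snoc hc)
  obtain ⟨m', k'', hmm', hsm', hm'⟩ := exists_next_head hinf (Seg.start hm)
  have h1 := (spacing_next hbad ht hsm hm).1
  have h2 := (spacing_next hbad ht hsm' hm').1
  -- The end `m'` of the next row is one unit after the end `m` of the present one, hence late
  -- enough.
  have hex : ∃ p, t j + 1 ≤ t p := ⟨m', by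
    rw [h2]; gcongr; exact ht.monotone (by omega)⟩
  have hmin : ∀ l < Nat.find hex, t l < t j + 1 := fun l hl => not_le.1 (Nat.find_min hex hl)
  have hsp := Nat.find_spec hex
  set p := Nat.find hex with hp
  -- The cell comes after the head of a row of duration one, so the next letter is read before the
  -- copy is due and can supply the right neighbour to `seenWait`.
  have hlt : t (j + 1) < t j + 1 := by
    refine (ht.monotone hjm).trans_lt ?_
    rw [h1]
    gcongr
    exact ht hs.2.1
  have hjp : j + 2 ≤ p := by
    by_contra hcon
    exact absurd hsp (not_le.2 ((ht.monotone (by omega : p ≤ j + 1)).trans_lt hlt))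
  have hw := reach_succ (r := false) (o := .lt) (reach_seen (B := B) (n := n) (t := t) hs hc)
    (compare_lt_of (add_delayOf ht (zero_add (t j))) (hlt.trans_eq (by
      rw [← Nat.cast_one]; rfl))) (.seenWait k _ c _)
  obtain ⟨v, hv, hvj⟩ := reach_waiting ht rfl (fun l => .wait _ l)
    ⟨_, hw, add_delayOf ht (zero_add (t j))⟩ hjp (fun l _ hl => hmin l hl)
  have hle : t p ≤ t j + 1 := by
    by_contra hcon
    exact hbad _ _ (reach_succ (r := false) hv
      (compare_gt_of (add_delayOf ht hvj) ((not_le.1 hcon).trans_eq' (by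
        rw [← Nat.cast_one]; rfl))) (.waitLate _ _))
  have heq := le_antisymm hle hsp
  refine ⟨p, heq, ?_⟩
  by_contra hcon
  exact hbad _ _ (reach_succ (r := false) hv
    (compare_eq_of (add_delayOf ht hvj) (heq.trans (by rw [← Nat.cast_one]; rfl)))
    (.waitBad _ _ hcon))

theorem grow_of_not_bad (ht : StrictMono t) {i j j' : ℕ} {k' : Kind S}
    (hs : Seg a i (j + 1) .super) (hj : a (j + 1) = .mark k') (hj' : t j' = t j + 1) :
    ∃ c, a (j' + 1) = .cell c := by
  cases hm : a (j' + 1) with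
  | cell c => exact ⟨c, rfl⟩
  | mark k =>
    exfalso
    have hr := reach_endRow (B := B) (n := n) (t := t) hs
    suffices ∃ v, (B.watch n).Reach a t (j' + 1) (.endCopy, v) by
      obtain ⟨v, hv⟩ := this
      exact hbad _ _ (reach_succ (r := false) hv rfl (by rw [hm]; exact .endBad k _))
    have hjj' : j < j' := by
      rw [← ht.lt_iff_lt, hj']
      exact lt_add_one _
    have hz : (0 : ℝ≥0) + t j = elapsed t (j + 1) := zero_add _
    have hc0 := add_delayOf ht hz
    -- Either letters come strictly between, and `endWait` passes over them, or the next head itself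
    -- is one unit later, as after an empty row.
    rcases (Nat.succ_le_of_lt hjj').lt_or_eq with h1 | rfl
    · have hlt : ∀ l, l < j' → t l < t j + 1 := fun l hl => by rw [← hj']; exact ht hl
      have hw := reach_succ (r := false) (o := .lt) (q' := .endWait) hr
        (compare_lt_of hc0 ((hlt _ h1).trans_eq (by rw [← Nat.cast_one]; rfl)))
        (by rw [hj]; exact .endRowWait k')
      obtain ⟨v, hv, hvj⟩ := reach_waiting ht rfl (fun l => .endWait l) ⟨_, hw, hc0⟩
        (show j + 1 + 1 ≤ j' by omega) (fun l _ hl => hlt l hl)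
      exact ⟨_, reach_succ (r := false) hv
        (compare_eq_of (add_delayOf ht hvj) (hj'.trans (by rw [← Nat.cast_one]; rfl)))
        (.endWaitCopy _)⟩
    · exact ⟨_, reach_succ (r := false) hr
        (compare_eq_of hc0 (hj'.trans (by rw [← Nat.cast_one]; rfl)))
        (by rw [show a j.succ = .mark k' from hj]; exact .endRowCopy k')⟩

theorem clock_of_not_bad (ht : StrictMono t) {i j : ℕ} {s : S} (hi : a i = .mark .start)
    (hij : i < j) (hpre : ∀ l, i < l → l < j → ∀ k, a l = .mark k → k = .step B.pre)
    (hj : a j = .mark (.step s)) :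
    (t j < t i + n → s = B.pre) ∧ (t j = t i + n → s = B.start) := by
  -- All letters before `j` are read strictly before the constant `n` is reached, and heads among
  -- them show `pre`, so the check in `clk` survives until `j`.
  have key : t j ≤ t i + n → ∀ p, i + 1 ≤ p → p ≤ j →
      ∃ v, (B.watch n).Reach a t p (.clk, v) ∧ v + t i = elapsed t p := by
    intro hle p hp
    induction p, hp using Nat.le_induction with
    | base => exact fun _ => ⟨0, reach_clk hi, zero_add _⟩
    | succ p hp ih =>
      intro hpj
      obtain ⟨v, hv, hvi⟩ := ih (by omega)
      have hcmp := compare_lt_of (add_delayOf ht hvi) ((ht (by omega : p < j)).trans_le hle)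
      refine ⟨_, reach_succ (r := false) hv hcmp ?_, add_delayOf ht hvi⟩
      cases hap : a p with
      | cell c => exact .clkCell c _
      | mark k => rw [hpre p (by omega) (by omega) k hap]; exact .clkPre
  constructor
  · intro hlt
    obtain ⟨v, hv, hvi⟩ := key hlt.le j hij le_rfl
    by_contra hs
    exact hbad _ _ (reach_succ (r := false) hv (compare_lt_of (add_delayOf ht hvi) hlt)
      (by rw [hj]; exact .clkBad s hs))
  · intro heq
    obtain ⟨v, hv, hvi⟩ := key heq.le j hij le_rfl
    by_contra hs
    exact hbad _ _ (reach_succ (r := false) hv (compare_eq_of (add_delayOf ht hvi) heq)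
      (by rw [hj]; exact .clkStart s hs))

theorem good_of_not_bad (ht : StrictMono t) (hinf : ∀ N, ∃ p ≥ N, a p = .mark .super) :
    B.Good n a t where
  spacing _ _ _ _ hs hj := (spacing_next hbad ht hs hj).1
  next _ _ _ _ hs hj := (spacing_next hbad ht hs hj).2
  ok _ _ _ hs := ok_of_not_bad hbad hs
  copy _ _ _ _ hs hc := copy_of_not_bad hbad ht hinf hs hc
  grow _ _ _ _ hs hj hj' := grow_of_not_bad hbad ht hs hj hj'
  clock _ _ _ hi hij hpre hj := clock_of_not_bad hbad ht hi hij hpre hj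
  super_inf := hinf

end

end CellAut

end TimedAut

namespace TimedAut

/-! ### Büchi acceptance by the automaton that looks for errors -/

namespace CellAut

variable {S C : Type} {B : CellAut S C} {n : ℕ} {a : ℕ → Letter S C} {t : ℕ → ℝ≥0}

theorem exists_run_bad {p : ℕ} {v : ℝ≥0} (h : (B.watch n).Reach a t p (.bad, v)) :
    ∃ ρ, (B.watch n).IsRun a t ρ ∧ ∀ k, p ≤ k → (ρ k).1 = .bad :=
  h.exists_run (fun _ x => x.1 = .bad) rfl fun k _ x hx =>
    ⟨(.bad, x.2 + delayOf t k), ⟨false, by rw [hx]; exact .bad _ _, rfl⟩, rfl⟩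

theorem exists_run_home : ∃ ρ, (B.watch n).IsRun a t ρ ∧
    ∀ k, (ρ (k + 1)).1 = .home (a k).isSuper := by
  obtain ⟨ρ, hρ, h⟩ := RegAut.Reach.exists_run (A := B.watch n) (a := a) (t := t) .zero
    (fun k x => x.1 = .home false ∧ k = 0 ∨ ∃ l, k = l + 1 ∧ x.1 = .home (a l).isSuper)
    (.inl ⟨rfl, rfl⟩) fun k _ x hx => by
      obtain ⟨b, hb⟩ : ∃ b, x.1 = .home b := by
        rcases hx with hx | ⟨l, -, hx⟩
        exacts [⟨_, hx.1⟩, ⟨_, hx⟩]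
      exact ⟨(.home (a k).isSuper, x.2 + delayOf t k), ⟨false, by rw [hb]; exact .home _ _ _, rfl⟩,
        .inr ⟨k, rfl, rfl⟩⟩
  refine ⟨ρ, hρ, fun k => ?_⟩
  rcases h (k + 1) (Nat.zero_le _) with h | ⟨l, hl, h⟩
  · exact absurd h.2 (Nat.succ_ne_zero k)
  · rw [h, Nat.succ_injective hl]

theorem exists_run_fin {N : ℕ} (h : ∀ p ≥ N, a p ≠ .mark .super) :
    ∃ ρ, (B.watch n).IsRun a t ρ ∧ ∀ k, N + 1 ≤ k → (ρ k).1 = .fin := by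
  obtain ⟨b, v, hv⟩ := reach_home (B := B) (n := n) (a := a) (t := t) N
  exact (reach_succ (r := false) hv rfl (.toFin b _ _)).exists_run (fun _ x => x.1 = .fin) rfl
    fun k hk x hx => ⟨(.fin, x.2 + delayOf t k),
      ⟨false, by rw [hx]; exact .fin _ _ (h k (by omega)), rfl⟩, rfl⟩

theorem IsRun.step {ρ : ℕ → Loc S C × ℝ≥0} (h : (B.watch n).IsRun a t ρ) (k : ℕ) :
    ∃ o r, B.Tr (ρ k).1 (a k) o (ρ (k + 1)).1 r := by
  obtain ⟨r, hr, -⟩ := h.succ k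
  exact ⟨_, r, hr⟩

theorem IsRun.dead {ρ : ℕ → Loc S C × ℝ≥0} (h : (B.watch n).IsRun a t ρ) {p k : ℕ}
    (hp : (ρ p).1 = .dead) (hk : p ≤ k) : (ρ k).1 = .dead := by
  induction k, hk using Nat.le_induction with
  | base => exact hp
  | succ k _ ih =>
    obtain ⟨o, r, hs⟩ := IsRun.step h k
    rw [ih] at hs
    generalize (ρ (k + 1)).1 = q at hs
    cases hs
    rfl

theorem IsRun.fin_or_dead {ρ : ℕ → Loc S C × ℝ≥0} (h : (B.watch n).IsRun a t ρ) {p k : ℕ}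
    (hp : (ρ p).1 = .fin) (hk : p ≤ k) :
    (ρ k).1 = .fin ∧ (∀ l, p ≤ l → l < k → a l ≠ .mark .super) ∨ (ρ k).1 = .dead := by
  induction k, hk using Nat.le_induction with
  | base => exact .inl ⟨hp, fun l h1 h2 => absurd h1 (not_le.2 h2)⟩
  | succ k _ ih =>
    rcases ih with ⟨ih, ha⟩ | ih
    · obtain ⟨o, r, hs⟩ := IsRun.step h k
      rw [ih] at hs
      generalize (ρ (k + 1)).1 = q at hs
      generalize hak : a k = ak at hs
      cases hs with
      | dead => exact .inr rfl
      | fin _ _ hne =>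
        refine .inl ⟨rfl, fun l h1 h2 => ?_⟩
        rcases (Nat.lt_succ_iff.1 h2).lt_or_eq with h3 | rfl
        exacts [ha l h1 h3, hak ▸ hne]
    · exact .inr (IsRun.dead h ih (Nat.le_succ k))

/-- Only `super_inf` cannot be refuted by a finite prefix. It also guarantees that later rows exist,
so the other clauses are refuted by reaching `bad` once it holds. -/
theorem good_or_error (ht : StrictMono t) (h : ¬ B.Good n a t) :
    (∃ p v, (B.watch n).Reach a t p (.bad, v)) ∨ ∃ N, ∀ p ≥ N, a p ≠ .mark .super := by
  by_contra! hc
  exact h (good_of_not_bad hc.1 ht hc.2)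

/-- Some run is eventually stuck with an error if and only if the word is not good. -/
theorem exists_run_iff (ht : StrictMono t) :
    (∃ ρ, (B.watch n).IsRun a t ρ ∧ ∀ N, ∃ k ≥ N, (ρ k).1 = .bad ∨ (ρ k).1 = .fin) ↔
      ¬ B.Good n a t := by
  constructor
  · rintro ⟨ρ, hρ, hacc⟩ hg
    have hnb : ∀ k, (ρ k).1 ≠ .bad := fun k => hg.not_bad ht (hρ.reach k)
    have hfin : ∀ N, ∃ k ≥ N, (ρ k).1 = .fin := fun N => by
      obtain ⟨k, hk, h⟩ := hacc N
      exact ⟨k, hk, h.resolve_left (hnb k)⟩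
    obtain ⟨p, -, hp⟩ := hfin 0
    obtain ⟨l, hl, hsup⟩ := hg.super_inf p
    obtain ⟨k, hk, hkf⟩ := hfin (l + 1)
    rcases IsRun.fin_or_dead hρ hp (show p ≤ k by omega) with h | h
    · exact h.2 l hl hk hsup
    · rw [hkf] at h; cases h
  · intro h
    rcases good_or_error ht h with ⟨p, v, hp⟩ | ⟨N, hN⟩
    · obtain ⟨ρ, hρ, hk⟩ := exists_run_bad hp
      exact ⟨ρ, hρ, fun N => ⟨max N p, le_max_left _ _, .inl (hk _ (le_max_right _ _))⟩⟩
    · obtain ⟨ρ, hρ, hk⟩ := exists_run_fin (B := B) (n := n) (t := t) hN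
      exact ⟨ρ, hρ, fun M => ⟨max M (N + 1), le_max_left _ _, .inr (hk _ (le_max_right _ _))⟩⟩

theorem Tr.home_inv {q : Loc S C} {l : Letter S C} {o : Ordering} {b r : Bool}
    (h : B.Tr q l o (.home b) r) : b = l.isSuper ∧ ∃ b', q = .home b' := by
  cases h with
  | home b' => exact ⟨rfl, b', rfl⟩

/-- All runs are infinitely often without error if and only if the word is good. -/
theorem forall_run_iff (ht : StrictMono t) :
    (∀ ρ, (B.watch n).IsRun a t ρ → ∀ N, ∃ k ≥ N, (ρ k).1 ≠ .bad ∧ (ρ k).1 ≠ .home false) ↔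
      B.Good n a t := by
  constructor
  · intro h
    by_contra hg
    rcases good_or_error ht hg with ⟨p, v, hp⟩ | ⟨N, hN⟩
    · obtain ⟨ρ, hρ, hk⟩ := exists_run_bad hp
      obtain ⟨k, hpk, h1, -⟩ := h ρ hρ p
      exact h1 (hk k hpk)
    · obtain ⟨ρ, hρ, hk⟩ := exists_run_home (B := B) (n := n) (a := a) (t := t)
      obtain ⟨k, hpk, -, h2⟩ := h ρ hρ (N + 1)
      obtain ⟨l, rfl⟩ : ∃ l, k = l + 1 := ⟨k - 1, by omega⟩
      refine h2 ?_
      rw [hk, Bool.eq_false_iff.2 fun hc => hN l (by omega) (Letter.isSuper_iff.1 hc)]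
  · intro hg ρ hρ N
    by_contra! hc
    -- As `bad` is unreachable over a good word, a run that is unsafe from `N` on stays in `home
    -- false`, which is impossible after the head of a `super` row.
    have hhome : ∀ k ≥ N, (ρ k).1 = .home false := fun k hk =>
      hc k hk (hg.not_bad ht (hρ.reach k))
    obtain ⟨l, hl, hsup⟩ := hg.super_inf N
    obtain ⟨o, r, hs⟩ := IsRun.step hρ l
    rw [hhome (l + 1) (by omega), hsup] at hs
    exact absurd hs.home_inv.1 (by simp [Letter.isSuper])

/-- Some word is good if and only if the halting state does not occur. -/
theorem exists_good_iff (hn : 0 < n) :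
    (∃ (a : ℕ → Letter S C) (t : ℕ → ℝ≥0), StrictMono t ∧ B.Good n a t) ↔ ¬ B.Halts n := by
  constructor
  · rintro ⟨a, t, ht, h⟩
    exact h.not_halts ht hn
  · intro h
    have hr := B.isRows_par n hn h
    exact ⟨_, _, IsRows.times_strictMono, hr.good_letters⟩

end CellAut

end TimedAut

namespace TimedAut

/-! ### From abstract automata to the syntax of timed automata -/

/-- The constraint that says how the clock compares with `c`. -/
def Guard.cmp (c : ℕ) : Ordering → Guard
  | .lt => .lt c
  | .eq => .and (.le c) (.neg (.lt c))
  | .gt => .neg (.le c)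

theorem Guard.sat_cmp (c : ℕ) (o : Ordering) (v : ℝ≥0) :
    (Guard.cmp c o).Sat v ↔ compare v (c : ℝ≥0) = o := by
  cases o with
  | lt => exact compare_lt_iff_lt.symm
  | eq =>
    rw [compare_eq_iff_eq]
    simp only [cmp, Sat, not_lt]
    exact le_antisymm_iff.symm
  | gt =>
    rw [compare_gt_iff_gt]
    simp [cmp, Sat]

theorem Guard.cmp_injective (c : ℕ) : Function.Injective (Guard.cmp c) := by
  intro o o' h
  cases o <;> cases o' <;> first | rfl | cases h

theorem Guard.exists_sat_cmp {c : ℕ} (hc : 0 < c) (o : Ordering) :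
    ∃ v, (Guard.cmp c o).Sat v := by
  simp only [sat_cmp]
  cases o with
  | lt => exact ⟨0, compare_lt_iff_lt.2 (by exact_mod_cast hc)⟩
  | eq => exact ⟨c, compare_eq_iff_eq.2 rfl⟩
  | gt => exact ⟨c + 1, compare_gt_iff_gt.2 (lt_add_one _)⟩

theorem TimedWord.delay_eq {m : ℕ} (w : TimedWord m) : w.delay = delayOf w.time := by
  funext k
  cases k <;> rfl

section encode

variable {Q L T : Type} {N M : ℕ} (e : Q ≃ Fin N) (f : L ≃ Fin M)

open Classical in
/-- The automaton with the transitions `g q a o`, where `o` is the result of the comparison of the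
clock with `bound q`. -/
noncomputable def encode (init : Q) (acc : Q → Prop) (bound : Q → ℕ)
    (g : Q → L → Ordering → List T) : Automaton T where
  numLocs := N
  numLetters := M
  init := e init
  acc := (Finset.univ.filter fun q => acc (e.symm q)).toList.map Fin.val
  -- `Option Bool` enumerates the three results of a comparison.
  rules := (Finset.univ : Finset ((Fin N × Fin M) × Option Bool)).toList.flatMap fun i =>
    let o := match i.2 with
      | none => Ordering.eq
      | some true => Ordering.lt
      | some false => Ordering.gt
    (g (e.symm i.1.1) (f.symm i.1.2) o).map fun x =>
      ⟨i.1.1, i.1.2, Guard.cmp (bound (e.symm i.1.1)) o, x⟩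

variable {init : Q} {acc : Q → Prop} {bound : Q → ℕ} {g : Q → L → Ordering → List T}

theorem mem_rules_encode {ρ : Rule T} : ρ ∈ (encode e f init acc bound g).rules ↔
    ∃ q a o, ∃ x ∈ g q a o, ρ = ⟨e q, f a, Guard.cmp (bound q) o, x⟩ := by
  simp only [encode, List.mem_flatMap, List.mem_map, Finset.mem_toList, Finset.mem_univ, true_and]
  constructor
  · rintro ⟨i, x, hx, rfl⟩
    exact ⟨_, _, _, x, hx, by simp⟩
  · rintro ⟨q, a, o, x, hx, rfl⟩
    refine ⟨((e q, f a), match o with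
      | .eq => none
      | .lt => some true
      | .gt => some false), x, ?_⟩
    cases o <;> simp [hx]

theorem mem_acc_encode {q : Q} : ((e q : ℕ) ∈ (encode e f init acc bound g).acc) ↔ acc q := by
  simp only [encode, List.mem_map, Finset.mem_toList, Finset.mem_filter, Finset.mem_univ, true_and]
  constructor
  · rintro ⟨x, hx, h⟩
    rw [Fin.val_injective h] at hx
    simpa using hx
  · intro h
    exact ⟨e q, by simpa using h, rfl⟩

theorem lt_of_mem_acc_encode {q : ℕ} (h : q ∈ (encode e f init acc bound g).acc) : q < N := by
  simp only [encode, List.mem_map] at h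
  obtain ⟨x, -, rfl⟩ := h
  exact x.2

/-- The number of a target. -/
def encodeTarget (y : Q × Bool) : ℕ × Bool := (e y.1, y.2)

end encode

/-- The disjunction (if `d = true`) or conjunction of a nonempty list of propositions. -/
def PosForm.bigOp (d : Bool) (x : ℕ × Bool) : List (ℕ × Bool) → PosForm
  | [] => .atom x.1 x.2
  | y :: l => cond d (.or (.atom x.1 x.2) (bigOp d y l)) (.and (.atom x.1 x.2) (bigOp d y l))

theorem PosForm.locsBelow_bigOp {m : ℕ} (d : Bool) {x : ℕ × Bool} {l : List (ℕ × Bool)}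
    (h : ∀ y ∈ x :: l, y.1 < m) : (bigOp d x l).LocsBelow m := by
  induction l generalizing x with
  | nil => exact h x (by simp)
  | cons y l ih =>
    have h1 : x.1 < m := h x (by simp)
    have h2 := ih (x := y) fun z hz => h z (List.mem_cons_of_mem _ hz)
    cases d <;> exact ⟨h1, h2⟩

theorem PosForm.conjFree_bigOp (x : ℕ × Bool) (l : List (ℕ × Bool)) :
    (bigOp true x l).ConjFree := by
  induction l generalizing x with
  | nil => trivial
  | cons y l ih => exact ⟨trivial, ih y⟩

/-! ### Nondeterministic and alternating automata with given transitions -/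

namespace RegAut

variable {Q L : Type} {N M : ℕ} (A : RegAut Q L) (e : Q ≃ Fin N) (f : L ≃ Fin M)
  (acc : Q → Prop)

/-- One chosen transition is put in front of the list `targets` of all of them, because `bigOp`
needs a first member. That it occurs twice does no harm. -/
noncomputable def target (q : Q) (a : L) (o : Ordering) : Q × Bool :=
  ((A.exists_tr q a o).choose, (A.exists_tr q a o).choose_spec.choose)

open Classical in
noncomputable def targets (q : Q) (a : L) (o : Ordering) : List (Q × Bool) :=
  (Finset.univ.filter fun y : Fin N × Bool => A.tr q a o (e.symm y.1) y.2).toList.map fun y =>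
    (e.symm y.1, y.2)

theorem mem_targets {q : Q} {a : L} {o : Ordering} {y : Q × Bool} :
    y ∈ A.target q a o :: A.targets e q a o ↔ A.tr q a o y.1 y.2 := by
  constructor
  · intro h
    rcases List.mem_cons.1 h with rfl | h
    · exact (A.exists_tr q a o).choose_spec.choose_spec
    · simp only [targets, List.mem_map, Finset.mem_toList, Finset.mem_filter, Finset.mem_univ,
        true_and] at h
      obtain ⟨x, hx, rfl⟩ := h
      exact hx
  · intro h
    refine List.mem_cons_of_mem _ ?_
    simp only [targets, List.mem_map, Finset.mem_toList, Finset.mem_filter, Finset.mem_univ,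
      true_and]
    exact ⟨(e y.1, y.2), by simpa using h, by simp⟩

noncomputable def toNTA : NTA :=
  encode e f A.init acc A.bound fun q a o =>
    (A.target q a o :: A.targets e q a o).map (encodeTarget e)

/-- The formula for the transitions from `q`. -/
noncomputable def formula (d : Bool) (q : Q) (a : L) (o : Ordering) : PosForm :=
  .bigOp d (encodeTarget e (A.target q a o)) ((A.targets e q a o).map (encodeTarget e))

noncomputable def toATA (d : Bool) : ATA :=
  encode e f A.init acc A.bound fun q a o => [A.formula e d q a o]

variable {A e f acc}

theorem mem_rules_toNTA {ρ : Rule (ℕ × Bool)} : ρ ∈ (A.toNTA e f acc).rules ↔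
    ∃ q a o q' r, A.tr q a o q' r ∧ ρ = ⟨e q, f a, Guard.cmp (A.bound q) o, (e q', r)⟩ := by
  rw [toNTA, mem_rules_encode]
  simp only [List.mem_map, mem_targets]
  constructor
  · rintro ⟨q, a, o, x, ⟨y, hy, rfl⟩, rfl⟩
    exact ⟨q, a, o, y.1, y.2, hy, rfl⟩
  · rintro ⟨q, a, o, q', r, h, rfl⟩
    exact ⟨q, a, o, _, ⟨(q', r), h, rfl⟩, rfl⟩

theorem mem_rules_toATA {d : Bool} {ρ : Rule PosForm} : ρ ∈ (A.toATA e f acc d).rules ↔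
    ∃ q a o, ρ = ⟨e q, f a, Guard.cmp (A.bound q) o, A.formula e d q a o⟩ := by
  rw [toATA, mem_rules_encode]
  simp only [List.mem_singleton, exists_eq_left]

theorem valid_toNTA : (A.toNTA e f acc).Valid where
  init_lt := (e A.init).2
  acc_lt _ h := lt_of_mem_acc_encode e f h
  rules_lt ρ h := by
    obtain ⟨q, a, o, q', r, -, rfl⟩ := mem_rules_toNTA.1 h
    exact ⟨(e q).2, (f a).2, (e q').2⟩

/-- For each location and letter there are exactly three guards, for the three outcomes of one
comparison, which makes them a partition. The constant must be positive, as no clock value is below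
`0`. -/
theorem valid_toATA (d : Bool) (hA : ∀ q, 0 < A.bound q) : (A.toATA e f acc d).Valid where
  init_lt := (e A.init).2
  acc_lt _ h := lt_of_mem_acc_encode e f h
  rules_lt ρ h := by
    obtain ⟨q, a, o, rfl⟩ := mem_rules_toATA.1 h
    refine ⟨(e q).2, (f a).2, PosForm.locsBelow_bigOp d fun y hy => ?_⟩
    rw [← List.map_cons, List.mem_map] at hy
    obtain ⟨z, -, rfl⟩ := hy
    exact (e z.1).2
  functional ρ h ρ' h' h1 h2 h3 := by
    obtain ⟨q, a, o, rfl⟩ := mem_rules_toATA.1 h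
    obtain ⟨q', a', o', rfl⟩ := mem_rules_toATA.1 h'
    obtain rfl := e.injective (Fin.val_injective h1)
    obtain rfl := f.injective (Fin.val_injective h2)
    obtain rfl := Guard.cmp_injective _ h3
    rfl
  guard_nonempty ρ h := by
    obtain ⟨q, a, o, rfl⟩ := mem_rules_toATA.1 h
    exact Guard.exists_sat_cmp (hA q) o
  partition q hq a ha v := by
    obtain ⟨q, rfl⟩ : ∃ q', (e q' : ℕ) = q := ⟨e.symm ⟨q, hq⟩, by simp⟩
    obtain ⟨a, rfl⟩ : ∃ a', (f a' : ℕ) = a := ⟨f.symm ⟨a, ha⟩, by simp⟩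
    refine ⟨Guard.cmp (A.bound q) (compare v (A.bound q : ℝ≥0)),
      ⟨⟨_, mem_rules_toATA.2 ⟨q, a, _, rfl⟩⟩, (Guard.sat_cmp _ _ _).2 rfl⟩, ?_⟩
    rintro σ ⟨⟨b, hb⟩, hσ⟩
    obtain ⟨q', a', o', h⟩ := mem_rules_toATA.1 hb
    obtain ⟨h1, h2, rfl, rfl⟩ := Rule.mk.inj h
    obtain rfl := e.injective (Fin.val_injective h1)
    rw [(Guard.sat_cmp _ _ _).1 hσ]

theorem purelyExistential_toATA : (A.toATA e f acc true).PurelyExistential := by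
  intro ρ h
  obtain ⟨q, a, o, rfl⟩ := mem_rules_toATA.1 h
  exact PosForm.conjFree_bigOp _ _

theorem toNTA_accepts (w : TimedWord M) : (A.toNTA e f acc).Accepts w ↔
    ∃ ρ, A.IsRun (fun k => f.symm (w.letter k)) w.time ρ ∧ ∀ K, ∃ k ≥ K, acc (ρ k).1 := by
  have hd : ∀ k, TimedWord.delay (m := (A.toNTA e f acc).numLetters) w k = delayOf w.time k :=
    fun k => congrFun w.delay_eq k
  constructor
  · rintro ⟨run, ⟨h0, hs⟩, hacc⟩
    have hlt : ∀ k, (run k).1 < N := by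
      rintro (_ | k)
      · rw [h0]; exact (e A.init).2
      · obtain ⟨ρ, hρ, -, -, -, h⟩ := hs k
        obtain ⟨q, a, o, q', r, -, rfl⟩ := mem_rules_toNTA.1 hρ
        rw [h]; exact (e q').2
    have hq : ∀ k q, (e q : ℕ) = (run k).1 → e.symm ⟨(run k).1, hlt k⟩ = q := fun k q h => by
      rw [e.symm_apply_eq]; exact Fin.ext h.symm
    refine ⟨fun k => (e.symm ⟨(run k).1, hlt k⟩, (run k).2), ⟨?_, fun k => ?_⟩, fun K => ?_⟩
    · have h1 : (run 0).1 = e A.init := by rw [h0]; rfl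
      have h2 : (run 0).2 = 0 := by rw [h0]
      exact Prod.ext (hq 0 _ h1.symm) h2
    · obtain ⟨ρ, hρ, h1, h2, h3, h4⟩ := hs k
      obtain ⟨q, a, o, q', r, htr, rfl⟩ := mem_rules_toNTA.1 hρ
      have ha : f.symm (w.letter k) = a := by
        rw [f.symm_apply_eq]; exact (Fin.ext h2).symm
      refine ⟨r, ?_, ?_⟩
      · rw [Guard.sat_cmp, hd] at h3
        simp only [hq k q h1, ha]
        rw [hq (k + 1) q' (by rw [h4])]
        rw [h3]
        exact htr
      · simp only
        rw [h4, hd]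
    · obtain ⟨k, hk, h⟩ := hacc K
      refine ⟨k, hk, ?_⟩
      obtain ⟨q, hq'⟩ : ∃ q, (e q : ℕ) = (run k).1 := ⟨e.symm ⟨_, hlt k⟩, by simp⟩
      simp only [hq k q hq']
      rw [← hq'] at h
      exact (mem_acc_encode e f).1 h
  · rintro ⟨ρ, ⟨h0, hs⟩, hacc⟩
    refine ⟨fun k => ((e (ρ k).1 : ℕ), (ρ k).2), ⟨?_, fun k => ?_⟩, fun K => ?_⟩
    · simp only [h0]; rfl
    · obtain ⟨r, htr, hv⟩ := hs k
      refine ⟨_, mem_rules_toNTA.2 ⟨_, _, _, _, _, htr, rfl⟩, rfl, by simp, ?_, ?_⟩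
      · rw [Guard.sat_cmp, hd]
      · simp only [hd, hv]
    · obtain ⟨k, hk, h⟩ := hacc K
      exact ⟨k, hk, (mem_acc_encode e f).2 h⟩

end RegAut

end TimedAut

namespace TimedAut

/-! ### Plays of the acceptance game -/

/-- The locations in the position are among `0, …, n - 1`. -/
def Pos.Below (n : ℕ) : Pos → Prop
  | .conf _ q _ => q < n
  | .form _ _ b => b.LocsBelow n

/-- Adam follows the strategy `s` in the play `π`. -/
def AdamFollows (s : List Pos → Bool) (π : ℕ → Pos) : Prop :=
  ∀ i k v b c, π i = .form k v (.and b c) →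
    π (i + 1) = .form k v (if s ((List.range (i + 1)).map π) then b else c)

theorem ATA.Valid.exists_move {A : ATA} (hA : A.Valid) (w : TimedWord A.numLetters) {p : Pos}
    (hp : p.Below A.numLocs) (d d' : Bool) : ∃ p', p'.Below A.numLocs ∧ A.Move w p p' ∧
      (∀ k v b c, p = .form k v (.or b c) → p' = .form k v (if d then b else c)) ∧
      ∀ k v b c, p = .form k v (.and b c) → p' = .form k v (if d' then b else c) := by
  cases p with
  | conf k q v =>
    obtain ⟨σ, ⟨⟨b, hb⟩, hσ⟩, -⟩ := hA.partition q hp (w.letter k) (w.letter k).2 (v + w.delay k)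
    exact ⟨.form k (v + w.delay k) b, (hA.rules_lt _ hb).2.2, .read k q v σ b hb hσ,
      fun _ _ _ _ h => (by cases h), fun _ _ _ _ h => (by cases h)⟩
  | form k v b =>
    cases b with
    | atom q r => exact ⟨.conf (k + 1) q (applyReset r v), hp, .atom k v q r,
        fun _ _ _ _ h => (by cases h), fun _ _ _ _ h => (by cases h)⟩
    | and b c => cases d' with
      | true => exact ⟨.form k v b, hp.1, .and_left k v b c,
          fun _ _ _ _ h => (by cases h), fun _ _ _ _ h => (by cases h; rfl)⟩
      | false => exact ⟨.form k v c, hp.2, .and_right k v b c,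
          fun _ _ _ _ h => (by cases h), fun _ _ _ _ h => (by cases h; rfl)⟩
    | or b c => cases d with
      | true => exact ⟨.form k v b, hp.1, .or_left k v b c,
          fun _ _ _ _ h => (by cases h; rfl), fun _ _ _ _ h => (by cases h)⟩
      | false => exact ⟨.form k v c, hp.2, .or_right k v b c,
          fun _ _ _ _ h => (by cases h; rfl), fun _ _ _ _ h => (by cases h)⟩

/-- By validity no position within range is a dead end, so a pair of strategies can be played
against each other forever. -/
theorem ATA.Valid.exists_play {A : ATA} (hA : A.Valid) (w : TimedWord A.numLetters)
    (s u : List Pos → Bool) : ∃ π, A.IsPlay w π ∧ Follows s π ∧ AdamFollows u π := by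
  choose f hf hmove hor hand using fun (p : {p : Pos // p.Below A.numLocs}) d d' =>
    hA.exists_move w p.2 d d'
  -- Strategies depend on the history, so the recursion carries it along with the current position.
  let σ : ℕ → List Pos × {p : Pos // p.Below A.numLocs} := fun i => Nat.rec
    ([], ⟨.conf 0 A.init 0, hA.init_lt⟩)
    (fun _ x => (x.1 ++ [x.2.1], ⟨f x.2 (s (x.1 ++ [x.2.1])) (u (x.1 ++ [x.2.1])), hf _ _ _⟩)) i
  have hσ : ∀ i, (List.range i).map (fun j => (σ j).2.1) = (σ i).1 := by
    intro i
    induction i with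
    | zero => rfl
    | succ i ih => rw [List.range_succ, List.map_append, ih]; rfl
  refine ⟨fun i => (σ i).2.1, ⟨rfl, fun i => hmove _ _ _⟩, fun i k v b c h => ?_,
    fun i k v b c h => ?_⟩
  · rw [hσ (i + 1)]
    exact hor (σ i).2 _ _ k v b c h
  · rw [hσ (i + 1)]
    exact hand (σ i).2 _ _ k v b c h

/-- Positions are numbered so that the number never decreases, and increases when a letter is
read. -/
def Pos.phase : Pos → ℕ
  | .conf k _ _ => 2 * k
  | .form k _ _ => 2 * k + 1

section

variable {A : ATA} {w : TimedWord A.numLetters} {π : ℕ → Pos}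

theorem ATA.IsPlay.monotone_phase (h : A.IsPlay w π) : Monotone fun i => (π i).phase := by
  refine monotone_nat_of_le_succ fun i => ?_
  have := h.2 i
  generalize π i = p at this
  generalize π (i + 1) = p' at this
  cases this <;> simp only [Pos.phase] <;> omega

/-- Leaving a configuration raises the phase strictly and it never decreases, so at most one
configuration occurs per letter. -/
theorem ATA.IsPlay.eq_of_conf (h : A.IsPlay w π) {i j k q q' : ℕ} {v v' : ℝ≥0}
    (hi : π i = .conf k q v) (hj : π j = .conf k q' v') : i = j := by
  have key : ∀ {i j q q' : ℕ} {v v' : ℝ≥0}, π i = .conf k q v → π j = .conf k q' v' →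
      ¬ i < j := by
    intro i j q q' v v' hi hj hij
    have h1 := h.2 i
    have h2 : (π (i + 1)).phase ≤ (π j).phase := h.monotone_phase hij
    rw [hi] at h1
    rw [hj] at h2
    generalize π (i + 1) = p' at h1 h2
    cases h1
    simp only [Pos.phase] at h2
    omega
  have h1 := key hi hj
  have h2 := key hj hi
  omega

end

/-- A play resolves a disjunction or conjunction of propositions to one of them, and to a given
one if the choices are made accordingly. -/
theorem ATA.IsPlay.exists_conf {A : ATA} {w : TimedWord A.numLetters} {π : ℕ → Pos}
    (h : A.IsPlay w π) {d : Bool} {i k : ℕ} {v : ℝ≥0} {x : ℕ × Bool} {l : List (ℕ × Bool)}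
    (hi : π i = .form k v (.bigOp d x l)) :
    ∃ j > i, ∃ y ∈ x :: l, π j = .conf (k + 1) y.1 (applyReset y.2 v) := by
  induction l generalizing i x with
  | nil =>
    refine ⟨i + 1, Nat.lt_succ_self i, x, by simp, ?_⟩
    have := h.2 i
    rw [hi] at this
    generalize π (i + 1) = p at this
    cases this
    rfl
  | cons y l ih =>
    have hnext : π (i + 1) = .form k v (.atom x.1 x.2) ∨ π (i + 1) = .form k v (.bigOp d y l) := by
      have := h.2 i
      rw [hi] at this
      generalize π (i + 1) = p at this
      cases d <;> cases this <;> first | exact .inl rfl | exact .inr rfl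
    rcases hnext with hn | hn
    · refine ⟨i + 1 + 1, by omega, x, by simp, ?_⟩
      have := h.2 (i + 1)
      rw [hn] at this
      generalize π (i + 1 + 1) = p at this
      cases this
      rfl
    · obtain ⟨j, hj, z, hz, h'⟩ := ih hn
      exact ⟨j, by omega, z, List.mem_cons_of_mem _ hz, h'⟩

/-- Choose the proposition `y k` in phase `k` if it is the next one. -/
noncomputable def steer (y : ℕ → ℕ × Bool) (h : List Pos) : Bool :=
  open Classical in
  match h.getLast? with
  | some (.form k _ (.or b _)) => decide (b = .atom (y k).1 (y k).2)
  | some (.form k _ (.and b _)) => decide (b = .atom (y k).1 (y k).2)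
  | _ => true

theorem ATA.IsPlay.exists_conf_steer {A : ATA} {w : TimedWord A.numLetters} {π : ℕ → Pos}
    (h : A.IsPlay w π) {d : Bool} {y : ℕ → ℕ × Bool}
    (hr : ∀ i k v x z l, π i = .form k v (.bigOp d x (z :: l)) → π (i + 1) =
      .form k v (if steer y ((List.range (i + 1)).map π) then .atom x.1 x.2 else .bigOp d z l))
    {i k : ℕ} {v : ℝ≥0} {x : ℕ × Bool} {l : List (ℕ × Bool)}
    (hi : π i = .form k v (.bigOp d x l)) (hy : y k ∈ x :: l) :
    ∃ j > i, π j = .conf (k + 1) (y k).1 (applyReset (y k).2 v) := by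
  have hatom : ∀ i, π i = .form k v (.atom (y k).1 (y k).2) →
      π (i + 1) = .conf (k + 1) (y k).1 (applyReset (y k).2 v) := fun i hi => by
    have := h.2 i
    rw [hi] at this
    generalize π (i + 1) = p at this
    cases this
    rfl
  induction l generalizing i x with
  | nil =>
    obtain rfl := List.mem_singleton.1 hy
    exact ⟨i + 1, Nat.lt_succ_self i, hatom i hi⟩
  | cons z l ih =>
    have hc : steer y ((List.range (i + 1)).map π) = true ↔ x = y k := by
      rw [List.range_succ, List.map_append, List.map_singleton, steer,
        List.getLast?_append_of_ne_nil _ (by simp), List.getLast?_singleton, hi]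
      cases d <;> simp [PosForm.bigOp, Prod.ext_iff]
    have hn := hr i k v x z l hi
    by_cases hx : x = y k
    · rw [if_pos (hc.2 hx), hx] at hn
      exact ⟨i + 1 + 1, by omega, hatom _ hn⟩
    · rw [if_neg fun h => hx (hc.1 h)] at hn
      obtain ⟨j, hj, h'⟩ := ih hn ((List.mem_cons.1 hy).resolve_left (Ne.symm hx))
      exact ⟨j, by omega, h'⟩

/-! ### Acceptance games with only disjunctions or only conjunctions -/

namespace RegAut

variable {Q L : Type} {N M : ℕ} {A : RegAut Q L} {e : Q ≃ Fin N} {f : L ≃ Fin M}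
  {acc : Q → Prop} {d : Bool} {w : TimedWord M} {π : ℕ → Pos}

/-- The position at which letter number `k` is read in the configuration `x`. -/
def toPos (e : Q ≃ Fin N) (k : ℕ) (x : Q × ℝ≥0) : Pos := .conf k (e x.1) x.2

/-- Reading a letter leaves no choice: the guard must be the actual outcome of the comparison, and
there is one formula for each outcome. -/
theorem form_of_toPos (h : (A.toATA e f acc d).IsPlay w π) {i k : ℕ} {x : Q × ℝ≥0}
    (hi : π i = toPos e k x) :
    π (i + 1) = .form k (x.2 + delayOf w.time k) (A.formula e d x.1 (f.symm (w.letter k))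
      (compare (x.2 + delayOf w.time k) (A.bound x.1 : ℝ≥0))) := by
  have hd : ∀ k, TimedWord.delay (m := (A.toATA e f acc d).numLetters) w k = delayOf w.time k :=
    fun k => congrFun w.delay_eq k
  have := h.2 i
  rw [hi] at this
  generalize π (i + 1) = p at this
  cases this with
  | read _ _ _ σ b hrule hsat =>
    obtain ⟨q, a, o, hρ⟩ := mem_rules_toATA.1 hrule
    obtain ⟨h1, h2, rfl, rfl⟩ := Rule.mk.inj hρ
    rw [hd] at hsat ⊢
    obtain rfl := e.injective (Fin.val_injective h1)
    have ha : f.symm (w.letter k) = a := by rw [f.symm_apply_eq]; exact Fin.ext h2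
    rw [ha, (Guard.sat_cmp _ _ _).1 hsat]

theorem exists_step (h : (A.toATA e f acc d).IsPlay w π) {i k : ℕ} {x : Q × ℝ≥0}
    (hi : π i = toPos e k x) : ∃ j > i, ∃ y, π j = toPos e (k + 1) y ∧
      A.Step (fun k => f.symm (w.letter k)) w.time k x y := by
  obtain ⟨j, hj, y, hy, h'⟩ := ATA.IsPlay.exists_conf h (form_of_toPos h hi)
  rw [← List.map_cons, List.mem_map] at hy
  obtain ⟨z, hz, rfl⟩ := hy
  exact ⟨j, by omega, (z.1, _), h', z.2, (A.mem_targets e).1 hz, rfl⟩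

/-- The game positions of a run have been reached one after the other. -/
theorem eveWins_iff (h : (A.toATA e f acc d).IsPlay w π) {ρ : ℕ → Q × ℝ≥0}
    (hρ : ∀ k, ∃ i, π i = toPos e k (ρ k)) :
    (A.toATA e f acc d).EveWins π ↔ ∀ K, ∃ k ≥ K, acc (ρ k).1 := by
  choose idx hidx using hρ
  have hmono : ∀ {k k'}, k < k' → idx k < idx k' := fun {k k'} hkk => by
    by_contra hc
    have h1 : (π (idx k')).phase ≤ (π (idx k)).phase := ATA.IsPlay.monotone_phase h (not_lt.1 hc)
    rw [hidx, hidx] at h1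
    simp only [toPos, Pos.phase] at h1
    omega
  constructor
  · intro hw K
    obtain ⟨i, hi, k, q, v, hp, hq⟩ := hw (idx K)
    obtain rfl := ATA.IsPlay.eq_of_conf h hp (hidx k)
    refine ⟨k, ?_, ?_⟩
    · by_contra hc
      have := hmono (not_le.1 hc)
      omega
    · rw [hidx] at hp
      obtain ⟨-, rfl, -⟩ := Pos.conf.inj hp
      exact (mem_acc_encode e f).1 hq
  · intro hacc K
    obtain ⟨k, hk, hq⟩ := hacc K
    have hid : k ≤ idx k := StrictMono.le_apply (f := idx) fun _ _ => hmono
    exact ⟨idx k, by omega, k, _, _, hidx k, (mem_acc_encode e f).2 hq⟩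

/-- Every play traces a run, whoever made the choices, since a formula can only be resolved to one
of the transitions it lists. -/
theorem exists_run_of_isPlay (h : (A.toATA e f acc d).IsPlay w π) :
    ∃ ρ, A.IsRun (fun k => f.symm (w.letter k)) w.time ρ ∧ ∀ k, ∃ i, π i = toPos e k (ρ k) := by
  obtain ⟨ρ, hρ, hp⟩ := Reach.exists_run (A := A) (a := fun k => f.symm (w.letter k))
    (t := w.time) .zero (fun k x => ∃ i, π i = toPos e k x) ⟨0, h.1⟩ (fun k _ x ⟨i, hi⟩ => by
      obtain ⟨j, -, y, hj, hs⟩ := exists_step h hi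
      exact ⟨y, hs, j, hj⟩)
  exact ⟨ρ, hρ, fun k => hp k (Nat.zero_le k)⟩

/-- A run can be followed by making the right choices. -/
theorem exists_toPos_of_isRun {ρ : ℕ → Q × ℝ≥0}
    (hρ : A.IsRun (fun k => f.symm (w.letter k)) w.time ρ) :
    ∃ y : ℕ → ℕ × Bool, ∀ π, (A.toATA e f acc d).IsPlay w π →
      (∀ i k v x z l, π i = .form k v (.bigOp d x (z :: l)) → π (i + 1) =
        .form k v (if steer y ((List.range (i + 1)).map π) then .atom x.1 x.2 else .bigOp d z l)) →
      ∀ k, ∃ i, π i = toPos e k (ρ k) := by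
  choose r htr hv using hρ.succ
  refine ⟨fun k => (e (ρ (k + 1)).1, r k), fun π h hr k => ?_⟩
  induction k with
  | zero => exact ⟨0, by rw [hρ.zero]; exact h.1⟩
  | succ k ih =>
    obtain ⟨i, hi⟩ := ih
    obtain ⟨j, -, hj⟩ := ATA.IsPlay.exists_conf_steer h hr (form_of_toPos h hi) (by
      rw [← List.map_cons, List.mem_map]
      exact ⟨((ρ (k + 1)).1, r k), (A.mem_targets e).2 (htr k), rfl⟩)
    exact ⟨j, by rw [hj, toPos, hv]⟩

/-- Eve resolves all formulas. A winning strategy gives a run through any play that follows it, and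
an accepting run is a strategy by way of `steer`. -/
theorem toATA_accepts_true (hA : ∀ q, 0 < A.bound q) (w : TimedWord M) :
    (A.toATA e f acc true).Accepts w ↔
      ∃ ρ, A.IsRun (fun k => f.symm (w.letter k)) w.time ρ ∧ ∀ K, ∃ k ≥ K, acc (ρ k).1 := by
  constructor
  · rintro ⟨s, hs⟩
    -- The second `s` is an arbitrary strategy of Adam, who never has to move.
    obtain ⟨π, hπ, hr, -⟩ :=
      (valid_toATA (e := e) (f := f) (acc := acc) true hA).exists_play w s s
    obtain ⟨ρ, hρ, hp⟩ := exists_run_of_isPlay hπ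
    exact ⟨ρ, hρ, (eveWins_iff hπ hp).1 (hs π hπ hr)⟩
  · rintro ⟨ρ, hρ, hacc⟩
    obtain ⟨y, hy⟩ := exists_toPos_of_isRun (e := e) (acc := acc) (d := true) hρ
    refine ⟨steer y, fun π hπ hf => (eveWins_iff hπ (hy π hπ fun i k v x z l hi =>
      hf i k v _ _ hi)).2 hacc⟩

/-- Adam resolves all formulas, so he can steer the play along any run, and Eve's strategy is
immaterial. -/
theorem toATA_accepts_false (hA : ∀ q, 0 < A.bound q) (w : TimedWord M) :
    (A.toATA e f acc false).Accepts w ↔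
      ∀ ρ, A.IsRun (fun k => f.symm (w.letter k)) w.time ρ → ∀ K, ∃ k ≥ K, acc (ρ k).1 := by
  constructor
  · rintro ⟨s, hs⟩ ρ hρ
    obtain ⟨y, hy⟩ := exists_toPos_of_isRun (e := e) (acc := acc) (d := false) hρ
    obtain ⟨π, hπ, hf, hr⟩ :=
      (valid_toATA (e := e) (f := f) (acc := acc) false hA).exists_play w s (steer y)
    exact (eveWins_iff hπ (hy π hπ fun i k v x z l hi => hr i k v _ _ hi)).1 (hs π hπ hf)
  · intro h
    refine ⟨fun _ => true, fun π hπ _ => ?_⟩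
    obtain ⟨ρ, hρ, hp⟩ := exists_run_of_isPlay hπ
    exact (eveWins_iff hπ hp).2 (h ρ hρ)

end RegAut

end TimedAut

namespace TimedAut

/-! ### Computability of the reduction -/

theorem primrec_guard_cmp (o : Ordering) : Primrec fun c => Guard.cmp c o := by
  have h4 : Primrec fun c : ℕ => 4 * c := Primrec.nat_mul.comp (.const 4) .id
  have hadd : ∀ {g : ℕ → ℕ} (k : ℕ), Primrec g → Primrec fun c => g c + k := fun k hg =>
    Primrec.nat_add.comp hg (.const k)
  rw [← Primrec.encode_iff]
  cases o with
  | lt => exact h4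
  | eq => exact hadd 3 (h4.comp (Primrec₂.natPair.comp (hadd 1 h4) (hadd 2 (h4.comp h4))))
  | gt => exact hadd 2 (h4.comp (hadd 1 h4))

theorem primrec_map_of_forall {α β : Type*} [Primcodable β] (l : List α) {F : α → ℕ → β}
    (h : ∀ x, Primrec (F x)) : Primrec fun n => l.map (F · n) := by
  induction l with
  | nil => exact .const []
  | cons x l ih => exact Primrec.list_cons.comp (h x) ih

theorem primrec_flatMap_of_forall {α β : Type*} [Primcodable β] (l : List α)
    {F : α → ℕ → List β} (h : ∀ x, Primrec (F x)) : Primrec fun n => l.flatMap (F · n) := by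
  induction l with
  | nil => exact .const []
  | cons x l ih =>
    simp only [List.flatMap_cons]
    exact Primrec.list_append.comp (h x) ih

/-- Locations, letters and transitions are fixed, however noncomputably they were obtained, and
count as constants; the parameter enters only through the guards of a list of rules of fixed shape.
-/
theorem primrec_encode {Q L T : Type} [Primcodable T] {N M : ℕ} (e : Q ≃ Fin N) (f : L ≃ Fin M)
    (init : Q) (acc : Q → Prop) {bound : ℕ → Q → ℕ} (g : Q → L → Ordering → List T)
    (hb : ∀ q, Primrec fun n => bound n q) :
    Primrec fun n => encode e f init acc (bound n) g := by
  have hr : Primrec fun n => (encode e f init acc (bound n) g).rules := by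
    refine primrec_flatMap_of_forall _ fun i => primrec_map_of_forall _ fun x => ?_
    exact (Primrec.of_equiv_symm (e := Rule.equivProd T)).comp
      (.pair (.const _) (.pair (.const _) (.pair ((primrec_guard_cmp _).comp (hb _)) (.const _))))
  exact (Primrec.of_equiv_symm (e := Automaton.equivProd T)).comp
    (.pair (.const N) (.pair (.const M) (.pair (.const _) (.pair (.const _) hr))))

/-- Reduction of a problem on natural numbers. -/
theorem DecidableOn.computablePred {α : Type} [Primcodable α] {C P : α → Prop}
    (h : DecidableOn C P) {F : ℕ → α} (hF : Computable F) (hC : ∀ n, C (F n)) {p : ℕ → Prop}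
    (hp : ∀ n, P (F n) ↔ p n) : ComputablePred p := by
  classical
  obtain ⟨f, hf, hspec⟩ := h
  refine ⟨inferInstance, (hf.comp hF).of_eq fun n => ?_⟩
  obtain ⟨b, hb, hbP⟩ := hspec (F n) (hC n)
  rw [Part.eq_some_iff.2 hb]
  exact congrArg Part.some
    (Bool.eq_iff_iff.2 ((hbP.trans (hp n)).trans decide_eq_true_iff.symm))

/-! ### Finiteness -/

instance (S : Type) [Finite S] : Finite (Kind S) :=
  Finite.of_surjective (fun x : S ⊕ Fin 3 => match x with
    | .inl s => Kind.step s
    | .inr 0 => .start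
    | .inr 1 => .last
    | .inr 2 => .super) fun k => by
  cases k with
  | start => exact ⟨.inr 0, rfl⟩
  | step s => exact ⟨.inl s, rfl⟩
  | last => exact ⟨.inr 1, rfl⟩
  | super => exact ⟨.inr 2, rfl⟩

instance (C : Type) [Finite C] : Finite (Cell C) :=
  Finite.of_surjective (fun x : Option (Bool × C) => match x with
    | none => Cell.off
    | some y => .on y.1 y.2) fun c => by
  cases c with
  | off => exact ⟨none, rfl⟩
  | on m c => exact ⟨some (m, c), rfl⟩

variable {S C : Type}

instance [Finite S] [Finite C] : Finite (Letter S C) :=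
  Finite.of_surjective (fun x : Kind S ⊕ Cell C => match x with
    | .inl k => Letter.mark k
    | .inr c => .cell c) fun a => by
  cases a with
  | mark k => exact ⟨.inl k, rfl⟩
  | cell c => exact ⟨.inr c, rfl⟩

instance [Finite S] [Finite C] : Finite (Loc S C) :=
  Finite.of_surjective (fun x : (Bool ⊕ Fin 7) ⊕ (Kind S × Option (Cell C) × Option (Cell C)) ⊕
      (Kind S × Cell C) ⊕ (Kind S × Option (Cell C)) ⊕ Kind S ⊕ Cell C => match x with
    | .inl (.inl b) => Loc.home b
    | .inl (.inr i) => ![.fin, .dead, .bad, .endRow, .endWait, .endCopy, .clk] i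
    | .inr (.inl (k, o, some c)) => .seen k o c
    | .inr (.inl (_, _, none)) => .bad
    | .inr (.inr (.inl (k, c))) => .body k c
    | .inr (.inr (.inr (.inl (k, o)))) => .walk k o
    | .inr (.inr (.inr (.inr (.inl k)))) => .head k
    | .inr (.inr (.inr (.inr (.inr c)))) => .wait c) fun q => by
  cases q with
  | home b => exact ⟨.inl (.inl b), rfl⟩
  | fin => exact ⟨.inl (.inr 0), rfl⟩
  | dead => exact ⟨.inl (.inr 1), rfl⟩
  | bad => exact ⟨.inl (.inr 2), rfl⟩
  | endRow => exact ⟨.inl (.inr 3), rfl⟩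
  | endWait => exact ⟨.inl (.inr 4), rfl⟩
  | endCopy => exact ⟨.inl (.inr 5), rfl⟩
  | clk => exact ⟨.inl (.inr 6), rfl⟩
  | seen k o c => exact ⟨.inr (.inl (k, o, some c)), rfl⟩
  | body k c => exact ⟨.inr (.inr (.inl (k, c))), rfl⟩
  | walk k o => exact ⟨.inr (.inr (.inr (.inl (k, o)))), rfl⟩
  | head k => exact ⟨.inr (.inr (.inr (.inr (.inl k)))), rfl⟩
  | wait c => exact ⟨.inr (.inr (.inr (.inr (.inr c)))), rfl⟩

/-! ### Correctness of the reduction -/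

namespace CellAut

variable (B : CellAut S C) (n : ℕ) {N M : ℕ} (e : Loc S C ≃ Fin N) (f : Letter S C ≃ Fin M)

/-- The locations in which an error has been found. -/
def Err (q : Loc S C) : Prop := q = .bad ∨ q = .fin

/-- The locations in which no error has been found. -/
def Safe (q : Loc S C) : Prop := q ≠ .bad ∧ q ≠ .home false

theorem primrec_bound_watch (q : Loc S C) : Primrec fun n => (B.watch (n + 1)).bound q := by
  cases q with
  | clk => exact .succ
  | _ => exact .const 1

theorem bound_watch_pos (q : Loc S C) : 0 < (B.watch (n + 1)).bound q := by
  cases q with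
  | clk => exact Nat.succ_pos n
  | _ => exact Nat.one_pos

/-- The transitions of `watch` do not depend on the constant, so those of `B.watch 0` can stand for
all of them. -/
theorem computable_toNTA : Computable fun n => (B.watch (n + 1)).toNTA e f Err :=
  (primrec_encode e f (.home false) Err (bound := fun n => (B.watch (n + 1)).bound)
    (fun q a o => ((B.watch 0).target q a o :: (B.watch 0).targets e q a o).map (encodeTarget e))
    B.primrec_bound_watch).to_comp

theorem computable_toATA (acc : Loc S C → Prop) (d : Bool) :
    Computable fun n => (B.watch (n + 1)).toATA e f acc d :=
  (primrec_encode e f (.home false) acc (bound := fun n => (B.watch (n + 1)).bound)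
    (fun q a o => [(B.watch 0).formula e d q a o]) B.primrec_bound_watch).to_comp

theorem exists_good_word_iff :
    (∃ w : TimedWord M, B.Good (n + 1) (fun k => f.symm (w.letter k)) w.time) ↔
      ¬ B.Halts (n + 1) := by
  rw [← exists_good_iff (Nat.succ_pos n)]
  constructor
  · rintro ⟨w, hw⟩
    exact ⟨_, _, w.time_strictMono, hw⟩
  · rintro ⟨a, t, ht, h⟩
    exact ⟨⟨fun k => f (a k), t, ht⟩, by simpa using h⟩

theorem universal_toNTA : ((B.watch (n + 1)).toNTA e f Err).Universal ↔ B.Halts (n + 1) := by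
  rw [← not_iff_not, ← B.exists_good_word_iff n f, ← not_iff_not, not_not, not_exists]
  exact forall_congr' fun w => (RegAut.toNTA_accepts w).trans (exists_run_iff w.time_strictMono)

theorem universal_toATA :
    ((B.watch (n + 1)).toATA e f Err true).Universal ↔ B.Halts (n + 1) := by
  rw [← not_iff_not, ← B.exists_good_word_iff n f, ← not_iff_not, not_not, not_exists]
  exact forall_congr' fun w => (RegAut.toATA_accepts_true (B.bound_watch_pos n) w).trans
    (exists_run_iff w.time_strictMono)

theorem empty_toATA : ((B.watch (n + 1)).toATA e f Safe false).Empty ↔ B.Halts (n + 1) := by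
  rw [← not_iff_not, ← B.exists_good_word_iff n f, ← not_iff_not, not_not, not_exists]
  exact forall_congr' fun w => not_congr <|
    (RegAut.toATA_accepts_false (B.bound_watch_pos n) w).trans (forall_run_iff w.time_strictMono)

end CellAut

end TimedAut

/-- Over infinite timed words with Büchi acceptance, for automata with one clock: universality is
undecidable for nondeterministic timed automata, both in the standard sense and as purely
existential alternating timed automata, and emptiness is undecidable for alternating timed
automata. -/
theorem mainTheorem5 :
    ¬ TimedAut.DecidableOn TimedAut.NTA.Valid TimedAut.NTA.Universal ∧
    ¬ TimedAut.DecidableOn (fun A : TimedAut.ATA => A.Valid ∧ A.PurelyExistential)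
        TimedAut.ATA.Universal ∧
    ¬ TimedAut.DecidableOn TimedAut.ATA.Valid TimedAut.ATA.Empty := by
  obtain ⟨S, C, _, _, B, hB⟩ := TimedAut.exists_undecidable_cellAut
  have e := Finite.equivFin (TimedAut.Loc S C)
  have f := Finite.equivFin (TimedAut.Letter S C)
  refine ⟨fun h => hB ?_, fun h => hB ?_, fun h => hB ?_⟩
  · exact h.computablePred (B.computable_toNTA e f) (fun _ => TimedAut.RegAut.valid_toNTA)
      fun n => B.universal_toNTA n e f
  · exact h.computablePred (B.computable_toATA e f _ true)
      (fun n => ⟨TimedAut.RegAut.valid_toATA true (B.bound_watch_pos n),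
        TimedAut.RegAut.purelyExistential_toATA⟩)
      fun n => B.universal_toATA n e f
  · exact h.computablePred (B.computable_toATA e f _ false)
      (fun n => TimedAut.RegAut.valid_toATA false (B.bound_watch_pos n))
      fun n => B.empty_toATA n e f
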